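/- Let $\mathbb R$ denote Cantor space $2^{\omega}$, with its Borel structure. All equivalence relations below are on $\mathbb R$. *Machines.* An infinite time Turing machine has finitely many states, among them three distinct states start, limit and halt, and three semi-infinite tapes (input, scratch, output) of cells holding $0$ or $1$; one head reads and writes the corresponding cells of the three tapes simultaneously. At successor ordinal stages it acts as an ordinary Turing machine (a head on the first cell told to move left stays there). At a limit stage it is in the limit state, the head is on the first cell, and each cell holds the $\limsup$ of its earlier values. The computation ceases when the halt state is entered, and the tapes do not change afterwards. A function $f:\mathbb R\to\mathbb R$ is *infinite time computable* if there are a machine and a real parameter $c$ such that, for every $x$, the machine on input $x\oplus c$ (with $x$ on the even cells and $c$ on the odd cells of the input tape) halts with $f(x)$ on its output tape. It is *eventually computable* if there are a machine and a real parameter $c$ such that, for every $x$, the output tape in the computation on input $x\oplus c$ shows $f(x)$ from some ordinal stage on, whether or not the machine halts. *Reducibility.* A reduction of $E$ to $F$ is a function $f:\mathbb R\to\mathbb R$ such that $x\mathrel E x'\iff f(x)\mathrel F f(x')$ for all $x,x'$. Write $E\le_B F$, $E\le_c F$, $E\le_e F$ if there is a reduction of $E$ to $F$ that is Borel, infinite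 time computable, eventually computable, respectively. *Enumerability.* A real $y$ codes the sequence of reals $(y)_n(m)=y(\langle n,m\rangle)$, where $\langle\cdot,\cdot\rangle$ is the standard pairing function on $\mathbb N$. The relation $E$ is *enumerable* (respectively *eventually enumerable*) if there is an infinite time computable (respectively eventually computable) function $f$ such that $\{(f(x))_n : n\in\mathbb N\}=[x]_E$ for every $x\in\mathbb R$. *The relation $E_\infty$.* An equivalence relation is countable Borel if it is Borel as a subset of $\mathbb R\times\mathbb R$ and all its classes are countable. $E_\infty$ denotes a $\le_B$-greatest countable Borel equivalence relation: it is countable Borel, and $F\le_B E_\infty$ for every countable Borel equivalence relation $F$. **Theorem.** Such a relation $E_\infty$ exists, and every such relation $E_\infty$ has the following properties. 1. $E_\infty$ is $\le_c$-greatest among the enumerable equivalence relations: $E_\infty$ is enumerable, and $E\le_c E_\infty$ for every enumerable equivalence relation $E$. 2. $E_\infty$ is $\le_e$-greatest among the eventually enumerable equivalence relations: $E_\infty$ is eventually enumerable, and $E\le_e E_\infty$ for every eventually enumerable equivalence relation $E$. -/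

import Mathlib

noncomputable section

/-- Cantor space, whose elements are called reals. It carries the product sigma-algebra, which is
its Borel sigma-algebra. -/
abbrev Real2 : Type := ℕ → Bool

/-- An infinite time Turing machine program: finitely many states, three tapes (`0` input,
`1` scratch, `2` output), one head reading and writing a cell of each tape at the same time. -/
structure ITTM where
  State : Type
  finite_state : Finite State
  start : State
  limit : State
  halt : State
  start_ne_halt : start ≠ halt
  limit_ne_halt : limit ≠ halt
  start_ne_limit : start ≠ limit
  /-- current state and the three symbols read ↦ new state, the three symbols written, and the
  direction in which the head moves -/
  trans : State → (Fin 3 → Bool) → State × (Fin 3 → Bool) × Turing.Dir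

namespace ITTM

/-- A complete configuration of the machine. -/
structure Config (M : ITTM) where
  state : M.State
  head : ℕ
  tape : Fin 3 → ℕ → Bool

variable (M : ITTM)

/-- The starting configuration: `x` is on the input tape, the other tapes are blank. -/
def init (x : Real2) : M.Config where
  state := M.start
  head := 0
  tape := fun i n => if i = 0 then x n else false

/-- The position of the head after a move on a semi-infinite tape; a head on the first cell that
is told to move left stays where it is. -/
def moveHead : Turing.Dir → ℕ → ℕ
  | Turing.Dir.left, n => n - 1
  | Turing.Dir.right, n => n + 1

open Classical in
/-- The configuration at a successor stage. A halted machine no longer changes. -/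
def next (c : M.Config) : M.Config :=
  if c.state = M.halt then c
  else
    let r := M.trans c.state (fun i => c.tape i c.head)
    { state := r.1
      head := moveHead r.2.2 c.head
      tape := fun i => Function.update (c.tape i) c.head (r.2.1 i) }

open Classical in
/-- The configuration at a limit stage `α`, given the configurations at all earlier stages: the
machine is in the limit state, the head is on the first cell, and each cell shows the `limsup` of
its earlier values. A machine that has halted at an earlier stage stays halted; its tapes have been
constant from then on, so that the `limsup` does not change them. -/
def limitConfig (α : Ordinal.{0}) (h : ∀ β : Ordinal.{0}, β < α → M.Config) : M.Config where
  state := if ∃ (β : Ordinal.{0}) (hβ : β < α), (h β hβ).state = M.halt then M.halt else M.limit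
  head := 0
  tape := fun i n =>
    decide (∀ β : Ordinal.{0}, β < α →
      ∃ (γ : Ordinal.{0}) (hγ : γ < α), β ≤ γ ∧ (h γ hγ).tape i n = true)

/-- The configuration at stage `α` of the computation on input `x`. -/
def run (x : Real2) (α : Ordinal.{0}) : M.Config :=
  Ordinal.limitRecOn α (M.init x) (fun _ c => M.next c) (fun β _ h => M.limitConfig β h)

/-- `φ_M(x) = y`: on input `x` the machine halts, with `y` on its output tape. -/
def Computes (x y : Real2) : Prop :=
  ∃ α : Ordinal.{0}, (M.run x α).state = M.halt ∧ (M.run x α).tape 2 = y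

/-- On input `x`, the output tape shows `y` from some stage on (whether or not the machine
halts). -/
def EventuallyComputes (x y : Real2) : Prop :=
  ∃ α : Ordinal.{0}, ∀ β : Ordinal.{0}, α ≤ β → (M.run x β).tape 2 = y

end ITTM

/-- The real that codes the pair `(x, c)`: `x` on the even cells and `c` on the odd cells. -/
def joinReal (x c : Real2) : Real2 :=
  fun n => if n % 2 = 0 then x (n / 2) else c (n / 2)

/-- `f` is infinite time computable, with a real parameter `c`. -/
def InfTimeComputable (f : Real2 → Real2) : Prop :=
  ∃ (M : ITTM) (c : Real2), ∀ x : Real2, M.Computes (joinReal x c) (f x)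

/-- `f` is eventually computable, with a real parameter `c`. -/
def EventuallyComputable (f : Real2 → Real2) : Prop :=
  ∃ (M : ITTM) (c : Real2), ∀ x : Real2, M.EventuallyComputes (joinReal x c) (f x)

/-- `f` is a reduction of the equivalence relation `E` to the equivalence relation `F`. -/
def IsReduction (E F : Setoid Real2) (f : Real2 → Real2) : Prop :=
  ∀ x y : Real2, E x y ↔ F (f x) (f y)

/-- Borel reducibility `E ≤_B F`. -/
def BorelReducible (E F : Setoid Real2) : Prop :=
  ∃ f : Real2 → Real2, Measurable f ∧ IsReduction E F f

/-- Infinite time computable reducibility `E ≤_c F`. -/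
def CompReducible (E F : Setoid Real2) : Prop :=
  ∃ f : Real2 → Real2, InfTimeComputable f ∧ IsReduction E F f

/-- Eventual reducibility `E ≤_e F`. -/
def EvtReducible (E F : Setoid Real2) : Prop :=
  ∃ f : Real2 → Real2, EventuallyComputable f ∧ IsReduction E F f

/-- The `n`-th real in the sequence of reals coded by `y`. -/
def decodeSeq (y : Real2) (n : ℕ) : Real2 :=
  fun m => y (Nat.pair n m)

/-- `f x` codes an enumeration of the equivalence class of `x`, for all `x`. -/
def IsEnumerator (E : Setoid Real2) (f : Real2 → Real2) : Prop :=
  ∀ x : Real2, Set.range (decodeSeq (f x)) = {y | E x y}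

/-- `E` is (infinite time) enumerable. -/
def Enumerable (E : Setoid Real2) : Prop :=
  ∃ f : Real2 → Real2, InfTimeComputable f ∧ IsEnumerator E f

/-- `E` is eventually enumerable. -/
def EventuallyEnumerable (E : Setoid Real2) : Prop :=
  ∃ f : Real2 → Real2, EventuallyComputable f ∧ IsEnumerator E f

/-- `E` is a countable Borel equivalence relation: it is Borel as a set of pairs, and every
equivalence class is countable. -/
def IsCountableBorel (E : Setoid Real2) : Prop :=
  MeasurableSet {p : Real2 × Real2 | E p.1 p.2} ∧ ∀ x : Real2, {y : Real2 | E x y}.Countable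

/-- `E` is (a version of) `E_∞`: a `≤_B`-greatest countable Borel equivalence relation. -/
def IsEInfty (E : Setoid Real2) : Prop :=
  IsCountableBorel E ∧ ∀ F : Setoid Real2, IsCountableBorel F → BorelReducible F E

end

/-! An enumeration of the classes of E, of whatever complexity, gives a reduction of the same
complexity to one fixed countable Borel relation. Words over the natural numbers act by shifts on
reals that code families indexed by words, and `shiftSetoid` relates two reals if each is a shift of
the other. If the maps `g n` enumerate the classes of E, send x to the table of all iterates of the
`g n` along words, applied to x. Shifting the table of x by w gives the table of the w-th iterate of
x, so this is a reduction (`isReduction_iterateTable`). For a countable Borel relation the `g n` can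
be chosen Borel by Lusin–Novikov (`graphSmall_of_countable_sections`). Hence `shiftSetoid` is an
E_∞, and every E_∞ has a Borel enumerator. If E is enumerable or eventually enumerable, its table
map is followed by a Borel reduction of `shiftSetoid` to the given E_∞.

It remains to see that the computable and the eventually computable functions contain the Borel
functions and are closed under composition and countable packing. Composition is the difficulty: an
eventually computed output may change many times before it settles, so the next computation must be
able to start anew. The intermediate notion `Realizable` is designed for this. A countable network
of cells evolves in ordinal time, each cell coming on by an open condition on input and cells and
taking the limsup at limits; whenever the input signal settles at x, the output settles at f x. For
this notion the closure properties are direct (`Realizable.comp`, `Realizable.pack`,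
`Measurable.realizable`).

Two translations connect networks with machines. A network simulates a machine and restarts the
simulation when its input changes (`ITTM.realizable`). Conversely, one universal machine, whose
parameter lists the finite conditions that make up the open update rule, carries out a network step
in ω + ω stages (`OpenNetwork.exists_parameter`). Halting corresponds to all cells coming to rest,
the clause guarded by `S`; `restStep` detects this rest. Thus `Realizable True` amounts to
computability and `Realizable False` to eventual computability. -/

noncomputable section

/-! ### Lusin–Novikov for countable sections, by a fusion argument -/

/-- A set of pairs is graph-small if it is covered by the graphs of countably many Borel functions. -/
def GraphSmall (C : Set (Real2 × Real2)) : Prop :=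
  ∃ g : ℕ → Real2 → Real2, (∀ n, Measurable (g n)) ∧ ∀ p ∈ C, ∃ n, p.2 = g n p.1

theorem GraphSmall.mono {C D : Set (Real2 × Real2)} (hD : GraphSmall D) (h : C ⊆ D) :
    GraphSmall C := by
  obtain ⟨g, hg, hg'⟩ := hD
  exact ⟨g, hg, fun p hp => hg' p (h hp)⟩

theorem graphSmall_iUnion {ι : Type*} [Countable ι] {C : ι → Set (Real2 × Real2)}
    (h : ∀ i, GraphSmall (C i)) : GraphSmall (⋃ i, C i) := by
  choose g hg hg' using h
  rcases isEmpty_or_nonempty ι with hι | hι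
  · exact ⟨fun _ => id, fun _ => measurable_id, by simp⟩
  obtain ⟨e, he⟩ := exists_surjective_nat (ι × ℕ)
  refine ⟨fun k => g (e k).1 (e k).2, fun k => hg _ _, fun p hp => ?_⟩
  obtain ⟨i, hi⟩ := Set.mem_iUnion.1 hp
  obtain ⟨n, hn⟩ := hg' i p hi
  obtain ⟨k, hk⟩ := he (i, n)
  exact ⟨k, by simpa only [hk] using hn⟩

theorem GraphSmall.union {C D : Set (Real2 × Real2)} (hC : GraphSmall C) (hD : GraphSmall D) :
    GraphSmall (C ∪ D) := by
  rw [Set.union_eq_iUnion]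
  exact graphSmall_iUnion (by rintro (_ | _) <;> assumption)

theorem graphSmall_empty : GraphSmall ∅ :=
  ⟨fun _ => id, fun _ => measurable_id, by simp⟩

/-- An analytic set with at most one point in each section is covered by a Borel graph. -/
theorem graphSmall_of_functional {φ : (ℕ → ℕ) → Real2 × Real2} (hφ : Continuous φ)
    {N : Set (ℕ → ℕ)} (hN : MeasurableSet N)
    (hf : ∀ p ∈ φ '' N, ∀ q ∈ φ '' N, p.1 = q.1 → p.2 = q.2) : GraphSmall (φ '' N) := by
  have key : ∀ m : ℕ, ∃ C : Set Real2, MeasurableSet C ∧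
      ∀ p ∈ φ '' N, (p.1 ∈ C ↔ p.2 m = true) := by
    intro m
    have han : ∀ b : Bool,
        MeasureTheory.AnalyticSet (Prod.fst '' (φ '' N ∩ {p : Real2 × Real2 | p.2 m = b})) := by
      intro b
      rw [← Set.image_inter_preimage]
      exact ((hN.inter (hφ.measurable (measurableSet_eq_fun ((measurable_pi_apply m).comp
        measurable_snd) measurable_const))).analyticSet_image hφ.measurable).image_of_continuous
        continuous_fst
    -- Points of the image over the same x coincide, so the two analytic projections are disjoint
    -- and Lusin separation applies; the separating Borel set computes bit m of the second
    -- coordinate.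
    obtain ⟨u, hu1, hu2, hu3⟩ := (han true).measurablySeparable (han false) (by
      rw [Set.disjoint_left]
      rintro x ⟨p, ⟨hp, hp'⟩, rfl⟩ ⟨q, ⟨hq, hq'⟩, hqp⟩
      have := hf q hq p hp hqp
      simp only [Set.mem_ofPred_eq] at hp' hq'
      rw [this, hp'] at hq'
      exact absurd hq' (by simp))
    refine ⟨u, hu3, fun p hp => ⟨fun h => ?_, fun h => hu1 ⟨p, ⟨hp, h⟩, rfl⟩⟩⟩
    by_contra hne
    exact Set.disjoint_left.1 hu2 ⟨p, ⟨hp, by simpa using hne⟩, rfl⟩ h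
  choose C hC hC' using key
  classical
  refine ⟨fun _ x m => decide (x ∈ C m), fun _ => ?_, fun p hp => ⟨0, ?_⟩⟩
  · refine measurable_pi_lambda _ fun m => ?_
    refine measurable_to_bool ?_
    have : (fun x => decide (x ∈ C m)) ⁻¹' {true} = C m := by ext; simp
    rw [this]; exact hC m
  · funext m
    by_cases h : p.2 m = true
    · simp [h, (hC' m p hp).2 h]
    · simp [h, (hC' m p hp)]

section Fusion

variable (φ : (ℕ → ℕ) → Real2 × Real2)

/-- The part of the image of `U` that lies over `B`. -/
def imageOver (U : Set (ℕ → ℕ)) (B : Set Real2) : Set (Real2 × Real2) :=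
  φ '' U ∩ Prod.fst ⁻¹' B

/-- `R` is covered by countably many Borel sets, over each of which the image of some member of
`𝒰` is small. -/
def Thin (𝒰 : Set (Set (ℕ → ℕ))) (R : Set Real2) : Prop :=
  ∃ B : ℕ → Set Real2, (∀ k, MeasurableSet (B k)) ∧ R ⊆ ⋃ k, B k ∧
    ∀ k, ∃ U ∈ 𝒰, GraphSmall (imageOver φ U (B k))

variable {φ}

theorem thin_of_countable_cover {ι : Type*} [Countable ι] [Nonempty ι]
    {𝒰 : Set (Set (ℕ → ℕ))} {R : Set Real2} (B : ι → Set Real2) (hB : ∀ i, MeasurableSet (B i))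
    (hR : R ⊆ ⋃ i, B i) (h : ∀ i, ∃ U ∈ 𝒰, GraphSmall (imageOver φ U (B i))) : Thin φ 𝒰 R := by
  obtain ⟨e, he⟩ := exists_surjective_nat ι
  exact ⟨fun k => B (e k), fun k => hB _, by rwa [he.iUnion_comp B], fun k => h _⟩

theorem Thin.of_iUnion {ι : Type*} [Countable ι] [Nonempty ι] {𝒰 : Set (Set (ℕ → ℕ))}
    {R : Set Real2} {S : ι → Set Real2} (hR : R ⊆ ⋃ i, S i) (h : ∀ i, Thin φ 𝒰 (S i)) :
    Thin φ 𝒰 R := by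
  choose B hB hS hU using h
  refine thin_of_countable_cover (ι := ι × ℕ) (fun p => B p.1 p.2) (fun p => hB _ _) ?_
    (fun p => hU _ _)
  intro x hx
  obtain ⟨i, hi⟩ := Set.mem_iUnion.1 (hR hx)
  obtain ⟨k, hk⟩ := Set.mem_iUnion.1 (hS i hi)
  exact Set.mem_iUnion.2 ⟨(i, k), hk⟩

theorem thin_of_graphSmall {𝒰 : Set (Set (ℕ → ℕ))} {U : Set (ℕ → ℕ)} (hU : U ∈ 𝒰)
    {R : Set Real2} (hR : MeasurableSet R) (h : GraphSmall (imageOver φ U R)) : Thin φ 𝒰 R :=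
  ⟨fun _ => R, fun _ => hR, Set.subset_iUnion_of_subset 0 subset_rfl, fun _ => ⟨U, hU, h⟩⟩

theorem imageOver_iUnion {ι : Type*} (U : Set (ℕ → ℕ)) (B : ι → Set Real2) :
    imageOver φ U (⋃ i, B i) = ⋃ i, imageOver φ U (B i) := by
  simp [imageOver, Set.preimage_iUnion, Set.inter_iUnion]

/-- If `R` is thin for `𝒱` enlarged by `𝒲`, then off a Borel set that is thin for `𝒱` the set `R`
is covered by Borel sets over which the members of `𝒲` are small. -/
theorem Thin.decompose {𝒲 𝒱 : Set (Set (ℕ → ℕ))} {R : Set Real2} (h : Thin φ (𝒲 ∪ 𝒱) R) :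
    ∃ L : Set Real2, MeasurableSet L ∧ (L = ∅ ∨ Thin φ 𝒱 L) ∧
      ∃ J : ℕ → Set Real2, (∀ k, MeasurableSet (J k)) ∧ R \ L ⊆ ⋃ k, J k ∧
        ∀ k, J k = ∅ ∨ ∃ W ∈ 𝒲, GraphSmall (imageOver φ W (J k)) := by
  classical
  obtain ⟨B, hB, hR, hU⟩ := h
  let P : ℕ → Prop := fun k => ∃ U ∈ 𝒱, GraphSmall (imageOver φ U (B k))
  refine ⟨⋃ k : {k // P k}, B k, MeasurableSet.iUnion fun k => hB _, ?_,
    fun k => if P k then ∅ else B k, fun k => ?_, ?_, fun k => ?_⟩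
  · rcases isEmpty_or_nonempty {k // P k} with he | he
    · left; simp
    · right
      exact thin_of_countable_cover (fun k : {k // P k} => B k) (fun k => hB _) subset_rfl
        (fun k => k.2)
  · dsimp only
    split_ifs
    exacts [MeasurableSet.empty, hB k]
  · rintro x ⟨hx, hx'⟩
    obtain ⟨k, hk⟩ := Set.mem_iUnion.1 (hR hx)
    have hk' : ¬ P k := fun h => hx' (Set.mem_iUnion.2 ⟨⟨k, h⟩, hk⟩)
    exact Set.mem_iUnion.2 ⟨k, by simp [hk', hk]⟩
  · by_cases hk : P k
    · simp [hk]
    · right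
      obtain ⟨U, hU1, hU2⟩ := hU k
      rcases hU1 with h1 | h1
      · exact ⟨U, h1, by simpa [hk] using hU2⟩
      · exact absurd ⟨U, h1, hU2⟩ hk

/-- Countably many sets that are empty or thin, together with a Borel remainder over which a
further set is small, make a thin set. -/
theorem thin_insert_of_diff {ι : Type*} [Countable ι] [Nonempty ι] {U : Set (ℕ → ℕ)}
    {𝒱 : Set (Set (ℕ → ℕ))} {R : Set Real2} (hR : MeasurableSet R) {L : ι → Set Real2}
    (hL : ∀ i, MeasurableSet (L i)) (hL' : ∀ i, L i = ∅ ∨ Thin φ 𝒱 (L i))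
    (h : GraphSmall (imageOver φ U (R \ ⋃ i, L i))) : Thin φ (insert U 𝒱) R := by
  have hthin : ∀ o : Option ι, Thin φ (insert U 𝒱) (o.elim (R \ ⋃ i, L i) L) := by
    rintro (_ | i)
    · exact thin_of_graphSmall (Set.mem_insert _ _) (hR.diff (MeasurableSet.iUnion hL)) h
    · rcases hL' i with h0 | ⟨B, h1, h2, h3⟩
      · simp only [Option.elim, h0]
        refine thin_of_graphSmall (Set.mem_insert _ _) MeasurableSet.empty ?_
        exact graphSmall_empty.mono (by simp [imageOver])
      · exact ⟨B, h1, h2, fun k => (h3 k).imp fun V hV => ⟨Set.mem_insert_of_mem _ hV.1, hV.2⟩⟩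
  refine Thin.of_iUnion ?_ hthin
  intro x hx
  by_cases hx' : x ∈ ⋃ i, L i
  · obtain ⟨i, hi⟩ := Set.mem_iUnion.1 hx'
    exact Set.mem_iUnion.2 ⟨some i, hi⟩
  · exact Set.mem_iUnion.2 ⟨none, hx, hx'⟩

/-- The pieces of U with `z n = k` are countably many and cover U. If every replacement by a piece
were thin, then off countably many thin Borel sets the image of U would be a countable union of
small sets, making the original family thin. -/
theorem exists_shrink {U : Set (ℕ → ℕ)} {𝒱 : Set (Set (ℕ → ℕ))} {R : Set Real2}
    (hR : MeasurableSet R) (h : ¬ Thin φ (insert U 𝒱) R) (n : ℕ) :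
    ∃ k, ¬ Thin φ (insert (U ∩ {z | z n = k}) 𝒱) R := by
  by_contra hcon
  push Not at hcon
  have hd := fun k => Thin.decompose (𝒲 := {U ∩ {z | z n = k}}) (𝒱 := 𝒱)
    (by rw [Set.singleton_union]; exact hcon k)
  choose L hL hL' J hJ hRJ hJ' using hd
  refine h (thin_insert_of_diff hR hL hL' ?_)
  have : GraphSmall (⋃ k, ⋃ j, imageOver φ (U ∩ {z | z n = k}) (J k j)) := by
    refine graphSmall_iUnion fun k => graphSmall_iUnion fun j => ?_
    rcases hJ' k j with h0 | ⟨W, rfl, hW⟩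
    · rw [h0]; exact graphSmall_empty.mono (by simp [imageOver])
    · exact hW
  refine this.mono ?_
  rintro _ ⟨⟨z, hz, rfl⟩, hzR⟩
  have h1 : (φ z).1 ∈ R \ L (z n) := ⟨hzR.1, fun h => hzR.2 (Set.mem_iUnion.2 ⟨_, h⟩)⟩
  obtain ⟨j, hj⟩ := Set.mem_iUnion.1 (hRJ _ h1)
  exact Set.mem_iUnion.2 ⟨z n, Set.mem_iUnion.2 ⟨j, ⟨z, ⟨hz, rfl⟩, rfl⟩, hj⟩⟩

/-- If no coordinate m of the second component could be used for splitting, then off a thin part the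
base would be covered, for each m, by Borel sets over which one of the two halves is small. Outside
these small halves every bit of the second component is determined by the first, so what is left is
a graph. -/
theorem exists_split (hφ : Continuous φ) {U : Set (ℕ → ℕ)} (hU : MeasurableSet U)
    {𝒱 : Set (Set (ℕ → ℕ))} {R : Set Real2}
    (hR : MeasurableSet R) (h : ¬ Thin φ (insert U 𝒱) R) :
    ∃ m, ¬ Thin φ (insert (U ∩ {z | (φ z).2 m = false})
      (insert (U ∩ {z | (φ z).2 m = true}) 𝒱)) R := by
  by_contra hcon
  push Not at hcon
  have hd := fun m => Thin.decompose
    (𝒲 := {U ∩ {z | (φ z).2 m = false}, U ∩ {z | (φ z).2 m = true}}) (𝒱 := 𝒱)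
    (by rw [Set.insert_union, Set.singleton_union]; exact hcon m)
  choose L hL hL' J hJ hRJ hJ' using hd
  refine h (thin_insert_of_diff hR hL hL' ?_)
  have hb : ∀ m j, ∃ b : Bool, GraphSmall (imageOver φ (U ∩ {z | (φ z).2 m = b}) (J m j)) := by
    intro m j
    rcases hJ' m j with h0 | ⟨W, hW, hW'⟩
    · rw [h0]; exact ⟨true, graphSmall_empty.mono (by simp [imageOver])⟩
    · rcases hW with rfl | hW
      · exact ⟨false, hW'⟩
      · rw [Set.mem_singleton_iff] at hW
        subst hW
        exact ⟨true, hW'⟩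
  choose b hb using hb
  -- `N` collects the points that avoid every small half: over `J m j` their bit m is the opposite
  -- of `b m j`.
  let N : Set (ℕ → ℕ) := U ∩ {z | (φ z).1 ∈ R \ ⋃ m, L m} ∩
    ⋂ m, ⋂ j, {z | (φ z).1 ∈ J m j → (φ z).2 m ≠ b m j}
  have hm1 : Measurable fun z => (φ z).1 := measurable_fst.comp hφ.measurable
  have hm2 : Measurable fun z => (φ z).2 := measurable_snd.comp hφ.measurable
  have hN : MeasurableSet N := by
    refine (hU.inter (hm1 (hR.diff (MeasurableSet.iUnion hL)))).inter
      (MeasurableSet.iInter fun m => MeasurableSet.iInter fun j => ?_)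
    refine MeasurableSet.imp (hm1 (hJ m j)) ?_
    exact ((measurable_pi_apply m).comp hm2) (measurableSet_singleton (b m j)).compl
  have hsmall : GraphSmall (φ '' N) := by
    refine graphSmall_of_functional hφ hN ?_
    rintro _ ⟨z, hz, rfl⟩ _ ⟨w, hw, rfl⟩ hzw
    by_contra hne
    obtain ⟨m, hm⟩ := Function.ne_iff.1 hne
    have h1 : (φ z).1 ∈ R \ L m := ⟨hz.1.2.1, fun h => hz.1.2.2 (Set.mem_iUnion.2 ⟨_, h⟩)⟩
    obtain ⟨j, hj⟩ := Set.mem_iUnion.1 (hRJ _ h1)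
    have h2 := Set.mem_iInter.1 (Set.mem_iInter.1 hz.2 m) j hj
    have h3 := Set.mem_iInter.1 (Set.mem_iInter.1 hw.2 m) j (hzw ▸ hj)
    revert h2 h3 hm
    cases (φ z).2 m <;> cases (φ w).2 m <;> cases b m j <;> simp
  have : GraphSmall (φ '' N ∪ ⋃ m, ⋃ j, imageOver φ (U ∩ {z | (φ z).2 m = b m j}) (J m j)) :=
    hsmall.union (graphSmall_iUnion fun m => graphSmall_iUnion fun j => hb m j)
  refine this.mono ?_
  rintro _ ⟨⟨z, hz, rfl⟩, hzR⟩
  by_cases hzN : z ∈ N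
  · exact Or.inl ⟨z, hzN, rfl⟩
  · right
    have : ¬ z ∈ ⋂ m, ⋂ j, {z | (φ z).1 ∈ J m j → (φ z).2 m ≠ b m j} :=
      fun h => hzN ⟨⟨hz, hzR⟩, h⟩
    simp only [Set.mem_iInter, Set.mem_ofPred_eq, not_forall, not_not] at this
    obtain ⟨m, j, hj, hbj⟩ := this
    exact Set.mem_iUnion.2 ⟨m, Set.mem_iUnion.2 ⟨j, ⟨z, ⟨hz, hbj⟩, rfl⟩, hj⟩⟩

theorem exists_shrink_base {𝒰 : Set (Set (ℕ → ℕ))} {R : Set Real2} (h : ¬ Thin φ 𝒰 R) (n : ℕ) :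
    ∃ b : Bool, ¬ Thin φ 𝒰 (R ∩ {x | x n = b}) := by
  by_contra hcon
  push Not at hcon
  exact h (Thin.of_iUnion (S := fun b => R ∩ {x | x n = b})
    (fun x hx => Set.mem_iUnion.2 ⟨x n, hx, rfl⟩) hcon)

theorem exists_mem_of_not_thin {𝒰 : Set (Set (ℕ → ℕ))} {R : Set Real2} (hR : MeasurableSet R)
    (h : ¬ Thin φ 𝒰 R) {U : Set (ℕ → ℕ)} (hU : U ∈ 𝒰) : ∃ z ∈ U, (φ z).1 ∈ R := by
  by_contra hcon
  push Not at hcon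
  refine h (thin_of_graphSmall hU hR (graphSmall_empty.mono ?_))
  rintro _ ⟨⟨z, hz, rfl⟩, hzR⟩
  exact absurd hzR (hcon z hz)

/-- The relation between a set and its two halves in the fusion construction. -/
def SplitInto (φ : (ℕ → ℕ) → Real2 × Real2) (n : ℕ) (U : Set (ℕ → ℕ))
    (V : Bool → Set (ℕ → ℕ)) : Prop :=
  (∀ b, MeasurableSet (V b) ∧ V b ⊆ U ∧ ∃ k, ∀ z ∈ V b, z n = k) ∧
    ∃ m, ∀ b, ∀ z ∈ V b, (φ z).2 m = b

theorem exists_splitInto (hφ : Continuous φ) {U : Set (ℕ → ℕ)} (hU : MeasurableSet U)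
    {𝒱 : Set (Set (ℕ → ℕ))} {R : Set Real2}
    (hR : MeasurableSet R) (h : ¬ Thin φ (insert U 𝒱) R) (n : ℕ) :
    ∃ V, SplitInto φ n U V ∧ ¬ Thin φ (Set.range V ∪ 𝒱) R := by
  obtain ⟨m, hm⟩ := exists_split hφ hU hR h
  obtain ⟨k, hk⟩ := exists_shrink hR hm n
  rw [Set.insert_comm] at hk
  obtain ⟨l, hl⟩ := exists_shrink hR hk n
  have hmeas : ∀ b k, MeasurableSet (U ∩ {z | (φ z).2 m = b} ∩ {z : ℕ → ℕ | z n = k}) := by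
    intro b k
    exact (hU.inter (measurableSet_eq_fun ((measurable_pi_apply m).comp
      (measurable_snd.comp hφ.measurable)) measurable_const)).inter
      (measurableSet_eq_fun (measurable_pi_apply n) measurable_const)
  refine ⟨fun b => U ∩ {z | (φ z).2 m = b} ∩ {z : ℕ → ℕ | z n = if b then l else k},
    ⟨fun b => ⟨hmeas _ _, fun z hz => hz.1.1, _, fun z hz => hz.2⟩, m, fun b z hz => hz.1.2⟩, ?_⟩
  rw [Bool.range_eq]
  simpa [Set.insert_union, Set.insert_comm] using hl

/-- The members are split one at a time, `T` being the set of indices already treated. All others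
stay in the family meanwhile, so that largeness over one common base is kept; this is what later
puts all branches over the same x. -/
theorem exists_splitInto_family (hφ : Continuous φ) {ι : Type} [Finite ι]
    {U : ι → Set (ℕ → ℕ)} (hU : ∀ i, MeasurableSet (U i)) {R : Set Real2} (hR : MeasurableSet R)
    (h : ¬ Thin φ (Set.range U) R) (n : ℕ) :
    ∃ V : ι → Bool → Set (ℕ → ℕ), (∀ i, SplitInto φ n (U i) (V i)) ∧
      ¬ Thin φ (Set.range fun p : ι × Bool => V p.1 p.2) R := by
  classical
  have := Fintype.ofFinite ι
  suffices H : ∀ T : Finset ι, ∃ V : ι → Bool → Set (ℕ → ℕ), (∀ i ∈ T, SplitInto φ n (U i) (V i)) ∧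
      ¬ Thin φ ((⋃ i ∈ T, Set.range (V i)) ∪ ⋃ i ∈ Tᶜ, {U i}) R by
    obtain ⟨V, hV, hV'⟩ := H Finset.univ
    refine ⟨V, fun i => hV i (Finset.mem_univ _), ?_⟩
    convert hV' using 2
    ext W
    simp [eq_comm]
  intro T
  induction T using Finset.induction_on with
  | empty =>
    refine ⟨fun _ _ => ∅, by simp, ?_⟩
    convert h using 2
    ext W
    simp [eq_comm]
  | insert i T hi ih =>
    obtain ⟨V, hV, hV'⟩ := ih
    have heq : ((⋃ i ∈ T, Set.range (V i)) ∪ ⋃ i ∈ Tᶜ, {U i}) = insert (U i)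
        ((⋃ i ∈ T, Set.range (V i)) ∪ ⋃ j ∈ (insert i T)ᶜ, {U j}) := by
      ext W
      simp only [Set.mem_union, Set.mem_iUnion, Finset.mem_compl, Set.mem_singleton_iff,
        Set.mem_insert_iff, Finset.mem_insert, exists_prop]
      constructor
      · rintro (h | ⟨j, hj, rfl⟩)
        · exact Or.inr (Or.inl h)
        · by_cases hji : j = i
          · subst hji; exact Or.inl rfl
          · exact Or.inr (Or.inr ⟨j, by tauto, rfl⟩)
      · rintro (rfl | h | ⟨j, hj, rfl⟩)
        · exact Or.inr ⟨i, hi, rfl⟩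
        · exact Or.inl h
        · exact Or.inr ⟨j, by tauto, rfl⟩
    rw [heq] at hV'
    obtain ⟨V', hs, hl⟩ := exists_splitInto hφ (hU i) hR hV' n
    refine ⟨Function.update V i V', fun j hj => ?_, ?_⟩
    · rcases Finset.mem_insert.1 hj with rfl | hj
      · simpa using hs
      · have : j ≠ i := fun h => hi (h ▸ hj)
        simpa [this] using hV j hj
    · convert hl using 2
      have h2 : ∀ j ∈ T, Function.update V i V' j = V j := fun j hj => by
        have : j ≠ i := fun h => hi (h ▸ hj)
        simp [this]
      rw [← Set.union_assoc]
      congr 1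
      rw [Finset.set_biUnion_insert, Function.update_self]
      congr 1
      exact Set.iUnion₂_congr fun j hj => by rw [h2 j hj]

/-- A stage of the fusion construction. -/
structure FusionStage (φ : (ℕ → ℕ) → Real2 × Real2) (n : ℕ) where
  base : Set Real2
  family : (Fin n → Bool) → Set (ℕ → ℕ)
  measurableSet_base : MeasurableSet base
  measurableSet_family : ∀ s, MeasurableSet (family s)
  not_thin : ¬ Thin φ (Set.range family) base

theorem FusionStage.exists_next (hφ : Continuous φ) {n : ℕ} (F : FusionStage φ n) :
    ∃ F' : FusionStage φ (n + 1),
      (F'.base ⊆ F.base ∧ ∃ b, ∀ x ∈ F'.base, x n = b) ∧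
      ∀ s, SplitInto φ n (F.family s) fun b => F'.family (Fin.snoc s b) := by
  obtain ⟨b, hb⟩ := exists_shrink_base F.not_thin n
  have hR : MeasurableSet (F.base ∩ {x | x n = b}) :=
    F.measurableSet_base.inter (measurableSet_eq_fun (measurable_pi_apply n) measurable_const)
  obtain ⟨V, hV, hV'⟩ := exists_splitInto_family hφ F.measurableSet_family hR hb n
  refine ⟨⟨_, fun t => V (Fin.init t) (t (Fin.last n)), hR, fun t => ((hV _).1 _).1, ?_⟩,
    ⟨Set.inter_subset_left, b, fun x hx => hx.2⟩, fun s => ?_⟩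
  · convert hV' using 2
    ext W
    constructor
    · rintro ⟨t, rfl⟩
      exact ⟨(Fin.init t, t (Fin.last n)), rfl⟩
    · rintro ⟨⟨s, c⟩, rfl⟩
      exact ⟨Fin.snoc (α := fun _ => Bool) s c, by simp⟩
  · simpa using hV s

/-- Were the range not small, the fusion would produce a point `b` and a family of second components
over `b` indexed injectively by Cantor space, against countability of the section. -/
theorem graphSmall_range_of_countable (hφ : Continuous φ)
    (hc : ∀ x, {y | (x, y) ∈ Set.range φ}.Countable) : GraphSmall (Set.range φ) := by
  by_contra hns
  -- For the one-member family consisting of the whole space, thinness over everything is smallness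
  -- of the range.
  have h0 : ¬ Thin φ (Set.range fun _ : Fin 0 → Bool => (Set.univ : Set (ℕ → ℕ))) Set.univ := by
    rintro ⟨B, -, hB, hU⟩
    refine hns ((graphSmall_iUnion (C := fun k => imageOver φ Set.univ (B k)) fun k => ?_).mono ?_)
    · obtain ⟨U, ⟨_, rfl⟩, h⟩ := hU k
      exact h
    · rw [← imageOver_iUnion, Set.univ_subset_iff.1 hB]
      simp [imageOver]
  choose nxt hbase hsplit using fun n (F : FusionStage φ n) => F.exists_next hφ
  let F : ∀ n, FusionStage φ n := fun n =>
    Nat.rec ⟨Set.univ, fun _ => Set.univ, MeasurableSet.univ, fun _ => MeasurableSet.univ, h0⟩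
      (fun n F => nxt n F) n
  have hF : ∀ n, F (n + 1) = nxt n (F n) := fun n => rfl
  let r : (ℕ → Bool) → ∀ n, Fin n → Bool := fun z n i => z i
  have hr : ∀ z n, r z (n + 1) = Fin.snoc (α := fun _ => Bool) (r z n) (z n) := by
    intro z n
    funext i
    refine Fin.lastCases ?_ (fun j => ?_) i
    · simp [r]
    · simp [r]
  have hsp : ∀ z n, SplitInto φ n ((F n).family (r z n))
      fun b => (F (n + 1)).family (Fin.snoc (r z n) b) := fun z n => hsplit n (F n) _
  have hdec : ∀ z, Antitone fun n => (F n).family (r z n) := fun z =>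
    antitone_nat_of_succ_le fun n => by
      rw [hr]; exact ((hsp z n).1 (z n)).2.1
  have hbdec : Antitone fun n => (F n).base := antitone_nat_of_succ_le fun n => (hbase n (F n)).1
  choose b hb using fun n => (hbase n (F n)).2
  choose k hk using fun z n => ((hsp z n).1 (z n)).2.2
  -- The sets of the construction are only Borel, so the limit point `k z` need not lie in them. The
  -- points `w z n` do, they converge to `k z`, and continuity of φ carries the prescribed bits over
  -- to `φ (k z)`.
  choose w hw hwR using fun z n => exists_mem_of_not_thin (F n).measurableSet_base (F n).not_thin
    (Set.mem_range_self (r z n))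
  have hwlim : ∀ z, Filter.Tendsto (w z) Filter.atTop (nhds (k z)) := by
    intro z
    rw [tendsto_pi_nhds]
    intro j
    refine tendsto_const_nhds.congr' ?_
    filter_upwards [Filter.eventually_ge_atTop (j + 1)] with n hn
    refine (hk z j (w z n) ?_).symm
    have : w z n ∈ (F (j + 1)).family (r z (j + 1)) := hdec z hn (hw z n)
    rwa [hr] at this
  have hφlim := fun z => (hφ.tendsto (k z)).comp (hwlim z)
  have hfst : ∀ z, (φ (k z)).1 = b := by
    intro z
    funext j
    have h1 : Filter.Tendsto (fun n => (φ (w z n)).1 j) Filter.atTop (nhds ((φ (k z)).1 j)) :=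
      ((continuous_apply j).comp continuous_fst).continuousAt.tendsto.comp (hφlim z)
    refine tendsto_nhds_unique h1 (tendsto_const_nhds.congr' ?_)
    filter_upwards [Filter.eventually_ge_atTop (j + 1)] with n hn
    exact (hb j _ (hbdec hn (hwR z n))).symm
  -- The splitting coordinate depends only on the first n bits of the branch, so the bits of the
  -- branch can be read off one after the other from the second component.
  choose m hm using fun n s => (hsplit n (F n) s).2
  have hsnd : ∀ z n, (φ (k z)).2 (m n (r z n)) = z n := by
    intro z n
    have h1 : Filter.Tendsto (fun j => (φ (w z j)).2 (m n (r z n))) Filter.atTop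
        (nhds ((φ (k z)).2 (m n (r z n)))) :=
      ((continuous_apply _).comp continuous_snd).continuousAt.tendsto.comp (hφlim z)
    refine tendsto_nhds_unique h1 (tendsto_const_nhds.congr' ?_)
    filter_upwards [Filter.eventually_ge_atTop (n + 1)] with j hj
    refine (hm n (r z n) (z n) _ ?_).symm
    have : w z j ∈ (F (n + 1)).family (r z (n + 1)) := hdec z hj (hw z j)
    rwa [hr] at this
  have hinj : Function.Injective fun z => (φ (k z)).2 := by
    intro z z' hzz
    simp only at hzz
    funext n
    induction n using Nat.strong_induction_on with
    | _ n ih =>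
      have : r z n = r z' n := funext fun i => ih i i.2
      rw [← hsnd z n, ← hsnd z' n, hzz, this]
  have : (Set.range fun z => (φ (k z)).2).Countable := by
    refine (hc b).mono ?_
    rintro _ ⟨z, rfl⟩
    exact ⟨k z, by rw [← hfst z]⟩
  have h3 : (Set.univ : Set (ℕ → Bool)).Countable := by
    rw [← Set.image_univ] at this
    exact (Set.countable_of_injective_of_countable_image hinj.injOn this)
  exact absurd (Set.countable_univ_iff.1 h3) (by
    rw [← Cardinal.mk_le_aleph0_iff]
    simpa using Cardinal.aleph0_lt_continuum)

end Fusion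

/-- **Lusin–Novikov**: a Borel set with countable sections is covered by countably many Borel
graphs. -/
theorem graphSmall_of_countable_sections {A : Set (Real2 × Real2)} (hA : MeasurableSet A)
    (hc : ∀ x, {y | (x, y) ∈ A}.Countable) : GraphSmall A := by
  have h1 : MeasureTheory.AnalyticSet (id '' A) := hA.analyticSet_image measurable_id
  rw [Set.image_id, MeasureTheory.AnalyticSet] at h1
  rcases h1 with rfl | ⟨φ, hφ, rfl⟩
  · exact graphSmall_empty
  · exact graphSmall_range_of_countable hφ hc

/-- The classes of a countable Borel equivalence relation are enumerated by Borel functions. -/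
theorem IsCountableBorel.exists_enumeration {E : Setoid Real2} (hE : IsCountableBorel E) :
    ∃ g : ℕ → Real2 → Real2, (∀ n, Measurable (g n)) ∧
      ∀ x, (Set.range fun n => g n x) = {y | E x y} := by
  classical
  obtain ⟨g, hg, hg'⟩ := graphSmall_of_countable_sections hE.1 hE.2
  refine ⟨fun n x => if E x (g n x) then g n x else x, fun n => ?_, fun x => ?_⟩
  · exact Measurable.ite ((measurable_id.prodMk (hg n)) hE.1) (hg n) measurable_id
  · ext y
    constructor
    · rintro ⟨n, rfl⟩
      dsimp only
      split_ifs with h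
      · exact h
      · exact E.refl x
    · intro h
      obtain ⟨n, hn⟩ := hg' (x, y) h
      simp only at hn
      subst hn
      exact ⟨n, if_pos h⟩

/-! ### A universal countable Borel equivalence relation from shifts by words -/

/-- A fixed coding of pairs of a word and a number. -/
def wordIndex : List ℕ × ℕ ≃ ℕ := Denumerable.eqv (List ℕ × ℕ)

/-- The action of words on reals that code families of reals indexed by words. -/
def wordShift (w : List ℕ) (p : Real2) : Real2 :=
  fun k => p (wordIndex (w ++ (wordIndex.symm k).1, (wordIndex.symm k).2))

theorem wordShift_nil (p : Real2) : wordShift [] p = p := by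
  funext k
  simp [wordShift]

theorem wordShift_wordShift (w w' : List ℕ) (p : Real2) :
    wordShift w (wordShift w' p) = wordShift (w' ++ w) p := by
  funext k
  simp [wordShift]

theorem measurable_wordShift (w : List ℕ) : Measurable (wordShift w) :=
  measurable_pi_lambda _ fun _ => measurable_pi_apply _

/-- Two reals are equivalent if each is a shift of the other. -/
def shiftSetoid : Setoid Real2 where
  -- Words form a monoid and not a group, so symmetry has to be imposed; no group action generating
  -- the relation is needed.
  r p q := (∃ w, wordShift w p = q) ∧ ∃ w, wordShift w q = p
  iseqv := by
    refine ⟨fun p => ⟨⟨[], wordShift_nil p⟩, [], wordShift_nil p⟩, fun h => ⟨h.2, h.1⟩, ?_⟩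
    rintro p q r ⟨⟨w, rfl⟩, v, hv⟩ ⟨⟨w', rfl⟩, v', hv'⟩
    refine ⟨⟨w ++ w', (wordShift_wordShift _ _ _).symm⟩, v' ++ v, ?_⟩
    rw [← wordShift_wordShift, hv', hv]

theorem isCountableBorel_shiftSetoid : IsCountableBorel shiftSetoid := by
  constructor
  · have h : {p : Real2 × Real2 | shiftSetoid p.1 p.2} =
        (⋃ w, {p | wordShift w p.1 = p.2}) ∩ ⋃ w, {p | wordShift w p.2 = p.1} := by
      ext p
      simp only [Set.mem_inter_iff, Set.mem_iUnion]
      rfl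
    rw [h]
    exact (MeasurableSet.iUnion fun w => measurableSet_eq_fun
      ((measurable_wordShift w).comp measurable_fst) measurable_snd).inter
      (MeasurableSet.iUnion fun w => measurableSet_eq_fun
        ((measurable_wordShift w).comp measurable_snd) measurable_fst)
  · intro x
    exact (Set.countable_range fun w => wordShift w x).mono fun y hy => hy.1

/-- The family of all iterates, indexed by words, of a sequence of functions. -/
def iterateTable (g : ℕ → Real2 → Real2) (x : Real2) : Real2 :=
  fun k => (wordIndex.symm k).1.foldl (fun y n => g n y) x (wordIndex.symm k).2

theorem wordShift_iterateTable (g : ℕ → Real2 → Real2) (w : List ℕ) (x : Real2) :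
    wordShift w (iterateTable g x) = iterateTable g (w.foldl (fun y n => g n y) x) := by
  funext k
  simp [wordShift, iterateTable]

theorem iterateTable_injective (g : ℕ → Real2 → Real2) : Function.Injective (iterateTable g) := by
  intro x y h
  funext m
  have := congrFun h (wordIndex ([], m))
  simpa [iterateTable] using this

/-- A one-letter word leads from the table of x to that of any equivalent y, since the `g n` exhaust
the class. Conversely iterates stay in the class, and the empty word makes the table determine its
base point. Measurability of `g` plays no role, which allows the use for enumerable relations. -/
theorem isReduction_iterateTable {E : Setoid Real2} {g : ℕ → Real2 → Real2}
    (hg : ∀ x, (Set.range fun n => g n x) = {y | E x y}) :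
    IsReduction E shiftSetoid (iterateTable g) := by
  have hstep : ∀ x y, E x y → ∃ w, wordShift w (iterateTable g x) = iterateTable g y := by
    intro x y h
    obtain ⟨n, hn⟩ : y ∈ Set.range fun n => g n x := by rw [hg]; exact h
    exact ⟨[n], by rw [wordShift_iterateTable, ← hn]; rfl⟩
  have hword : ∀ (w : List ℕ) x, E x (w.foldl (fun y n => g n y) x) := by
    intro w
    induction w with
    | nil => exact fun x => E.refl x
    | cons n w ih =>
      intro x
      have : g n x ∈ {y | E x y} := by rw [← hg]; exact ⟨n, rfl⟩
      exact E.trans this (ih _)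
  intro x y
  refine ⟨fun h => ⟨hstep x y h, hstep y x (E.symm h)⟩, ?_⟩
  rintro ⟨⟨w, hw⟩, -⟩
  rw [wordShift_iterateTable] at hw
  rw [← iterateTable_injective g hw]
  exact hword w x

theorem measurable_iterateTable {g : ℕ → Real2 → Real2} (hg : ∀ n, Measurable (g n)) :
    Measurable (iterateTable g) := by
  have : ∀ w : List ℕ, Measurable fun x => w.foldl (fun y n => g n y) x := by
    intro w
    induction w with
    | nil => exact measurable_id
    | cons n w ih => exact ih.comp (hg n)
  exact measurable_pi_lambda _ fun k => (measurable_pi_apply _).comp (this _)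

theorem IsReduction.comp {E F G : Setoid Real2} {f g : Real2 → Real2} (hg : IsReduction F G g)
    (hf : IsReduction E F f) : IsReduction E G (g ∘ f) :=
  fun x y => (hf x y).trans (hg _ _)

theorem isEInfty_shiftSetoid : IsEInfty shiftSetoid := by
  refine ⟨isCountableBorel_shiftSetoid, fun F hF => ?_⟩
  obtain ⟨g, hg, hg'⟩ := hF.exists_enumeration
  exact ⟨_, measurable_iterateTable hg, isReduction_iterateTable hg'⟩

/-! ### Limsup signals, networks and the closure properties of realizability -/

/-- At the limit stage `l` the signal `u` shows the `limsup` of its earlier values. -/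
def LimsupAt {κ : Type} (u : Ordinal.{0} → κ → Bool) (l : Ordinal.{0}) : Prop :=
  ∀ k, u l k = true ↔ ∀ β < l, ∃ γ, γ < l ∧ β ≤ γ ∧ u γ k = true

/-- The signal `u` shows at every limit stage the `limsup` of its earlier values. -/
def IsLimsupSignal {κ : Type} (u : Ordinal.{0} → κ → Bool) : Prop :=
  ∀ l, Order.IsSuccLimit l → LimsupAt u l

/-- The evolution `u` of a network with update rule `step`, all cells being `false` at the
beginning, under the input signal `v`. -/
structure Drives {κ : Type} (step : Real2 → (κ → Bool) → κ → Bool)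
    (v : Ordinal.{0} → Real2) (u : Ordinal.{0} → κ → Bool) : Prop where
  zero : u 0 = fun _ => false
  succ : ∀ β, u (β + 1) = step (v β) (u β)
  limit : IsLimsupSignal u

/-- `f` is realized by a network of countably many cells whose update rule is open: whenever the
input signal is eventually constant with value `x`, the output signal is eventually constant with
value `f x`; if `S` holds, then moreover all cells are eventually constant. -/
def Realizable (S : Prop) (f : Real2 → Real2) : Prop :=
  ∃ (κ : Type) (_ : Countable κ) (step : Real2 → (κ → Bool) → κ → Bool) (out : ℕ → κ),
    (∀ k, IsOpen {p : Real2 × (κ → Bool) | step p.1 p.2 k = true}) ∧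
    ∀ v u, IsLimsupSignal v → Drives step v u → ∀ x α, (∀ β, α ≤ β → v β = x) →
      ∃ γ, (∀ β, γ ≤ β → ∀ n, u β (out n) = f x n) ∧ (S → ∀ β, γ ≤ β → u β = u γ)

theorem IsLimsupSignal.comp {κ ι : Type} {u : Ordinal.{0} → κ → Bool} (h : IsLimsupSignal u)
    (e : ι → κ) : IsLimsupSignal fun β i => u β (e i) :=
  fun l hl i => h l hl (e i)

theorem isLimsupSignal_const {κ : Type} (x : κ → Bool) :
    IsLimsupSignal fun _ : Ordinal.{0} => x := by
  intro l hl k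
  refine ⟨fun h β hβ => ⟨β, hβ, le_rfl, h⟩, fun h => ?_⟩
  obtain ⟨_, -, -, h⟩ := h 0 hl.bot_lt
  exact h

/-- A cell that is constant on a final segment below a limit stage keeps its value there. -/
theorem LimsupAt.eq_of_eventually {κ : Type} {u : Ordinal.{0} → κ → Bool} {l : Ordinal.{0}}
    (h : LimsupAt u l) {β : Ordinal.{0}} (hβ : β < l) {k : κ} {b : Bool}
    (hb : ∀ γ, β ≤ γ → γ < l → u γ k = b) : u l k = b := by
  cases b with
  | true => exact (h k).2 fun δ hδ => ⟨max β δ, max_lt hβ hδ, le_max_right _ _,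
      hb _ (le_max_left _ _) (max_lt hβ hδ)⟩
  | false =>
    rw [Bool.eq_false_iff]
    intro h'
    obtain ⟨γ, h1, h2, h3⟩ := (h k).1 h' β hβ
    rw [hb γ h2 h1] at h3
    exact absurd h3 (by simp)

/-- Induction along a final segment of the ordinals. -/
theorem Ordinal.induction_ge {P : Ordinal.{0} → Prop} {γ : Ordinal.{0}} (h0 : P γ)
    (hs : ∀ β, γ ≤ β → P β → P (β + 1))
    (hl : ∀ l, Order.IsSuccLimit l → γ < l → (∀ β, γ ≤ β → β < l → P β) → P l) :
    ∀ β, γ ≤ β → P β := by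
  intro β
  induction β using Ordinal.limitRecOn with
  | zero => intro h; rwa [← nonpos_iff_eq_zero.1 h]
  | add_one β ih =>
    intro h
    rcases h.lt_or_eq with h | rfl
    · have : γ ≤ β := Order.lt_succ_iff.1 (by rwa [Order.succ_eq_add_one])
      exact hs β this (ih this)
    · exact h0
  | limit l hl' ih =>
    intro h
    rcases h.lt_or_eq with h | rfl
    · exact hl l hl' h fun β h1 h2 => ih β h2 h1
    · exact h0

theorem Continuous.isOpen_eq_const {X D : Type*} [TopologicalSpace X] [TopologicalSpace D]
    [DiscreteTopology D] {f : X → D} (hf : Continuous f) (b : D) : IsOpen {x | f x = b} :=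
  (isOpen_discrete {b}).preimage hf

theorem realizable_of_isOpen {G : Real2 → Real2} (S : Prop)
    (hG : ∀ k, IsOpen {s | G s k = true}) : Realizable S G := by
  refine ⟨ℕ, inferInstance, fun v _ => G v, id, fun k => (hG k).preimage continuous_fst, ?_⟩
  intro v u _ hu x α hα
  have key : ∀ β, α + 1 ≤ β → u β = G x := by
    apply Ordinal.induction_ge
    · rw [hu.succ, hα α le_rfl]
    · intro β hβ _
      rw [hu.succ, hα β (le_self_add.trans hβ)]
    · intro l hl hlt ih
      funext k
      exact (hu.limit l hl).eq_of_eventually hlt fun γ h1 h2 => by rw [ih γ h1 h2]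
  exact ⟨α + 1, fun β hβ n => by rw [key β hβ]; rfl, fun _ β hβ => by rw [key β hβ, key _ le_rfl]⟩

/-- The output of the first network is fed to the second. This intermediate signal obeys the limsup
rule and settles, but may take arbitrary values before; realizability allows exactly such inputs. -/
theorem Realizable.comp {S : Prop} {f g : Real2 → Real2} (hg : Realizable S g)
    (hf : Realizable S f) : Realizable S (g ∘ f) := by
  obtain ⟨κ, _, step, out, ho, hf⟩ := hf
  obtain ⟨κ', _, step', out', ho', hg⟩ := hg
  refine ⟨κ ⊕ κ', inferInstance, fun v u => Sum.elim (step v (u ∘ Sum.inl))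
    (step' (fun n => u (Sum.inl (out n))) (u ∘ Sum.inr)), Sum.inr ∘ out', ?_, ?_⟩
  · rintro (k | k)
    · exact (ho k).preimage (f := fun p : Real2 × (κ ⊕ κ' → Bool) => (p.1, p.2 ∘ Sum.inl))
        (by fun_prop)
    · exact (ho' k).preimage (f := fun p : Real2 × (κ ⊕ κ' → Bool) =>
        ((fun n => p.2 (Sum.inl (out n)) : Real2), p.2 ∘ Sum.inr)) (by fun_prop)
  · intro v u hv hu x α hα
    have hu1 : Drives step v fun β => u β ∘ Sum.inl :=
      ⟨by rw [hu.zero]; rfl, fun β => by rw [hu.succ]; rfl, hu.limit.comp _⟩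
    have hu2 : Drives step' (fun β n => u β (Sum.inl (out n))) fun β => u β ∘ Sum.inr :=
      ⟨by rw [hu.zero]; rfl, fun β => by rw [hu.succ]; rfl, hu.limit.comp _⟩
    obtain ⟨γ, h1, h2⟩ := hf v _ hv hu1 x α hα
    obtain ⟨δ, h3, h4⟩ := hg _ _ (hu.limit.comp _) hu2 (f x) γ fun β hβ => funext (h1 β hβ)
    refine ⟨max γ δ, fun β hβ n => h3 β ((le_max_right _ _).trans hβ) n, fun s β hβ => ?_⟩
    have e1 := (h2 s β ((le_max_left _ _).trans hβ)).trans (h2 s _ (le_max_left γ δ)).symm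
    have e2 := (h4 s β ((le_max_right _ _).trans hβ)).trans (h4 s _ (le_max_right γ δ)).symm
    funext k
    rcases k with k | k
    · exact congrFun e1 k
    · exact congrFun e2 k

/-- The networks run side by side. Countably many settling times have a supremum among the ordinals,
after which all networks have settled. -/
theorem Realizable.pack {S : Prop} {ι : Type} [Countable ι] {f : ι → Real2 → Real2}
    (hf : ∀ i, Realizable S (f i)) (sel : ℕ → ι × ℕ) :
    Realizable S fun x n => f (sel n).1 x (sel n).2 := by
  choose κ hκ step out ho hf using hf
  refine ⟨Σ i, κ i, inferInstance, fun v u k => step k.1 v (fun j => u ⟨k.1, j⟩) k.2,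
    fun n => ⟨(sel n).1, out _ (sel n).2⟩, ?_, ?_⟩
  · rintro ⟨i, k⟩
    exact (ho i k).preimage (f := fun p : Real2 × ((Σ i, κ i) → Bool) =>
      (p.1, fun j => p.2 ⟨i, j⟩)) (by fun_prop)
  · intro v u hv hu x α hα
    have hui : ∀ i, Drives (step i) v fun β j => u β ⟨i, j⟩ := fun i =>
      ⟨by rw [hu.zero], fun β => by rw [hu.succ], hu.limit.comp _⟩
    choose γ h1 h2 using fun i => hf i v _ hv (hui i) x α hα
    have hle : ∀ i, γ i ≤ ⨆ i, γ i := fun i => Ordinal.le_iSup γ i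
    refine ⟨⨆ i, γ i, fun β hβ n => h1 _ β ((hle _).trans hβ) _, fun s β hβ => ?_⟩
    funext ⟨i, k⟩
    have := (h2 i s β ((hle i).trans hβ)).trans (h2 i s _ (hle i)).symm
    exact congrFun this k

/-- The sets with realizable indicator form a σ-algebra containing the coordinate sets, hence all
Borel sets; the bits of a Borel function are indicators of Borel sets. -/
theorem Measurable.realizable {S : Prop} {f : Real2 → Real2} (hf : Measurable f) :
    Realizable S f := by
  classical
  have hset : ∀ B : Set Real2, MeasurableSet B → Realizable S fun x _ => decide (x ∈ B) := by
    have hcompl : ∀ B : Set Real2, Realizable S (fun x _ => decide (x ∈ B)) →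
        Realizable S fun x _ => decide (x ∈ Bᶜ) := by
      intro B hB
      have hnot : Realizable S fun s n => !s n := realizable_of_isOpen S fun k =>
        Continuous.isOpen_eq_const (f := fun s : Real2 => !s k)
          ((continuous_of_discreteTopology (f := fun b : Bool => !b)).comp
            (continuous_apply (A := fun _ : ℕ => Bool) k)) true
      refine cast (congrArg _ ?_) (hnot.comp hB)
      funext x n
      simp
    let m : MeasurableSpace Real2 :=
      { MeasurableSet' := fun B => Realizable S fun x _ => decide (x ∈ B)
        measurableSet_empty := by
          refine realizable_of_isOpen S fun k => ?_
          simp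
        measurableSet_compl := fun B hB => by convert hcompl B hB
        measurableSet_iUnion := fun B hB => by
          -- The indicator of the n-th set is constant along its row of the packed real, so bit 0 of
          -- the row is enough; the quantifier over n is an open condition.
          have hor : Realizable S fun (s : Real2) (_ : ℕ) =>
              decide (∃ n, s (Nat.pair n 0) = true) := realizable_of_isOpen S fun k => by
            have : {s : Real2 | decide (∃ n, s (Nat.pair n 0) = true) = true} =
                ⋃ n, {s : Real2 | s (Nat.pair n 0) = true} := by
              ext; simp
            rw [this]
            exact isOpen_iUnion fun n => Continuous.isOpen_eq_const
              (f := fun s : Real2 => s (Nat.pair n 0)) (continuous_apply _) true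
          refine cast (congrArg _ ?_) (hor.comp (Realizable.pack hB Nat.unpair))
          funext x n
          simp }
    have hle : MeasurableSpace.pi ≤ m := by
      refine iSup_le fun n => ?_
      rintro _ ⟨s, -, rfl⟩
      show Realizable S fun x _ => decide (x ∈ (fun y : Real2 => y n) ⁻¹' s)
      refine realizable_of_isOpen S fun k => ?_
      simp only [decide_eq_true_eq]
      exact (isOpen_discrete s).preimage (continuous_apply n)
    exact fun B hB => hle B hB
  have := Realizable.pack (fun n => hset _ (hf (measurableSet_eq_fun (measurable_pi_apply n)
    (measurable_const (a := true))))) fun n => (n, n)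
  refine cast (congrArg _ ?_) this
  funext x n
  simp

/-- Open sets of pairs of families of bits are those whose membership is secured by finitely many
bits. -/
theorem isOpen_iff_finite_support {κ : Type} {Q : Set (Real2 × (κ → Bool))} :
    IsOpen Q ↔ ∀ p ∈ Q, ∃ (A : Finset ℕ) (B : Finset κ), ∀ q : Real2 × (κ → Bool),
      (∀ n ∈ A, q.1 n = p.1 n) → (∀ k ∈ B, q.2 k = p.2 k) → q ∈ Q := by
  constructor
  · intro h p hp
    obtain ⟨U, V, hU, hV, hpU, hpV, hUV⟩ := isOpen_prod_iff.1 h p.1 p.2 hp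
    obtain ⟨A, a, ha, hA⟩ := isOpen_pi_iff.1 hU p.1 hpU
    obtain ⟨B, b, hb, hB⟩ := isOpen_pi_iff.1 hV p.2 hpV
    refine ⟨A, B, fun q h1 h2 => hUV ⟨hA fun n hn => ?_, hB fun n hn => ?_⟩⟩
    · rw [h1 n hn]; exact (ha n hn).2
    · rw [h2 n hn]; exact (hb n hn).2
  · intro h
    rw [isOpen_prod_iff]
    intro x y hxy
    obtain ⟨A, B, hAB⟩ := h _ hxy
    refine ⟨Set.pi A fun n => {x n}, Set.pi B fun n => {y n},
      isOpen_set_pi A.finite_toSet fun _ _ => isOpen_discrete _,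
      isOpen_set_pi B.finite_toSet fun _ _ => isOpen_discrete _, fun n _ => rfl, fun n _ => rfl, ?_⟩
    rintro ⟨x', y'⟩ ⟨h1, h2⟩
    exact hAB _ (fun n hn => h1 n hn) (fun n hn => h2 n hn)

theorem IsLimsupSignal.shift {κ : Type} {u : Ordinal.{0} → κ → Bool} (h : IsLimsupSignal u)
    (γ : Ordinal.{0}) : IsLimsupSignal fun ε => u (γ + ε) := by
  intro l hl k
  rw [h (γ + l) (Ordinal.isSuccLimit_add γ hl) k]
  constructor
  · intro H β hβ
    obtain ⟨δ, h1, h2, h3⟩ := H (γ + β) (by simpa using hβ)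
    refine ⟨δ - γ, ?_, ?_, ?_⟩
    · rw [Ordinal.sub_lt_of_le (le_self_add.trans h2)]; exact h1
    · rwa [Ordinal.le_sub_of_le (le_self_add.trans h2)]
    · show u (γ + (δ - γ)) k = true
      rwa [Ordinal.add_sub_cancel_of_le (le_self_add.trans h2)]
  · intro H β hβ
    rcases le_total γ β with hγ | hγ
    · obtain ⟨δ, h1, h2, h3⟩ := H (β - γ) (by rwa [Ordinal.sub_lt_of_le hγ])
      refine ⟨γ + δ, by simpa using h1, ?_, h3⟩
      rw [← Ordinal.add_sub_cancel_of_le hγ]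
      simpa using h2
    · obtain ⟨δ, h1, h2, h3⟩ := H 0 hl.bot_lt
      exact ⟨γ + δ, by simpa using h1, hγ.trans le_self_add, h3⟩

/-- If at every stage below `l` one of finitely many cells will be on before `l`, then one of them
is on at `l`. -/
theorem LimsupAt.exists_of_finite {κ ι : Type} [Finite ι] {u : Ordinal.{0} → κ → Bool}
    {l : Ordinal.{0}} (h : LimsupAt u l) (e : ι → κ) (hl : 0 < l)
    (H : ∀ β < l, ∃ γ, γ < l ∧ β ≤ γ ∧ ∃ i, u γ (e i) = true) : ∃ i, u l (e i) = true := by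
  by_contra hcon
  push Not at hcon
  have := Fintype.ofFinite ι
  have key : ∀ i, ∃ β < l, ∀ γ, γ < l → β ≤ γ → u γ (e i) ≠ true := by
    intro i
    have := mt (h (e i)).2 (hcon i)
    push Not at this
    exact this
  choose b hb hb' using key
  obtain ⟨γ, h1, h2, i, hi⟩ := H (Finset.univ.sup b)
    ((Finset.sup_lt_iff (by simpa using hl)).2 fun i _ => hb i)
  exact hb' i γ h1 ((Finset.le_sup (Finset.mem_univ i)).trans h2) hi

/-! ### Runs of infinite time Turing machines -/

namespace ITTM

variable (M : ITTM)

theorem run_zero (x : Real2) : M.run x 0 = M.init x := Ordinal.limitRecOn_zero _ _ _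

theorem run_succ (x : Real2) (α : Ordinal.{0}) : M.run x (α + 1) = M.next (M.run x α) :=
  Ordinal.limitRecOn_add_one _ _ _ _

theorem run_limit (x : Real2) {l : Ordinal.{0}} (hl : Order.IsSuccLimit l) :
    M.run x l = M.limitConfig l fun β _ => M.run x β :=
  Ordinal.limitRecOn_limit _ _ _ _ hl

theorem isLimsupSignal_tape (x : Real2) :
    IsLimsupSignal fun α (p : Fin 3 × ℕ) => (M.run x α).tape p.1 p.2 := by
  rintro l hl ⟨i, n⟩
  simp only [M.run_limit x hl, limitConfig, decide_eq_true_eq, exists_prop]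

theorem run_limit_state_of_not_halt (x : Real2) {l : Ordinal.{0}} (hl : Order.IsSuccLimit l)
    (h : ∀ β < l, (M.run x β).state ≠ M.halt) :
    (M.run x l).state = M.limit ∧ (M.run x l).head = 0 := by
  rw [M.run_limit x hl]
  refine ⟨if_neg ?_, rfl⟩
  rintro ⟨β, hβ, h'⟩
  exact h β hβ h'

theorem next_of_halt {c : M.Config} (h : c.state = M.halt) : M.next c = c := if_pos h

/-- A machine that has halted stays halted and its tapes do not change. -/
theorem run_of_halt {x : Real2} {α : Ordinal.{0}} (h : (M.run x α).state = M.halt) :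
    ∀ β, α ≤ β → (M.run x β).state = M.halt ∧ (M.run x β).tape = (M.run x α).tape := by
  apply Ordinal.induction_ge
  · exact ⟨h, rfl⟩
  · rintro β - ⟨h1, h2⟩
    rw [M.run_succ, M.next_of_halt h1]
    exact ⟨h1, h2⟩
  · intro l hl hlt ih
    constructor
    · rw [M.run_limit x hl]
      exact if_pos ⟨α, hlt, h⟩
    · funext i n
      exact (M.isLimsupSignal_tape x l hl).eq_of_eventually (k := (i, n)) hlt fun γ h1 h2 => by
        simp only [(ih γ h1 h2).2]

theorem Computes.eventuallyComputes {M : ITTM} {x y : Real2} (h : M.Computes x y) :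
    M.EventuallyComputes x y := by
  obtain ⟨α, h1, rfl⟩ := h
  exact ⟨α, fun β hβ => by rw [(M.run_of_halt h1 β hβ).2]⟩

end ITTM

/-! ### A restarting network that simulates a machine -/

namespace ITTM

/-- The cells of the network that simulates the machine `M`. -/
inductive SimCell (M : ITTM)
  | prev (n : ℕ)
  | changed
  | started
  | tape (i : Fin 3) (n : ℕ)
  | head (n : ℕ)
  -- The phase `b` flips at each step until the machine halts. At a limit of such steps cells of
  -- both phases are on, and this makes limit stages recognizable from the cells alone.
  | state (q : M.State) (b : Bool)

namespace SimCell

variable {M : ITTM}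

instance : Countable (SimCell M) := by
  have := M.finite_state
  let e : ℕ ⊕ Bool ⊕ (Fin 3 × ℕ) ⊕ ℕ ⊕ (M.State × Bool) → SimCell M := fun s => match s with
    | .inl n => prev n
    | .inr (.inl true) => changed
    | .inr (.inl false) => started
    | .inr (.inr (.inl p)) => tape p.1 p.2
    | .inr (.inr (.inr (.inl n))) => head n
    | .inr (.inr (.inr (.inr p))) => state p.1 p.2
  refine Function.Surjective.countable (f := e) ?_
  rintro (n | _ | _ | ⟨i, n⟩ | n | ⟨q, b⟩)
  exacts [⟨.inl n, rfl⟩, ⟨.inr (.inl true), rfl⟩, ⟨.inr (.inl false), rfl⟩,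
    ⟨.inr (.inr (.inl (i, n))), rfl⟩, ⟨.inr (.inr (.inr (.inl n))), rfl⟩,
    ⟨.inr (.inr (.inr (.inr (q, b)))), rfl⟩]

/-- Exactly one state cell is on. -/
def Sharp (u : SimCell M → Bool) (p : M.State × Bool) : Prop :=
  ∀ q b, u (state q b) = true ↔ (q, b) = p

open Classical in
/-- The state and phase shown by the state cells; if more than one of them is on, the simulated
machine is at a limit stage. -/
def readState (u : SimCell M → Bool) : M.State × Bool :=
  if h : ∃ p, Sharp u p then h.choose else (M.limit, false)

open Classical in
/-- The position of the head shown by the cells. -/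
def readHead (u : SimCell M → Bool) (n : ℕ) : Prop :=
  if ∃ p, Sharp u p then u (head n) = true else n = 0

/-- The transition of the simulated machine if its head is at position `n`. -/
def act (u : SimCell M → Bool) (n : ℕ) : M.State × (Fin 3 → Bool) × Turing.Dir :=
  M.trans (readState u).1 fun i => u (tape i n)

open Classical in
/-- One step of the simulated machine. -/
def simStep (u : SimCell M → Bool) : SimCell M → Bool
  | prev n => u (prev n)
  | changed => u changed
  | started => u started
  | tape i n => if (readState u).1 ≠ M.halt ∧ readHead u n then (act u n).2.1 i else u (tape i n)
  | head n => if (readState u).1 = M.halt then u (head n) else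
      decide (∃ p, readHead u p ∧ moveHead (act u p).2.2 p = n)
  | state q b => if (readState u).1 = M.halt then u (state q b) else
      decide (b = !(readState u).2 ∧ ∃ p, readHead u p ∧ (act u p).1 = q)

open Classical in
/-- The cells of the simulating network at the beginning of the computation on input `z`. -/
def load (z : Real2) : SimCell M → Bool
  | prev _ => false
  | changed => false
  | started => false
  | tape i n => if i = 0 then z n else false
  | head n => decide (n = 0)
  | state q b => decide ((q, b) = (M.start, false))

open Classical in
/-- The update rule of the network that simulates the machine on input `x ⊕ c`: the simulation is
started anew whenever the input has changed. -/
def step (c : Real2) (x : Real2) (u : SimCell M → Bool) : SimCell M → Bool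
  | prev n => x n
  | changed => decide (∃ n, x n ≠ u (prev n))
  | started => true
  | k => if u changed = true ∨ u started = false then load (joinReal x c) k else simStep u k

theorem Sharp.readState_eq {u : SimCell M → Bool} {p : M.State × Bool} (h : Sharp u p) :
    readState u = p := by
  have hex : ∃ p, Sharp u p := ⟨p, h⟩
  rw [readState, dif_pos hex]
  have h1 := hex.choose_spec
  exact ((h1 _ _).1 ((h p.1 p.2).2 rfl)).symm

theorem readState_congr {u u' : SimCell M → Bool} (h : ∀ q b, u' (state q b) = u (state q b)) :
    readState u' = readState u := by
  have : Sharp u' = Sharp u := funext fun p => by simp only [Sharp, h]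
  unfold readState
  rw [this]

theorem readHead_congr {u u' : SimCell M → Bool} (h : ∀ q b, u' (state q b) = u (state q b))
    {n : ℕ} (hn : u' (head n) = u (head n)) : readHead u' n = readHead u n := by
  have : Sharp u' = Sharp u := funext fun p => by simp only [Sharp, h]
  unfold readHead
  rw [this, hn]

theorem act_congr {u u' : SimCell M → Bool} (h : ∀ q b, u' (state q b) = u (state q b))
    {n : ℕ} (hn : ∀ i, u' (tape i n) = u (tape i n)) : act u' n = act u n := by
  simp only [act, readState_congr h, hn]

/-- State and phase occupy finitely many cells because the machine has finitely many states. Beyond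
these each rule looks at boundedly many cells, or asks for some position with a property that itself
concerns finitely many cells. -/
theorem isOpen_step (c : Real2) (k : SimCell M) :
    IsOpen {p : Real2 × (SimCell M → Bool) | step c p.1 p.2 k = true} := by
  classical
  have := M.finite_state
  have := Fintype.ofFinite M.State
  let base : Finset (SimCell M) := {changed, started} ∪
    Finset.univ.image fun p : M.State × Bool => state p.1 p.2
  let loc : ℕ → Finset (SimCell M) := fun n => insert (head n) (Finset.univ.image fun i => tape i n)
  have hst : ∀ q b, state q b ∈ base := fun q b =>
    Finset.mem_union_right _ (Finset.mem_image.2 ⟨(q, b), Finset.mem_univ _, rfl⟩)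
  have hch : changed ∈ base := by simp [base]
  have hsd : started ∈ base := by simp [base]
  have hloc : ∀ i n, tape i n ∈ loc n := fun i n =>
    Finset.mem_insert_of_mem (Finset.mem_image.2 ⟨i, Finset.mem_univ _, rfl⟩)
  have hhd : ∀ n, head n ∈ loc n := fun n => Finset.mem_insert_self _ _
  rw [isOpen_iff_finite_support]
  rintro ⟨x, u⟩ hp
  simp only [Set.mem_ofPred_eq] at hp ⊢
  cases k with
  | prev n => exact ⟨{n}, ∅, fun q h _ => by rw [← hp]; exact h n (by simp)⟩
  | changed =>
    simp only [step, decide_eq_true_eq] at hp ⊢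
    obtain ⟨n, hn⟩ := hp
    exact ⟨{n}, {prev n}, fun q h1 h2 => ⟨n, by
      rw [h1 n (by simp), h2 _ (Finset.mem_singleton_self _)]; exact hn⟩⟩
  | started => exact ⟨∅, ∅, fun _ _ _ => rfl⟩
  | tape i n =>
    refine ⟨{n / 2}, base ∪ loc n, fun q h1 h2 => ?_⟩
    have hb : ∀ q' b, q.2 (state q' b) = u (state q' b) := fun q' b =>
      h2 _ (Finset.mem_union_left _ (hst _ _))
    have ht : ∀ i, q.2 (tape i n) = u (tape i n) := fun i =>
      h2 _ (Finset.mem_union_right _ (hloc i n))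
    rw [← hp]
    simp only [step, load, simStep, joinReal, h2 _ (Finset.mem_union_left _ hch),
      h2 _ (Finset.mem_union_left _ hsd), h1 (n / 2) (by simp), readState_congr hb,
      readHead_congr hb (h2 _ (Finset.mem_union_right _ (hhd n))), act_congr hb ht, ht]
  | head n =>
    -- Only the value `true` has to be secured, so one witnessing head position suffices; the
    -- default 0 is used when the cell is on for another reason.
    obtain ⟨p, hpp⟩ : ∃ p, (∃ p, readHead u p ∧ moveHead (act u p).2.2 p = n) →
        readHead u p ∧ moveHead (act u p).2.2 p = n := by
      by_cases h : ∃ p, readHead u p ∧ moveHead (act u p).2.2 p = n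
      · exact ⟨h.choose, fun _ => h.choose_spec⟩
      · exact ⟨0, fun h' => absurd h' h⟩
    refine ⟨∅, base ∪ (loc n ∪ loc p), fun q _ h2 => ?_⟩
    have hb : ∀ q' b, q.2 (state q' b) = u (state q' b) := fun q' b =>
      h2 _ (Finset.mem_union_left _ (hst _ _))
    have hp2 : ∀ k ∈ loc p, q.2 k = u k := fun k hk =>
      h2 _ (Finset.mem_union_right _ (Finset.mem_union_right _ hk))
    have e1 := readHead_congr hb (hp2 _ (hhd p))
    have e2 := act_congr hb fun i => hp2 _ (hloc i p)
    have e3 := h2 _ (Finset.mem_union_right _ (Finset.mem_union_left _ (hhd n)))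
    simp only [step, load, simStep, h2 _ (Finset.mem_union_left _ hch),
      h2 _ (Finset.mem_union_left _ hsd), readState_congr hb, e3] at hp ⊢
    split_ifs at hp ⊢
    · exact hp
    · exact hp
    · rw [decide_eq_true_eq] at hp ⊢
      exact ⟨p, by rw [e1, e2]; exact hpp hp⟩
  | state q b =>
    obtain ⟨p, hpp⟩ : ∃ p, (∃ p, readHead u p ∧ (act u p).1 = q) →
        readHead u p ∧ (act u p).1 = q := by
      by_cases h : ∃ p, readHead u p ∧ (act u p).1 = q
      · exact ⟨h.choose, fun _ => h.choose_spec⟩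
      · exact ⟨0, fun h' => absurd h' h⟩
    refine ⟨∅, base ∪ loc p, fun w _ h2 => ?_⟩
    have hb : ∀ q' b, w.2 (state q' b) = u (state q' b) := fun q' b =>
      h2 _ (Finset.mem_union_left _ (hst _ _))
    have hp2 : ∀ k ∈ loc p, w.2 k = u k := fun k hk => h2 _ (Finset.mem_union_right _ hk)
    have e1 := readHead_congr hb (hp2 _ (hhd p))
    have e2 := act_congr hb fun i => hp2 _ (hloc i p)
    simp only [step, load, simStep, h2 _ (Finset.mem_union_left _ hch),
      h2 _ (Finset.mem_union_left _ hsd), readState_congr hb, hb] at hp ⊢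
    split_ifs at hp ⊢
    · exact hp
    · exact hp
    · rw [decide_eq_true_eq] at hp ⊢
      exact ⟨hp.1, p, by rw [e1, e2]; exact hpp hp.2⟩

/-- The cells `u` show the configuration `cfg`. -/
structure Shows (u : SimCell M → Bool) (cfg : M.Config) : Prop where
  tape : ∀ i n, u (tape i n) = cfg.tape i n
  state : (readState u).1 = cfg.state
  head : cfg.state ≠ M.halt → ∀ n, readHead u n ↔ n = cfg.head
  halt : cfg.state = M.halt → ∃ p, Sharp u p

theorem Sharp.readHead_iff {u : SimCell M → Bool} {p : M.State × Bool} (h : Sharp u p) (n : ℕ) :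
    readHead u n ↔ u (SimCell.head n) = true := by
  have hex : ∃ p, Sharp u p := ⟨p, h⟩
  rw [readHead, if_pos hex]

theorem shows_load (z : Real2) {u : SimCell M → Bool} (ht : ∀ i n, u (tape i n) = load (M := M) z (tape i n))
    (hh : ∀ n, u (head n) = load (M := M) z (head n))
    (hs : ∀ q b, u (state q b) = load (M := M) z (state q b)) :
    Shows u (M.init z) := by
  have h : Sharp u (M.start, false) := fun q b => by rw [hs]; simp [load]
  refine ⟨fun i n => ht i n, by rw [h.readState_eq]; rfl, fun _ n => ?_, fun _ => ⟨_, h⟩⟩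
  rw [h.readHead_iff, hh]
  simp [load, init]

theorem simStep_of_halt {u : SimCell M → Bool} (h : (readState u).1 = M.halt) : simStep u = u := by
  funext k
  cases k <;> simp [simStep, h]

theorem Shows.sharp_simStep {u : SimCell M → Bool} {cfg : M.Config} (h : Shows u cfg)
    (hh : cfg.state ≠ M.halt) :
    Sharp (simStep u) ((M.next cfg).state, !(readState u).2) := by
  intro q b
  classical
  have hh' : ¬ (readState u).1 = M.halt := by rwa [h.state]
  have hs : (M.next cfg).state = (M.trans cfg.state fun i => cfg.tape i cfg.head).1 := by
    simp [next, hh]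
  simp only [simStep, if_neg hh']
  rw [decide_eq_true_iff, hs]
  simp only [h.head hh, exists_eq_left, act, h.tape, h.state, Prod.mk.injEq]
  tauto

theorem Shows.simStep {u : SimCell M → Bool} {cfg : M.Config} (h : Shows u cfg) :
    Shows (simStep u) (M.next cfg) := by
  by_cases hh : cfg.state = M.halt
  · rw [M.next_of_halt hh, simStep_of_halt (h.state.trans hh)]
    exact h
  · have hs := h.sharp_simStep hh
    refine ⟨fun i n => ?_, by rw [hs.readState_eq], fun _ n => ?_, fun _ => ⟨_, hs⟩⟩
    · simp only [SimCell.simStep, h.state, next, hh, if_false, h.head hh, ne_eq, not_false_eq_true,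
        true_and, act, h.tape]
      split_ifs with hn
      · rw [hn, Function.update_self]
      · rw [Function.update_of_ne hn]
    · rw [hs.readHead_iff]
      simp only [SimCell.simStep, h.state, next, hh, if_false, h.head hh, decide_eq_true_eq,
        exists_eq_left, act, h.tape]
      exact eq_comm

/-- From a stage on at which the initial configuration is loaded, and as long as the simulation is
not started anew, the cells show the run of the machine. -/
theorem shows_run {z : Real2} {w : Ordinal.{0} → SimCell M → Bool}
    (h0 : Shows (w 0) (M.init z))
    (hs : ∀ ε i n, w (ε + 1) (tape i n) = SimCell.simStep (w ε) (tape i n))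
    (hs' : ∀ ε n, w (ε + 1) (head n) = SimCell.simStep (w ε) (head n))
    (hs'' : ∀ ε q b, w (ε + 1) (state q b) = SimCell.simStep (w ε) (state q b))
    (hl : IsLimsupSignal w) : ∀ ε, Shows (w ε) (M.run z ε) := by
  have hs3 : ∀ ε, readState (w (ε + 1)) = readState (SimCell.simStep (w ε)) := fun ε =>
    readState_congr fun q b => hs'' ε q b
  have hsucc : ∀ ε, Shows (w ε) (M.run z ε) → Shows (w (ε + 1)) (M.run z (ε + 1)) := by
    intro ε ih
    have h1 := ih.simStep
    rw [M.run_succ]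
    refine ⟨fun i n => by rw [hs]; exact h1.tape i n, by rw [hs3]; exact h1.state,
      fun hne n => ?_, fun he => ?_⟩
    · rw [readHead_congr (fun q b => hs'' ε q b) (hs' ε n)]
      exact h1.head hne n
    · obtain ⟨p, hp⟩ := h1.halt he
      exact ⟨p, fun q b => by rw [hs'']; exact hp q b⟩
  have hsharp : ∀ ε, Shows (w ε) (M.run z ε) → (M.run z ε).state ≠ M.halt →
      ∃ q, Sharp (w (ε + 1)) (q, !(readState (w ε)).2) := by
    intro ε ih hne
    have h1 := ih.sharp_simStep hne
    exact ⟨_, fun q b => by rw [hs'']; exact h1 q b⟩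
  intro ε
  induction ε using Ordinal.limitRecOn with
  | zero => rw [M.run_zero]; exact h0
  | add_one ε ih => exact hsucc ε ih
  | limit l hlim ih =>
    have htape : ∀ i n, w l (tape i n) = (M.run z l).tape i n := by
      intro i n
      rw [Bool.eq_iff_iff, hl l hlim, M.isLimsupSignal_tape z l hlim (i, n)]
      refine forall₂_congr fun β hβ => exists_congr fun γ => and_congr_right fun hγ => ?_
      rw [(ih γ hγ).tape]
    by_cases hhalt : ∃ β < l, (M.run z β).state = M.halt
    · obtain ⟨β, hβ, hβ'⟩ := hhalt
      -- After halting the state cells are frozen, so at the limit exactly one of them is still on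
      -- and the stage is not mistaken for a fresh limit.
      have hfro : ∀ γ, β ≤ γ → γ < l → ∀ q b, w γ (state q b) = w β (state q b) := by
        refine fun γ h1 => Ordinal.induction_ge (P := fun γ => γ < l →
          ∀ q b, w γ (state q b) = w β (state q b)) ?_ ?_ ?_ γ h1
        · exact fun _ _ _ => rfl
        · intro δ hδ ihδ hlt q b
          have hlt' : δ < l := (lt_add_one δ).trans hlt
          have : (readState (w δ)).1 = M.halt := by
            rw [(ih δ hlt').state, (M.run_of_halt hβ' δ hδ).1]
          rw [hs'', simStep_of_halt this, ihδ hlt']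
        · intro m hm hlt ihm hml q b
          exact (hl m hm).eq_of_eventually hlt fun γ h1 h2 => ihm γ h1 h2 (h2.trans hml) q b
      have hlst : ∀ q b, w l (state q b) = w β (state q b) := fun q b =>
        (hl l hlim).eq_of_eventually hβ fun γ h1 h2 => hfro γ h1 h2 q b
      have hst := (M.run_of_halt hβ' l hβ.le).1
      obtain ⟨p, hp⟩ := (ih β hβ).halt hβ'
      refine ⟨htape, ?_, fun hne => absurd hst hne, fun _ => ⟨p, fun q b => ?_⟩⟩
      · rw [readState_congr hlst, hst, (ih β hβ).state, hβ']
      · rw [hlst]; exact hp q b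
    · push Not at hhalt
      have hst := M.run_limit_state_of_not_halt z hlim hhalt
      -- Each phase occurs cofinally below `l`, carried by one of finitely many states; by
      -- pigeonhole one cell of each phase is on at `l`.
      have hphase : ∀ c : Bool, ∃ q, w l (state q c) = true := by
        intro c
        have := M.finite_state
        refine (hl l hlim).exists_of_finite (fun q => state q c) hlim.bot_lt fun β hβ => ?_
        have hβ1 : β + 1 < l := hlim.succ_lt hβ
        have hβ2 : β + 1 + 1 < l := hlim.succ_lt hβ1
        obtain ⟨q, hq⟩ := hsharp β (ih β hβ) (hhalt β hβ)
        obtain ⟨q', hq'⟩ := hsharp (β + 1) (ih _ hβ1) (hhalt _ hβ1)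
        rw [hq.readState_eq] at hq'
        by_cases hc : c = !(readState (w β)).2
        · exact ⟨β + 1, hβ1, (lt_add_one β).le, q, (hq _ _).2 (by rw [hc])⟩
        · refine ⟨β + 1 + 1, hβ2, ((lt_add_one β).trans (lt_add_one _)).le, q',
            (hq' _ _).2 ?_⟩
          rw [Prod.mk.injEq]
          refine ⟨rfl, ?_⟩
          revert hc
          cases c <;> cases (readState (w β)).2 <;> simp
      have hnot : ¬ ∃ p, Sharp (w l) p := by
        rintro ⟨p, hp⟩
        obtain ⟨q, hq⟩ := hphase true
        obtain ⟨q', hq'⟩ := hphase false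
        have := ((hp _ _).1 hq).trans ((hp _ _).1 hq').symm
        simp at this
      refine ⟨htape, ?_, fun _ n => ?_, fun he => ?_⟩
      · rw [readState, dif_neg hnot, hst.1]
      · rw [readHead, if_neg hnot, hst.2]
      · exact absurd (hst.1.symm.trans he) M.limit_ne_halt

theorem step_of_restart {c x : Real2} {u : SimCell M → Bool}
    (h : u changed = true ∨ u started = false) :
    (∀ i n, step c x u (tape i n) = load (M := M) (joinReal x c) (tape i n)) ∧
    (∀ n, step c x u (head n) = load (M := M) (joinReal x c) (head n)) ∧
    ∀ q b, step c x u (state q b) = load (M := M) (joinReal x c) (state q b) :=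
  ⟨fun _ _ => if_pos h, fun _ => if_pos h, fun _ _ => if_pos h⟩

theorem step_of_not_restart {c x : Real2} {u : SimCell M → Bool}
    (h : ¬ (u changed = true ∨ u started = false)) :
    (∀ i n, step c x u (tape i n) = SimCell.simStep u (tape i n)) ∧
    (∀ n, step c x u (head n) = SimCell.simStep u (head n)) ∧
    ∀ q b, step c x u (state q b) = SimCell.simStep u (state q b) :=
  ⟨fun _ _ => if_neg h, fun _ => if_neg h, fun _ _ => if_neg h⟩

end SimCell

open SimCell

/-- A function that is eventually computed by a machine with a parameter is realizable. -/
theorem realizable (M : ITTM) (c : Real2) (S : Prop) {f : Real2 → Real2}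
    (hf : ∀ x, M.EventuallyComputes (joinReal x c) (f x))
    (hS : S → ∀ x, ∃ α, (M.run (joinReal x c) α).state = M.halt) : Realizable S f := by
  refine ⟨SimCell M, inferInstance, SimCell.step c, fun n => tape 2 n, isOpen_step c, ?_⟩
  intro v u hv hu x α hα
  have hstarted : ∀ β, 1 ≤ β → u β started = true := by
    apply Ordinal.induction_ge
    · have := hu.succ 0
      rw [zero_add] at this
      rw [this]; rfl
    · intro β _ _
      rw [hu.succ]; rfl
    · intro l hl hlt ih
      exact (hu.limit l hl).eq_of_eventually hlt ih
  have hprev : ∀ β, α + 1 ≤ β → ∀ n, u β (prev n) = x n := by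
    apply Ordinal.induction_ge
    · intro n
      rw [hu.succ]
      exact congrFun (hα α le_rfl) n
    · intro β hβ _ n
      rw [hu.succ]
      exact congrFun (hα β ((lt_add_one α).le.trans hβ)) n
    · intro l hl hlt ih n
      exact (hu.limit l hl).eq_of_eventually hlt fun γ h1 h2 => ih γ h1 h2 n
  have hchanged : ∀ β, α + 1 + 1 ≤ β → u β changed = false := by
    have key : ∀ β, α + 1 ≤ β → u (β + 1) changed = false := by
      intro β hβ
      rw [hu.succ]
      simp only [SimCell.step, decide_eq_false_iff_not, not_exists, not_not]
      intro n
      rw [hprev β hβ, hα β ((lt_add_one α).le.trans hβ)]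
    apply Ordinal.induction_ge
    · exact key _ le_rfl
    · intro β hβ _
      exact key β ((lt_add_one _).le.trans hβ)
    · intro l hl hlt ih
      exact (hu.limit l hl).eq_of_eventually hlt ih
  let R : Ordinal.{0} → Prop := fun β => u β changed = true ∨ u β started = false
  -- There is a last restart. The least stage from which no restart occurs is not 0, as nothing has
  -- started then. It is not a limit either: restarts cofinal below it would leave `changed` on at
  -- that limit.
  obtain ⟨γ, hγ, hγ'⟩ : ∃ γ, R γ ∧ ∀ β, γ < β → ¬ R β := by
    have hex : ∃ δ, ∀ β, δ ≤ β → ¬ R β := by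
      refine ⟨α + 1 + 1, fun β hβ h => ?_⟩
      rcases h with h | h
      · rw [hchanged β hβ] at h; exact absurd h (by simp)
      · rw [hstarted β ((by simp : (1 : Ordinal.{0}) ≤ α + 1 + 1).trans hβ)] at h
        exact absurd h (by simp)
    obtain ⟨δ, hδ, hmin⟩ := WellFounded.has_min (wellFounded_lt (α := Ordinal.{0}))
      {δ | ∀ β, δ ≤ β → ¬ R β} hex
    have hδ' : ∀ β, δ ≤ β → ¬ R β := hδ
    have hR0 : R 0 := Or.inr (by rw [hu.zero])
    rcases Ordinal.zero_or_succ_or_isSuccLimit δ with rfl | ⟨γ, rfl⟩ | hlim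
    · exact absurd hR0 (hδ' 0 le_rfl)
    · refine ⟨γ, ?_, fun β hβ => hδ' β (Order.add_one_le_of_lt hβ)⟩
      by_contra hne
      refine hmin γ (fun β hβ => ?_) (lt_add_one γ)
      rcases hβ.eq_or_lt with rfl | h
      · exact hne
      · exact hδ' β (Order.add_one_le_of_lt h)
    · exfalso
      refine hδ' δ le_rfl (Or.inl ((hu.limit δ hlim changed).2 fun β hβ => ?_))
      have hlt : β + 1 < δ := hlim.succ_lt hβ
      by_contra hcon
      push Not at hcon
      refine hmin (β + 1) (fun ε hε hR => ?_) hlt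
      by_cases hεδ : ε < δ
      · rcases hR with h | h
        · exact hcon ε hεδ ((lt_add_one β).le.trans hε) h
        · rw [hstarted ε ((by simp : (1 : Ordinal.{0}) ≤ β + 1).trans hε)] at h
          exact absurd h (by simp)
      · exact hδ' ε (not_lt.1 hεδ) hR
  -- After the last restart no change of the input is registered, so the input at stage `γ` is
  -- already the final one and the simulation loaded there has the right input.
  have hvγ : ∀ β, γ ≤ β → v β = v γ := by
    apply Ordinal.induction_ge
    · rfl
    · intro β hβ ih
      have h1 : ¬ R (β + 1 + 1) :=
        hγ' _ ((hβ.trans_lt (lt_add_one β)).trans (lt_add_one _))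
      have h2 : ¬ u (β + 1 + 1) changed = true := fun h => h1 (Or.inl h)
      rw [hu.succ] at h2
      simp only [SimCell.step, decide_eq_true_eq, not_exists, not_not] at h2
      funext n
      rw [h2 n, hu.succ, ← ih]
      rfl
    · intro l hl hlt ih
      funext n
      exact (hv l hl).eq_of_eventually hlt fun β h1 h2 => by rw [ih β h1 h2]
  have hx : v γ = x := by
    rw [← hvγ (max γ α) (le_max_left _ _), hα _ (le_max_right _ _)]
  have hno : ∀ ε, ¬ R (γ + 1 + ε) := fun ε =>
    hγ' _ ((lt_add_one γ).trans_le le_self_add)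
  have hrun : ∀ ε, Shows (u (γ + 1 + ε)) (M.run (joinReal x c) ε) := by
    have h0 := step_of_restart (c := c) (x := v γ) hγ
    rw [← hu.succ, hx] at h0
    have h0' := shows_load _ h0.1 h0.2.1 h0.2.2
    have hst := fun ε => step_of_not_restart (c := c) (x := v (γ + 1 + ε)) (hno ε)
    refine shows_run (w := fun ε => u (γ + 1 + ε)) (by simpa using h0')
      (fun ε i n => ?_) (fun ε n => ?_) (fun ε q b => ?_) (hu.limit.shift _)
    · rw [← (hst ε).1, ← hu.succ, add_assoc (γ + 1) ε 1]
    · rw [← (hst ε).2.1, ← hu.succ, add_assoc (γ + 1) ε 1]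
    · rw [← (hst ε).2.2, ← hu.succ, add_assoc (γ + 1) ε 1]
  obtain ⟨δ, hδ⟩ := hf x
  have hout : ∀ β, γ + 1 + δ ≤ β → ∀ n, u β (tape 2 n) = f x n := by
    intro β hβ n
    have h1 : γ + 1 ≤ β := le_self_add.trans hβ
    rw [← Ordinal.add_sub_cancel_of_le h1, (hrun _).tape,
      hδ _ (by rwa [Ordinal.le_sub_of_le h1])]
  by_cases hs : S
  swap
  · exact ⟨_, hout, fun h => absurd h hs⟩
  obtain ⟨η, hη⟩ := hS hs x
  -- By this stage the simulated machine has halted and the cells that watch the input have settled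
  -- as well.
  let ζ := max (γ + 1 + max δ η) (α + 1 + 1)
  have hζ1 : γ + 1 + δ ≤ ζ := ((by simp : γ + 1 + δ ≤ γ + 1 + max δ η)).trans (le_max_left _ _)
  have hζ2 : γ + 1 + η ≤ ζ := ((by simp : γ + 1 + η ≤ γ + 1 + max δ η)).trans (le_max_left _ _)
  have hζ3 : α + 1 + 1 ≤ ζ := le_max_right _ _
  refine ⟨ζ, fun β hβ => hout β (hζ1.trans hβ), fun _ => ?_⟩
  apply Ordinal.induction_ge
  · rfl
  · intro β hβ ih
    have h1 : γ + 1 ≤ β := le_self_add.trans (hζ2.trans hβ)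
    have hh : (readState (u β)).1 = M.halt := by
      rw [← Ordinal.add_sub_cancel_of_le h1, (hrun _).state]
      refine (M.run_of_halt hη _ ?_).1
      rw [Ordinal.le_sub_of_le h1]
      exact hζ2.trans hβ
    have hR : ¬ R β := hγ' β ((lt_add_one γ).trans_le h1)
    have hst := step_of_not_restart (c := c) (x := v β) hR
    rw [simStep_of_halt hh, ← hu.succ] at hst
    rw [← ih]
    funext k
    have h2 : α + 1 + 1 ≤ β := hζ3.trans hβ
    cases k with
    | prev n =>
      have h3 : α + 1 ≤ β := (lt_add_one _).le.trans h2
      rw [hprev _ h3, hprev _ (h3.trans (lt_add_one β).le)]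
    | changed => rw [hchanged _ h2, hchanged _ (h2.trans (lt_add_one β).le)]
    | started =>
      have h3 : 1 ≤ β := (by simp : (1 : Ordinal.{0}) ≤ α + 1 + 1).trans h2
      rw [hstarted _ h3, hstarted _ (h3.trans (lt_add_one β).le)]
    | tape i n => exact hst.1 i n
    | head n => exact hst.2.1 n
    | state q b => exact hst.2.2 q b
  · intro l hl hlt ih
    funext k
    exact (hu.limit l hl).eq_of_eventually hlt fun β h1 h2 => by rw [ih β h1 h2]

end ITTM

theorem InfTimeComputable.realizable {f : Real2 → Real2} (hf : InfTimeComputable f) :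
    Realizable True f := by
  obtain ⟨M, c, h⟩ := hf
  exact M.realizable c True (fun x => (h x).eventuallyComputes) fun _ x => (h x).imp fun _ h => h.1

theorem EventuallyComputable.realizable {f : Real2 → Real2} (hf : EventuallyComputable f) :
    Realizable False f := by
  obtain ⟨M, c, h⟩ := hf
  exact M.realizable c False h False.elim

/-! ### Machines that act on blocks of sixteen cells, and their simulation -/

/-- The contents of a block of sixteen cells on each of the three tapes. -/
abbrev Block : Type := Fin 3 → Fin 16 → Bool

/-- An infinite time machine that reads and writes a whole block of cells in a single step. -/
structure BlockMachine where
  State : Type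
  finite_state : Finite State
  start : State
  limit : State
  halt : State
  start_ne_halt : start ≠ halt
  limit_ne_halt : limit ≠ halt
  start_ne_limit : start ≠ limit
  trans : State → Block → State × Block × Turing.Dir

namespace BlockMachine

/-- A configuration of a block machine. -/
structure Config (B : BlockMachine) where
  state : B.State
  head : ℕ
  tape : ℕ → Block

variable (B : BlockMachine)

/-- The block machine configuration that follows `c`. -/
def next (c : B.Config) : B.Config where
  state := (B.trans c.state (c.tape c.head)).1
  head := ITTM.moveHead (B.trans c.state (c.tape c.head)).2.2 c.head
  tape := Function.update c.tape c.head (B.trans c.state (c.tape c.head)).2.1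

/-- The transition table of the machine simulating `B`: it reads a block from left to right, writes
it from right to left, and then moves to the neighbouring block. -/
def microTrans (s : B.State × Block × Fin 48) (r : Fin 3 → Bool) :
    (B.State × Block × Fin 48) × (Fin 3 → Bool) × Turing.Dir :=
  if s.2.2.1 < 16 then
    ((s.1, (fun i o => if o.1 = s.2.2.1 then r i else s.2.1 i o), s.2.2 + 1), r, Turing.Dir.right)
  else if s.2.2.1 = 16 then ((s.1, s.2.1, s.2.2 + 1), r, Turing.Dir.left)
  else if s.2.2.1 < 32 then ((s.1, s.2.1, s.2.2 + 1),
    (fun i => (B.trans s.1 s.2.1).2.1 i (Fin.ofNat 16 (32 - s.2.2.1))), Turing.Dir.left)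
  -- The move away from cell 0 of the block is already part of the journey: the micro steps 32 to 47
  -- make sixteen moves, exactly one block, and on the first block left moves stay at 0.
  else if s.2.2.1 = 32 then ((s.1, s.2.1, s.2.2 + 1),
    (fun i => (B.trans s.1 s.2.1).2.1 i 0), (B.trans s.1 s.2.1).2.2)
  else if s.2.2.1 < 47 then ((s.1, s.2.1, s.2.2 + 1), r, (B.trans s.1 s.2.1).2.2)
  else (((B.trans s.1 s.2.1).1, (fun _ _ => false), 0), r, (B.trans s.1 s.2.1).2.2)

/-- The machine that simulates the block machine `B`. -/
def toITTM : ITTM where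
  State := B.State × Block × Fin 48
  finite_state := by
    have := B.finite_state
    infer_instance
  start := (B.start, (fun _ _ => false), 0)
  limit := (B.limit, (fun _ _ => false), 0)
  halt := (B.halt, (fun _ _ => false), 0)
  start_ne_halt := fun h => B.start_ne_halt (congrArg Prod.fst h)
  limit_ne_halt := fun h => B.limit_ne_halt (congrArg Prod.fst h)
  start_ne_limit := fun h => B.start_ne_limit (congrArg Prod.fst h)
  trans := B.microTrans

/-- A tape that shows the given blocks. -/
def flatten (T : ℕ → Block) (i : Fin 3) (p : ℕ) : Bool := T (p / 16) i (Fin.ofNat 16 p)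

/-- The blocks shown by a tape. -/
def blocksOf (t : Fin 3 → ℕ → Bool) : ℕ → Block := fun n i o => t i (16 * n + o)

theorem flatten_blocksOf (t : Fin 3 → ℕ → Bool) : flatten (blocksOf t) = t := by
  funext i p
  simp only [flatten, blocksOf, Fin.ofNat]
  congr 1
  omega

theorem blocksOf_flatten (T : ℕ → Block) : blocksOf (flatten T) = T := by
  funext n i o
  have h1 : (16 * n + o.1) / 16 = n := by omega
  have h2 : Fin.ofNat 16 (16 * n + o.1) = o := by ext; simp [Fin.ofNat]
  simp only [flatten, blocksOf, h1, h2]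

/-- The configuration of the simulating machine that represents `c`. -/
def encode (c : B.Config) : B.toITTM.Config where
  state := (c.state, (fun _ _ => false), 0)
  head := 16 * c.head
  tape := flatten c.tape

/-- The configurations of the simulating machine during the simulation of one step. -/
def micro (c : B.Config) (j : ℕ) : B.toITTM.Config where
  state := (c.state, (fun i o => if o.1 < j then c.tape c.head i o else false), Fin.ofNat 48 j)
  head := if j ≤ 16 then 16 * c.head + j else if j ≤ 32 then 16 * c.head + (32 - j) else
    match (B.trans c.state (c.tape c.head)).2.2 with
    | Turing.Dir.left => 16 * c.head - (j - 32)
    | Turing.Dir.right => 16 * c.head + (j - 32)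
  -- The cell with offset o is written in micro step 32 - o, so the new value is visible once 33 ≤ j
  -- + o.
  tape := fun i p => if p / 16 = c.head ∧ 33 ≤ j + p % 16 then
    (B.trans c.state (c.tape c.head)).2.1 i (Fin.ofNat 16 p) else flatten c.tape i p

theorem micro_zero (c : B.Config) : B.micro c 0 = B.encode c := by
  simp only [micro, encode]
  congr 1
  funext i p
  rw [if_neg (by omega)]

theorem ITTM_config_ext {M : ITTM} {c d : M.Config} (h1 : c.state = d.state) (h2 : c.head = d.head)
    (h3 : c.tape = d.tape) : c = d := by
  cases c; cases d; simp_all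

theorem buffer_eq {c : B.Config} {j : ℕ} (hj : 16 ≤ j) :
    (fun (i : Fin 3) (o : Fin 16) => if o.1 < j then c.tape c.head i o else false) =
      c.tape c.head := by
  funext i o
  rw [if_pos (by omega)]

theorem next_micro (c : B.Config) (hc : c.state ≠ B.halt) {j : ℕ} (hj : j < 47) :
    B.toITTM.next (B.micro c j) = B.micro c (j + 1) := by
  have hne : ¬ (B.micro c j).state = B.toITTM.halt := fun h => hc (congrArg Prod.fst h)
  have hjj : j % 48 = j := by omega
  have hj1 : Fin.ofNat 48 j + 1 = Fin.ofNat 48 (j + 1) := by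
    ext; simp [Fin.ofNat, Fin.val_add]
  rw [ITTM.next, if_neg hne]
  have htr : B.toITTM.trans = B.microTrans := rfl
  have hval : (Fin.ofNat 48 j).1 = j := hjj
  have hmod : ∀ m < 16, (16 * c.head + m) / 16 = c.head ∧ (16 * c.head + m) % 16 = m := by
    intro m hm; omega
  have hupd : ∀ (t : Fin 3 → ℕ → Bool) (p : ℕ), (fun i => Function.update (t i) p (t i p)) = t :=
    fun t p => funext fun i => Function.update_eq_self _ _
  rcases lt_or_ge j 16 with h | h
  · have hsym : ∀ i, (B.micro c j).tape i (B.micro c j).head = c.tape c.head i (Fin.ofNat 16 j) := by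
      intro i
      have := hmod j h
      simp only [micro, if_pos h.le, this.1, this.2]
      rw [if_neg (by omega), flatten, this.1]
      congr 1
      ext; simp [Fin.ofNat]
    refine ITTM_config_ext ?_ ?_ ?_
    · simp only [htr, microTrans, hsym]
      simp only [micro, hval, if_pos h, hj1]
      congr 2
      funext i o
      by_cases ho : o.1 = j
      · rw [if_pos ho, if_pos (by omega)]
        congr 1
        ext; simp [Fin.ofNat]; omega
      · rw [if_neg ho]
        exact if_congr (by omega) rfl rfl
    · simp only [htr, microTrans]
      simp only [micro, hval, if_pos h, ITTM.moveHead, if_pos h.le, if_pos (show j + 1 ≤ 16 by omega)]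
      omega
    · simp only [htr, microTrans]
      have e : (B.micro c j).state.2.2.1 < 16 := by simp only [micro, hval]; exact h
      simp only [if_pos e, hupd]
      funext i p
      exact if_congr (by omega) rfl rfl
  have hb := B.buffer_eq (c := c) h
  have hb' := B.buffer_eq (c := c) (j := j + 1) (by omega)
  have hst : (B.micro c j).state = (c.state, c.tape c.head, Fin.ofNat 48 j) := by
    simp only [micro, hb]
    rfl
  have hst' : (B.micro c (j + 1)).state = (c.state, c.tape c.head, Fin.ofNat 48 (j + 1)) := by
    simp only [micro, hb']
    rfl
  simp only [htr, microTrans, hst, hval, hj1, if_neg (not_lt.2 h)]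
  have hwrite : 17 ≤ j → j ≤ 32 → (fun i => Function.update ((B.micro c j).tape i)
      (B.micro c j).head ((B.trans c.state (c.tape c.head)).2.1 i (Fin.ofNat 16 (32 - j)))) =
      (B.micro c (j + 1)).tape := by
    intro h1 h2
    have hh : (B.micro c j).head = 16 * c.head + (32 - j) := by
      simp only [micro, if_neg (show ¬ j ≤ 16 by omega), if_pos h2]
    have := hmod (32 - j) (by omega)
    funext i p
    rw [hh]
    by_cases hp : p = 16 * c.head + (32 - j)
    · subst hp
      rw [Function.update_self]
      simp only [micro, this.1, this.2]
      rw [if_pos ⟨trivial, by omega⟩]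
      exact congrArg _ (by ext; simp [Fin.ofNat])
    · rw [Function.update_of_ne hp]
      exact if_congr (by omega) rfl rfl
  have hkeep : (j = 16 ∨ 33 ≤ j) → (B.micro c j).tape = (B.micro c (j + 1)).tape := by
    intro h1
    funext i p
    exact if_congr (by omega) rfl rfl
  rcases h.eq_or_lt with h1 | h1
  · subst h1
    simp only [if_true, hupd]
    refine ITTM_config_ext hst'.symm ?_ (hkeep (by omega))
    simp [micro, ITTM.moveHead]
  rw [if_neg (by omega)]
  rcases lt_or_ge j 32 with h2 | h2
  · rw [if_pos h2]
    refine ITTM_config_ext hst'.symm ?_ (hwrite (by omega) (by omega))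
    simp only [micro, ITTM.moveHead]
    rw [if_neg (by omega), if_pos (by omega), if_neg (by omega), if_pos (by omega)]
    omega
  rw [if_neg (by omega)]
  rcases h2.eq_or_lt with h3 | h3
  · subst h3
    simp only [if_true]
    refine ITTM_config_ext hst'.symm ?_ (hwrite (by omega) (by omega))
    simp only [micro]
    cases (B.trans c.state (c.tape c.head)).2.2 <;> simp [ITTM.moveHead]
  rw [if_neg (by omega), if_pos (by omega)]
  simp only [hupd]
  refine ITTM_config_ext hst'.symm ?_ (hkeep (by omega))
  simp only [micro]
  rw [if_neg (by omega), if_neg (by omega), if_neg (by omega), if_neg (by omega)]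
  cases (B.trans c.state (c.tape c.head)).2.2 <;> simp only [ITTM.moveHead] <;> omega

theorem flatten_next_tape (c : B.Config) : flatten (B.next c).tape = (B.micro c 47).tape := by
  funext i p
  simp only [flatten, next, micro]
  by_cases h : p / 16 = c.head
  · rw [if_pos ⟨h, by omega⟩, h, Function.update_self]
  · rw [if_neg (by tauto), Function.update_of_ne h]

theorem next_micro_last (c : B.Config) (hc : c.state ≠ B.halt) :
    B.toITTM.next (B.micro c 47) = B.encode (B.next c) := by
  have hne : ¬ (B.micro c 47).state = B.toITTM.halt := fun h => hc (congrArg Prod.fst h)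
  rw [ITTM.next, if_neg hne]
  have htr : B.toITTM.trans = B.microTrans := rfl
  have hst : (B.micro c 47).state = (c.state, c.tape c.head, Fin.ofNat 48 47) := by
    simp only [micro, B.buffer_eq (c := c) (show 16 ≤ 47 by omega)]
    rfl
  have hval : (Fin.ofNat 48 47).1 = 47 := rfl
  simp only [htr, microTrans, hst, hval]
  norm_num
  refine ITTM_config_ext rfl ?_ ?_
  · simp only [encode, next, micro]
    cases (B.trans c.state (c.tape c.head)).2.2 <;> simp [ITTM.moveHead] <;> omega
  · exact (B.flatten_next_tape c).symm

/-- The run of the simulating machine during the simulation of one step. -/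
theorem run_micro {z : Real2} {α : Ordinal.{0}} {c : B.Config} (hc : c.state ≠ B.halt)
    (h : B.toITTM.run z α = B.encode c) :
    (∀ j < 48, B.toITTM.run z (α + (j : ℕ)) = B.micro c j) ∧
      B.toITTM.run z (α + (48 : ℕ)) = B.encode (B.next c) := by
  have h1 : ∀ j < 48, B.toITTM.run z (α + (j : ℕ)) = B.micro c j := by
    intro j
    induction j with
    | zero => intro _; rw [Nat.cast_zero, add_zero, h, micro_zero]
    | succ j ih =>
      intro hj
      rw [Nat.cast_succ, ← add_assoc, ITTM.run_succ, ih (by omega), B.next_micro c hc (by omega)]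
  refine ⟨h1, ?_⟩
  rw [show (48 : ℕ) = 47 + 1 from rfl, Nat.cast_succ, ← add_assoc, ITTM.run_succ, h1 47 (by omega),
    B.next_micro_last c hc]

/-- Micro steps never produce foreign values. Therefore a bit that settles along the block steps
also settles along the micro steps, and its limsup is the expected one. -/
theorem micro_tape (c : B.Config) (j : ℕ) (i : Fin 3) (p : ℕ) :
    (B.micro c j).tape i p = flatten c.tape i p ∨
      (B.micro c j).tape i p = flatten (B.next c).tape i p := by
  rw [flatten_next_tape]
  simp only [micro]
  split_ifs <;> first | tauto | omega

/-- The run of the simulating machine during finitely many steps. -/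
theorem run_iterate {z : Real2} {α : Ordinal.{0}} {c : B.Config}
    (h : B.toITTM.run z α = B.encode c) (hc : ∀ m, (B.next^[m] c).state ≠ B.halt) (m : ℕ) :
    B.toITTM.run z (α + ((48 * m : ℕ) : Ordinal.{0})) = B.encode (B.next^[m] c) := by
  induction m with
  | zero => simpa using h
  | succ m ih =>
    have := (B.run_micro (hc m) ih).2
    rw [Function.iterate_succ_apply', ← this, add_assoc, ← Nat.cast_add, Nat.mul_succ]

/-- During an infinite sequence of steps every cell shows at every moment its value before or after
the current step. -/
theorem run_tape_between {z : Real2} {α : Ordinal.{0}} {c : B.Config}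
    (h : B.toITTM.run z α = B.encode c) (hc : ∀ m, (B.next^[m] c).state ≠ B.halt)
    (n : ℕ) (i : Fin 3) (p : ℕ) :
    ∃ m, n / 48 ≤ m ∧ (B.toITTM.run z (α + (n : ℕ))).tape i p = flatten (B.next^[m] c).tape i p := by
  have h1 := (B.run_micro (hc (n / 48)) (B.run_iterate h hc (n / 48))).1 (n % 48) (by omega)
  rw [add_assoc, ← Nat.cast_add, Nat.div_add_mod] at h1
  rw [h1]
  rcases B.micro_tape (B.next^[n / 48] c) (n % 48) i p with h2 | h2
  · exact ⟨_, le_rfl, h2⟩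
  · exact ⟨n / 48 + 1, by omega, by rw [h2, Function.iterate_succ_apply']⟩

/-- The situation at the limit of an infinite sequence of steps. -/
theorem run_add_omega {z : Real2} {α : Ordinal.{0}} {c : B.Config}
    (h : B.toITTM.run z α = B.encode c) (hc : ∀ m, (B.next^[m] c).state ≠ B.halt) :
    ∃ T : ℕ → Block, B.toITTM.run z (α + Ordinal.omega0) = B.encode ⟨B.limit, 0, T⟩ ∧
      ∀ n i o b, (∃ K, ∀ m, K ≤ m → (B.next^[m] c).tape n i o = b) → T n i o = b := by
  have hlim : Order.IsSuccLimit (α + Ordinal.omega0) :=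
    Ordinal.isSuccLimit_add α Ordinal.isSuccLimit_omega0
  -- A halt inside a step would persist until the end of some later block step, where the state is
  -- known not to be halting.
  have hstate : ∀ β < α + Ordinal.omega0, (B.toITTM.run z β).state ≠ B.toITTM.halt := by
    intro β hβ hh
    obtain ⟨n, hn⟩ : ∃ n : ℕ, β ≤ α + n := by
      rcases le_total β α with h1 | h1
      · exact ⟨0, by simpa using h1⟩
      · have : β - α < Ordinal.omega0 := by rwa [Ordinal.sub_lt_of_le h1]
        obtain ⟨n, hn⟩ := Ordinal.lt_omega0.1 this
        exact ⟨n, by rw [← hn, Ordinal.add_sub_cancel_of_le h1]⟩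
    have h2 : β ≤ α + ((48 * n : ℕ) : Ordinal.{0}) := hn.trans (by
      gcongr
      omega)
    have h3 := (B.toITTM.run_of_halt hh _ h2).1
    rw [B.run_iterate h hc] at h3
    exact hc n (congrArg Prod.fst h3)
  have hst := B.toITTM.run_limit_state_of_not_halt z hlim hstate
  refine ⟨blocksOf (B.toITTM.run z (α + Ordinal.omega0)).tape,
    ITTM_config_ext hst.1 hst.2 (flatten_blocksOf _).symm, ?_⟩
  rintro n i o b ⟨K, hK⟩
  refine (B.toITTM.isLimsupSignal_tape z _ hlim).eq_of_eventually (k := (i, 16 * n + o.1))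
    (β := α + ((48 * K : ℕ) : Ordinal.{0})) ?_ ?_
  · gcongr
    exact Ordinal.natCast_lt_omega0 _
  · intro γ h1 h2
    have h3 : α ≤ γ := le_self_add.trans h1
    have h4 : γ - α < Ordinal.omega0 := by rwa [Ordinal.sub_lt_of_le h3]
    obtain ⟨m, hm⟩ := Ordinal.lt_omega0.1 h4
    rw [← Ordinal.add_sub_cancel_of_le h3, hm] at h1 ⊢
    have h5 : 48 * K ≤ m := by
      rw [add_le_add_iff_left] at h1
      exact_mod_cast h1
    obtain ⟨k, hk, hk'⟩ := B.run_tape_between h hc m i (16 * n + o.1)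
    simp only [hk']
    rw [show flatten (B.next^[k] c).tape i (16 * n + o.1) = blocksOf (flatten (B.next^[k] c).tape) n i o
      from rfl, blocksOf_flatten]
    exact hK k (by omega)

end BlockMachine

/-! ### The universal machine and the execution of single instructions -/

/-- The instructions of the universal machine: the token moves, a bit of the block at the token is
compared with a given value, or a value is written there if no comparison has failed. -/
inductive Instr
  | move (d : Turing.Dir)
  | test (i : Fin 3) (j : Fin 16) (b : Bool)
  | write (i : Fin 3) (j : Fin 16) (b : Bool)

namespace Instr

/-- An auxiliary injection into a finite type. -/
def toSum : Instr → Bool ⊕ Bool × Fin 3 × Fin 16 × Bool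
  | move .left => .inl false
  | move .right => .inl true
  | test i j b => .inr (false, i, j, b)
  | write i j b => .inr (true, i, j, b)

theorem toSum_injective : Function.Injective toSum := by
  rintro (⟨_ | _⟩ | ⟨i, j, b⟩ | ⟨i, j, b⟩) (⟨_ | _⟩ | ⟨i', j', b'⟩ | ⟨i', j', b'⟩) h <;>
    simp_all [toSum]

/-- There are at most 2 + 2 · 3 · 16 · 2 = 194 instructions, against 256 codes. -/
theorem exists_code : ∃ f : Instr → Fin 8 → Bool, Function.Injective f := by
  obtain ⟨e⟩ := Function.Embedding.nonempty_of_card_le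
    (α := Bool ⊕ Bool × Fin 3 × Fin 16 × Bool) (β := Fin 8 → Bool) (by simp)
  exact ⟨e ∘ toSum, e.injective.comp toSum_injective⟩

/-- A code of instructions by eight bits. -/
def code : Instr → Fin 8 → Bool := exists_code.choose

theorem code_injective : Function.Injective code := exists_code.choose_spec

instance : Finite Instr := Finite.of_injective _ code_injective

instance : Nonempty Instr := ⟨move .left⟩

end Instr

/-- The instruction in a block, on the odd cells of the input tape. -/
def instrAt (γ : Block) : Instr :=
  Function.invFun Instr.code fun l => γ 0 (Fin.ofNat 16 (2 * l + 1))

/-- Change one bit of a block. -/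
def Block.set (γ : Block) (i : Fin 3) (j : Fin 16) (b : Bool) : Block :=
  fun i' j' => if i' = i ∧ j' = j then b else γ i' j'

/-- The control states of the universal machine. -/
inductive UState
  | start
  | limit
  | halt
  | clean
  | seekInstr (r : Bool)
  | markInstr (r : Bool) (s : Instr)
  | seekToken (r : Bool) (s : Instr)
  | markToken (r : Bool)

namespace UState

instance : Finite UState := by
  let e : Fin 4 ⊕ Bool ⊕ (Bool × Instr) ⊕ (Bool × Instr) ⊕ Bool → UState := fun s => match s with
    | .inl 0 => start
    | .inl 1 => limit
    | .inl 2 => halt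
    | .inl 3 => clean
    | .inr (.inl r) => seekInstr r
    | .inr (.inr (.inl p)) => markInstr p.1 p.2
    | .inr (.inr (.inr (.inl p))) => seekToken p.1 p.2
    | .inr (.inr (.inr (.inr r))) => markToken r
  refine Finite.of_surjective e ?_
  rintro (_ | _ | _ | _ | r | ⟨r, s⟩ | ⟨r, s⟩ | r)
  exacts [⟨.inl 0, rfl⟩, ⟨.inl 1, rfl⟩, ⟨.inl 2, rfl⟩, ⟨.inl 3, rfl⟩, ⟨.inr (.inl r), rfl⟩,
    ⟨.inr (.inr (.inl (r, s))), rfl⟩, ⟨.inr (.inr (.inr (.inl (r, s)))), rfl⟩,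
    ⟨.inr (.inr (.inr (.inr r))), rfl⟩]

end UState

/-- On the scratch tape of a block, cell `0` shows the present and cell `1` the next value of a
network cell, cells `2` and `3` mark the token and the current instruction, cell `4` shows the phase
and cell `5` the wish to halt. At the beginning of each network step the next values become the
present ones. -/
def cleanBlock (γ : Block) : Block := fun i j =>
  if i = 1 ∧ j = 0 then γ 1 1
  else if i = 1 ∧ (j = 1 ∨ j = 2 ∨ j = 3 ∨ j = 4) then false else γ i j

/-- The transition function of the universal machine. -/
def uTrans : UState → Block → UState × Block × Turing.Dir
  | .start, γ => (.clean, cleanBlock γ, .right)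
  | .clean, γ => (.clean, cleanBlock γ, .right)
  | .halt, γ => (.halt, γ, .right)
  -- A limit with the phase off comes after cleaning and starts the rules. With the phase on it
  -- comes after a pass through the rules, or is a limit of network steps, where the phase was on
  -- cofinally.
  | .limit, γ =>
    if γ 1 4 then
      if γ 1 5 then (.halt, γ, .right) else (.clean, cleanBlock γ, .right)
    else (.seekInstr true, ((γ.set 1 4 true).set 1 2 true).set 1 3 true, .left)
  | .seekInstr r, γ =>
    if γ 1 3 then (.markInstr r (instrAt γ), γ.set 1 3 false, .right) else (.seekInstr r, γ, .right)
  | .markInstr r s, γ => (.seekToken r s, γ.set 1 3 true, .left)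
  | .seekToken r s, γ =>
    if γ 1 2 then
      match s with
      | .move d => (.markToken r, γ.set 1 2 false, d)
      | .test i j b => (.seekInstr (r && (γ i j == b)), γ, .right)
      -- The write ends a rule, so the register is reset for the tests of the next one.
      | .write i j b => (.seekInstr true, if r then γ.set i j b else γ, .right)
    else (.seekToken r s, γ, .left)
  -- Moving left here keeps the head from passing the instruction mark, which the next search seeks
  -- only to the right.
  | .markToken r, γ => (.seekInstr r, γ.set 1 2 true, .left)

/-- The universal machine. -/
def universal : BlockMachine where
  State := UState
  finite_state := inferInstance
  start := .start
  limit := .limit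
  halt := .halt
  start_ne_halt := by simp
  limit_ne_halt := by simp
  start_ne_limit := by simp
  trans := uTrans

namespace universal

/-- The tape with data `T`, whose tokens and instruction marks are given by `D` and `I`. -/
def marks (T : ℕ → Block) (D I : ℕ → Bool) : ℕ → Block := fun n i j =>
  if i = 1 ∧ j = 2 then D n else if i = 1 ∧ j = 3 then I n else T n i j

/-- Two tapes carry the same data. -/
def SameData (T T' : ℕ → Block) : Prop :=
  ∀ n i j, ¬ (i = 1 ∧ (j = 2 ∨ j = 3)) → T n i j = T' n i j

theorem sameData_marks (T : ℕ → Block) (D I : ℕ → Bool) : SameData (marks T D I) T := by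
  intro n i j h
  rw [marks, if_neg (by tauto), if_neg (by tauto)]

theorem marks_data (T : ℕ → Block) (D I : ℕ → Bool) (n : ℕ) {i : Fin 3} {j : Fin 16}
    (h : ¬ (i = 1 ∧ (j = 2 ∨ j = 3))) : marks T D I n i j = T n i j :=
  sameData_marks T D I n i j h

theorem marks_token (T : ℕ → Block) (D I : ℕ → Bool) (n : ℕ) : marks T D I n 1 2 = D n := by
  simp [marks]

theorem marks_instr (T : ℕ → Block) (D I : ℕ → Bool) (n : ℕ) : marks T D I n 1 3 = I n := by
  simp [marks]

theorem instrAt_marks (T : ℕ → Block) (D I : ℕ → Bool) (n : ℕ) :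
    instrAt (marks T D I n) = instrAt (T n) := by
  simp [instrAt, marks]

theorem update_marks_token (T : ℕ → Block) (D I : ℕ → Bool) (n : ℕ) (b : Bool) :
    Function.update (marks T D I) n ((marks T D I n).set 1 2 b) =
      marks T (Function.update D n b) I := by
  funext m i j
  by_cases hm : m = n
  · subst hm
    simp only [Function.update_self, Block.set, marks]
    split_ifs <;> rfl
  · simp only [Function.update_of_ne hm, marks]

theorem update_marks_instr (T : ℕ → Block) (D I : ℕ → Bool) (n : ℕ) (b : Bool) :
    Function.update (marks T D I) n ((marks T D I n).set 1 3 b) =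
      marks T D (Function.update I n b) := by
  funext m i j
  by_cases hm : m = n
  · subst hm
    simp only [Function.update_self, Block.set, marks]
    split_ifs <;> simp_all
  · simp only [Function.update_of_ne hm, marks]

theorem update_marks_data (T : ℕ → Block) (D I : ℕ → Bool) (n : ℕ) (b : Bool) {i : Fin 3}
    {j : Fin 16} (h : ¬ (i = 1 ∧ (j = 2 ∨ j = 3))) :
    Function.update (marks T D I) n ((marks T D I n).set i j b) =
      marks (Function.update T n ((T n).set i j b)) D I := by
  funext m i' j'
  by_cases hm : m = n
  · subst hm
    simp only [Function.update_self, Block.set, marks]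
    split_ifs <;> simp_all
  · simp only [Function.update_of_ne hm, marks]

/-- The mark of a single block. -/
def single (t : ℕ) : ℕ → Bool := fun n => decide (n = t)

theorem update_single (t : ℕ) : Function.update (single t) t false = fun _ => false := by
  funext n
  by_cases h : n = t <;> simp [single, h]

theorem update_none (t : ℕ) : Function.update (fun _ => false) t true = single t := by
  funext n
  by_cases h : n = t <;> simp [single, h]

/-- The token, the register and the data on which the instructions act. -/
structure Memory where
  token : ℕ
  reg : Bool
  data : ℕ → Block

/-- The action of an instruction. -/
def exec (a : Memory) : Instr → Memory
  | .move d => ⟨ITTM.moveHead d a.token, a.reg, a.data⟩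
  | .test i j b => ⟨a.token, a.reg && (a.data a.token i j == b), a.data⟩
  | .write i j b => ⟨a.token, true,
      if a.reg then Function.update a.data a.token ((a.data a.token).set i j b) else a.data⟩

/-- An instruction that leaves the marks and the input tape alone. -/
def Valid : Instr → Prop
  | .move _ => True
  | .test i j _ => ¬ (i = 1 ∧ (j = 2 ∨ j = 3))
  | .write i j _ => ¬ (i = 1 ∧ (j = 2 ∨ j = 3)) ∧ i ≠ 0

/-- The machine gets from `c` to `c'`, with `P` before. -/
def Trace (P : universal.Config → Prop) (c c' : universal.Config) : Prop :=
  ∃ m, universal.next^[m] c = c' ∧ ∀ k < m, P (universal.next^[k] c)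

theorem Trace.trans {P : universal.Config → Prop} {c c' c'' : universal.Config}
    (h : Trace P c c') (h' : Trace P c' c'') : Trace P c c'' := by
  obtain ⟨m, rfl, h1⟩ := h
  obtain ⟨m', rfl, h2⟩ := h'
  refine ⟨m' + m, Function.iterate_add_apply _ _ _ _, fun k hk => ?_⟩
  rcases lt_or_ge k m with h | h
  · exact h1 k h
  · have := h2 (k - m) (by omega)
    rwa [← Function.iterate_add_apply, Nat.sub_add_cancel h] at this

theorem Trace.single {P : universal.Config → Prop} {c c' : universal.Config} (h : P c)
    (h' : universal.next c = c') : Trace P c c' :=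
  ⟨1, h', fun k hk => by
    obtain rfl : k = 0 := by omega
    exact h⟩

theorem trace_seekInstr {P : universal.Config → Prop} {r : Bool} {b t : ℕ} (hbt : b ≤ t)
    {T : ℕ → Block} {D : ℕ → Bool} (hP : ∀ n, P ⟨.seekInstr r, n, marks T D (single t)⟩) :
    Trace P ⟨.seekInstr r, b, marks T D (single t)⟩ ⟨.seekInstr r, t, marks T D (single t)⟩ := by
  obtain ⟨m, rfl⟩ := Nat.exists_eq_add_of_le hbt
  clear hbt
  induction m generalizing b with
  | zero => exact ⟨0, rfl, by simp⟩
  | succ m ih =>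
    rw [show b + (m + 1) = b + 1 + m by omega] at hP ⊢
    refine Trace.trans (Trace.single (hP b) ?_) (ih hP)
    have : single (b + 1 + m) b = false := by simp [universal.single]; omega
    simp [BlockMachine.next, universal, uTrans, marks_instr, this, ITTM.moveHead]

theorem trace_seekToken {P : universal.Config → Prop} {r : Bool} {s : Instr} {d t : ℕ}
    (hdt : d ≤ t) {T : ℕ → Block} {I : ℕ → Bool}
    (hP : ∀ n, P ⟨.seekToken r s, n, marks T (single d) I⟩) :
    Trace P ⟨.seekToken r s, t, marks T (single d) I⟩ ⟨.seekToken r s, d, marks T (single d) I⟩ := by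
  obtain ⟨m, rfl⟩ := Nat.exists_eq_add_of_le hdt
  clear hdt
  induction m with
  | zero => exact ⟨0, rfl, by simp⟩
  | succ m ih =>
    refine Trace.trans (Trace.single (hP _) ?_) ih
    have : single d (d + (m + 1)) = false := by simp [universal.single]
    simp [BlockMachine.next, universal, uTrans, marks_token, this, ITTM.moveHead]

/-- The machine is ready to carry out the instruction of block `t`. -/
def Ready (t : ℕ) (a : Memory) (c : universal.Config) : Prop :=
  ∃ b ≤ t, c = ⟨.seekInstr a.reg, b, marks a.data (single a.token) (single t)⟩

/-- The machine has not halted and the data are `T`. -/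
def Shows (T : ℕ → Block) (c : universal.Config) : Prop :=
  c.state ≠ UState.halt ∧ SameData c.tape T

/-- Execution of one instruction. -/
theorem Ready.exec {t : ℕ} {a : Memory} {c : universal.Config} (h : Ready t a c)
    (htok : a.token ≤ t) (hv : Valid (instrAt (a.data t))) :
    ∃ m > 0, Ready (t + 1) (exec a (instrAt (a.data t))) (universal.next^[m] c) ∧
      ∀ k < m, Shows a.data (universal.next^[k] c) := by
  suffices H : ∃ c', Trace (Shows a.data) c c' ∧
      Ready (t + 1) (universal.exec a (instrAt (a.data t))) c' by
    obtain ⟨_, ⟨m, rfl, hm⟩, hr⟩ := H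
    -- The instruction mark has moved from `t` to `t + 1`, so some step was made; positivity drives
    -- the induction in `exists_ge_shows`.
    refine ⟨m, Nat.pos_of_ne_zero ?_, hr, hm⟩
    rintro rfl
    obtain ⟨b, -, rfl⟩ := h
    obtain ⟨b', -, hb'⟩ := hr
    have := congrArg (fun c : universal.Config => c.tape t 1 3) hb'
    simp [marks_instr, universal.single] at this
  obtain ⟨b, hb, rfl⟩ := h
  have hshow : ∀ q n D I, q ≠ UState.halt → Shows a.data ⟨q, n, marks a.data D I⟩ :=
    fun q n D I hq => ⟨hq, sameData_marks _ _ _⟩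
  have t1 := trace_seekInstr (P := Shows a.data) (r := a.reg) hb (T := a.data)
    (D := single a.token) fun n => hshow _ _ _ _ (by simp)
  have t2 : Trace (Shows a.data) _ ⟨.markInstr a.reg (instrAt (a.data t)), t + 1,
      marks a.data (single a.token) fun _ => false⟩ :=
    t1.trans (Trace.single (hshow _ _ _ _ (by simp)) (by
      rw [← update_single t, ← update_marks_instr]
      simp [BlockMachine.next, universal, uTrans, marks_instr, universal.single, ITTM.moveHead,
        instrAt_marks]))
  have t3 : Trace (Shows a.data) _ ⟨.seekToken a.reg (instrAt (a.data t)), t,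
      marks a.data (single a.token) (single (t + 1))⟩ :=
    t2.trans (Trace.single (hshow _ _ _ _ (by simp)) (by
      rw [← update_none (t + 1), ← update_marks_instr]
      simp [BlockMachine.next, universal, uTrans, ITTM.moveHead]))
  have t4 := t3.trans (trace_seekToken htok fun n => hshow _ _ _ _ (by simp))
  have hD : single a.token a.token = true := by simp [universal.single]
  generalize hs : instrAt (a.data t) = s at *
  cases s with
  | move d =>
    have t5 : Trace (Shows a.data) _ ⟨.markToken a.reg, ITTM.moveHead d a.token,
        marks a.data (fun _ => false) (single (t + 1))⟩ :=
      t4.trans (Trace.single (hshow _ _ _ _ (by simp)) (by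
        rw [← update_single a.token, ← update_marks_token]
        simp [BlockMachine.next, universal, uTrans, marks_token, hD]))
    have t6 : Trace (Shows a.data) _ ⟨.seekInstr a.reg, ITTM.moveHead d a.token - 1,
        marks a.data (universal.single (ITTM.moveHead d a.token)) (single (t + 1))⟩ :=
      t5.trans (Trace.single (hshow _ _ _ _ (by simp)) (by
        rw [← update_none (ITTM.moveHead d a.token), ← update_marks_token]
        simp [BlockMachine.next, universal, uTrans, ITTM.moveHead]))
    refine ⟨_, t6, _, ?_, rfl⟩
    cases d <;> simp [ITTM.moveHead] <;> omega
  | test i j b =>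
    refine ⟨⟨.seekInstr (a.reg && (a.data a.token i j == b)), a.token + 1,
      marks a.data (single a.token) (single (t + 1))⟩,
      t4.trans (Trace.single (hshow _ _ _ _ (by simp)) ?_), _, by omega, rfl⟩
    simp [BlockMachine.next, universal, uTrans, marks_token, hD, marks_data _ _ _ _ hv,
      ITTM.moveHead]
  | write i j b =>
    refine ⟨⟨.seekInstr true, a.token + 1,
      marks (universal.exec a (.write i j b)).data (single a.token) (single (t + 1))⟩,
      t4.trans (Trace.single (hshow _ _ _ _ (by simp)) ?_), _, by omega, rfl⟩
    rcases hr : a.reg with _ | _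
    · simp [BlockMachine.next, universal, uTrans, marks_token, hD, ITTM.moveHead,
        universal.exec, hr]
    · simp only [universal.exec, hr, if_true]
      rw [← update_marks_data _ _ _ _ _ hv.1]
      simp [BlockMachine.next, universal, uTrans, marks_token, hD, ITTM.moveHead]

/-- An infinite execution. -/
theorem exists_ge_shows {a : ℕ → Memory} {c : universal.Config} (h0 : Ready 0 (a 0) c)
    (hs : ∀ t, a (t + 1) = universal.exec (a t) (instrAt ((a t).data t)))
    (htok : ∀ t, (a t).token ≤ t) (hv : ∀ t, Valid (instrAt ((a t).data t))) (t₀ : ℕ) :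
    ∃ K, (t₀ = 0 → K = 0) ∧ ∀ k, K ≤ k →
      ∃ t, t₀ ≤ t ∧ Shows (a t).data (universal.next^[k] c) := by
  have hstep : ∀ t c, Ready t (a t) c → ∃ m > 0, Ready (t + 1) (a (t + 1)) (universal.next^[m] c) ∧
      ∀ k < m, Shows (a t).data (universal.next^[k] c) := fun t c h => by
    rw [hs]; exact h.exec (htok t) (hv t)
  have hreach : ∀ t, ∃ K, Ready t (a t) (universal.next^[K] c) := by
    intro t
    induction t with
    | zero => exact ⟨0, h0⟩
    | succ t ih =>
      obtain ⟨K, hK⟩ := ih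
      obtain ⟨m, -, hm, -⟩ := hstep t _ hK
      exact ⟨m + K, by rwa [Function.iterate_add_apply]⟩
  have hafter : ∀ k t c, Ready t (a t) c →
      ∃ t', t ≤ t' ∧ Shows (a t').data (universal.next^[k] c) := by
    intro k
    induction k using Nat.strong_induction_on with
    | _ k ih =>
      intro t c hc
      obtain ⟨m, hm0, hm, hm'⟩ := hstep t c hc
      rcases lt_or_ge k m with h | h
      · exact ⟨t, le_rfl, hm' k h⟩
      · obtain ⟨t', h1, h2⟩ := ih (k - m) (by omega) (t + 1) _ hm
        rw [← Function.iterate_add_apply, Nat.sub_add_cancel h] at h2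
        exact ⟨t', by omega, h2⟩
  rcases Nat.eq_zero_or_pos t₀ with rfl | ht₀
  · exact ⟨0, fun _ => rfl, fun k _ => hafter k 0 c h0⟩
  obtain ⟨K, hK⟩ := hreach t₀
  refine ⟨K, fun h => by omega, fun k hk => ?_⟩
  have := hafter (k - K) t₀ _ hK
  rwa [← Function.iterate_add_apply, Nat.sub_add_cancel hk] at this

end universal

/-! ### Rules, their programs, and the joint effect of infinitely many rules -/

/-- Infinitely many nonempty lists can be concatenated. -/
theorem exists_concat {α : Type*} (l : ℕ → List α) (hl : ∀ m, l m ≠ []) :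
    ∃ (P : ℕ → α) (t : ℕ → ℕ), t 0 = 0 ∧ (∀ m, t (m + 1) = t m + (l m).length) ∧
      ∀ m j (h : j < (l m).length), P (t m + j) = (l m)[j] := by
  let t : ℕ → ℕ := fun m => ∑ s ∈ Finset.range m, (l s).length
  have hts : ∀ m, t (m + 1) = t m + (l m).length := fun m => Finset.sum_range_succ _ _
  have hpos : ∀ m, 0 < (l m).length := fun m => List.length_pos_iff.2 (hl m)
  have hmono : StrictMono t := strictMono_nat_of_lt_succ fun m => by have := hpos m; rw [hts]; omega
  have hex : ∀ p, ∃ m, t m ≤ p ∧ p < t (m + 1) := by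
    intro p
    induction p with
    | zero => exact ⟨0, by simp [t], by rw [hts]; have := hpos 0; omega⟩
    | succ p ih =>
      obtain ⟨m, h1, h2⟩ := ih
      rcases lt_or_ge (p + 1) (t (m + 1)) with h | h
      · exact ⟨m, by omega, h⟩
      · exact ⟨m + 1, h, by have := hpos (m + 1); rw [hts]; omega⟩
  choose f hf1 hf2 using hex
  have hlt : ∀ p, p - t (f p) < (l (f p)).length := fun p => by
    have := hf1 p; have := hf2 p; rw [hts] at this; omega
  refine ⟨fun p => (l (f p))[p - t (f p)]'(hlt p), t, by simp [t], hts, fun m j h => ?_⟩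
  have hm : f (t m + j) = m := by
    have h1 := hf1 (t m + j)
    have h2 := hf2 (t m + j)
    have h3 : f (t m + j) < m + 1 := hmono.lt_iff_lt.1 (h1.trans_lt (by rw [hts]; omega))
    have h4 : m < f (t m + j) + 1 := hmono.lt_iff_lt.1 (by omega)
    omega
  simp only [hm]
  congr 1
  omega

namespace universal

/-- A rule of a network: if finitely many bits have given values, a bit is written. -/
structure Rule where
  tests : List (ℕ × Fin 3 × Fin 16 × Bool)
  block : ℕ
  track : Fin 3
  cell : Fin 16
  value : Bool

instance : Countable Rule := by
  refine Function.Injective.countable (f := fun r : Rule =>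
    (r.tests, r.block, r.track, r.cell, r.value)) ?_
  rintro ⟨⟩ ⟨⟩ h
  simp_all

namespace Rule

/-- All tests of the rule succeed. -/
def Enabled (r : Rule) (T : ℕ → Block) : Prop :=
  ∀ s ∈ r.tests, T s.1 s.2.1 s.2.2.1 = s.2.2.2

open Classical in
/-- The effect of a rule. -/
def apply (r : Rule) (T : ℕ → Block) : ℕ → Block :=
  if r.Enabled T then Function.update T r.block ((T r.block).set r.track r.cell r.value) else T

/-- Carry out an instruction at block `n` and return. -/
def excursion (n : ℕ) (s : Instr) : List Instr :=
  List.replicate n (.move .right) ++ s :: List.replicate n (.move .left)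

/-- The tests of a rule as a list of instructions. -/
def testCode (l : List (ℕ × Fin 3 × Fin 16 × Bool)) : List Instr :=
  l.flatMap fun s => excursion s.1 (.test s.2.1 s.2.2.1 s.2.2.2)

/-- A rule as a list of instructions. -/
def code (r : Rule) : List Instr :=
  testCode r.tests ++ excursion r.block (.write r.track r.cell r.value)

theorem code_ne_nil (r : Rule) : r.code ≠ [] := by simp [code, excursion]

/-- A rule that leaves the marks and the input tape alone. -/
def WellFormed (r : Rule) : Prop :=
  (∀ s ∈ r.tests, ¬ (s.2.1 = 1 ∧ (s.2.2.1 = 2 ∨ s.2.2.1 = 3))) ∧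
    ¬ (r.track = 1 ∧ (r.cell = 2 ∨ r.cell = 3)) ∧ r.track ≠ 0

theorem valid_of_mem_code {r : Rule} (hr : r.WellFormed) : ∀ s ∈ r.code, Valid s := by
  intro s hs
  have hmem : ∀ n s', s ∈ excursion n s' → Valid s' → Valid s := by
    intro n s' h h'
    simp only [excursion, List.mem_append, List.mem_replicate, List.mem_cons] at h
    rcases h with ⟨_, rfl⟩ | rfl | ⟨_, rfl⟩
    exacts [trivial, h', trivial]
  simp only [code, testCode, List.mem_append, List.mem_flatMap] at hs
  rcases hs with ⟨a, ha, hs⟩ | hs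
  · exact hmem _ _ hs (hr.1 a ha)
  · exact hmem _ _ hs hr.2

theorem foldl_move_right (n : ℕ) (a : Memory) :
    (List.replicate n (Instr.move .right)).foldl exec a = ⟨a.token + n, a.reg, a.data⟩ := by
  induction n generalizing a with
  | zero => rfl
  | succ n ih =>
    rw [List.replicate_succ, List.foldl_cons, ih]
    simp [exec, ITTM.moveHead]; omega

theorem foldl_move_left (n : ℕ) (a : Memory) :
    (List.replicate n (Instr.move .left)).foldl exec a = ⟨a.token - n, a.reg, a.data⟩ := by
  induction n generalizing a with
  | zero => rfl
  | succ n ih =>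
    rw [List.replicate_succ, List.foldl_cons, ih]
    simp [exec, ITTM.moveHead]; omega

theorem foldl_testCode (l : List (ℕ × Fin 3 × Fin 16 × Bool)) (r : Bool) (T : ℕ → Block) :
    (testCode l).foldl exec ⟨0, r, T⟩ =
      ⟨0, r && l.all fun s => T s.1 s.2.1 s.2.2.1 == s.2.2.2, T⟩ := by
  induction l generalizing r with
  | nil => simp [testCode]
  | cons s l ih =>
    rw [testCode, List.flatMap_cons, List.foldl_append, ← testCode]
    have : (excursion s.1 (.test s.2.1 s.2.2.1 s.2.2.2)).foldl exec ⟨0, r, T⟩ =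
        ⟨0, r && (T s.1 s.2.1 s.2.2.1 == s.2.2.2), T⟩ := by
      rw [excursion, List.foldl_append, foldl_move_right, List.foldl_cons, foldl_move_left]
      simp [exec]
    rw [this, ih, List.all_cons, Bool.and_assoc]

theorem foldl_code (r : Rule) (T : ℕ → Block) :
    r.code.foldl exec ⟨0, true, T⟩ = ⟨0, true, r.apply T⟩ := by
  rw [code, List.foldl_append, foldl_testCode, excursion, List.foldl_append, foldl_move_right,
    List.foldl_cons, foldl_move_left]
  simp only [exec, apply, Bool.true_and, zero_add, Nat.sub_self]
  classical
  congr 1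
  refine if_congr ?_ rfl rfl
  simp [Enabled]

theorem data_foldl_of_not_write {l : List Instr} (hl : ∀ s ∈ l, ∀ i j b, s ≠ .write i j b)
    (a : Memory) : (l.foldl exec a).data = a.data := by
  induction l generalizing a with
  | nil => rfl
  | cons s l ih =>
    rw [List.foldl_cons, ih fun s' h => hl s' (List.mem_cons_of_mem _ h)]
    cases s with
    | move d => rfl
    | test i j b => rfl
    | write i j b => exact absurd rfl (hl _ List.mem_cons_self i j b)

/-- A rule contains a single write instruction, so even in the middle of a rule the data are those
before or after it. -/
theorem data_foldl_take (r : Rule) (T : ℕ → Block) (j : ℕ) :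
    ((r.code.take j).foldl exec ⟨0, true, T⟩).data = T ∨
      ((r.code.take j).foldl exec ⟨0, true, T⟩).data = r.apply T := by
  obtain ⟨p, s, q, hp, hq, hcode⟩ : ∃ (p : List Instr) (s : Instr) (q : List Instr),
      (∀ s ∈ p, ∀ i j b, s ≠ Instr.write i j b) ∧ (∀ s ∈ q, ∀ i j b, s ≠ Instr.write i j b) ∧
      r.code = p ++ s :: q := by
    refine ⟨testCode r.tests ++ List.replicate r.block (.move .right),
      .write r.track r.cell r.value, List.replicate r.block (.move .left), ?_, ?_, ?_⟩
    · intro s hs i j b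
      simp only [testCode, excursion, List.mem_append, List.mem_flatMap, List.mem_replicate,
        List.mem_cons] at hs
      rcases hs with ⟨a, _, ⟨_, rfl⟩ | rfl | ⟨_, rfl⟩⟩ | ⟨_, rfl⟩ <;> simp
    · intro s hs i j b
      rw [List.mem_replicate] at hs
      rw [hs.2]; simp
    · simp [code, excursion]
  rcases le_or_gt j p.length with h | h
  · left
    rw [hcode, List.take_append_of_le_length h]
    exact data_foldl_of_not_write (fun s hs => hp s (List.mem_of_mem_take hs)) _
  · right
    obtain ⟨k, rfl⟩ := Nat.exists_eq_add_of_lt h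
    have e1 : r.code.take (p.length + k + 1) = p ++ s :: q.take k := by
      rw [hcode, List.take_append, List.take_of_length_le (by omega)]
      simp [show p.length + k + 1 - p.length = k + 1 by omega]
    have e2 : ∀ q' : List Instr, (∀ s ∈ q', ∀ i j b, s ≠ Instr.write i j b) →
        ((p ++ s :: q').foldl exec ⟨0, true, T⟩).data =
          ((p ++ [s]).foldl exec ⟨0, true, T⟩).data := by
      intro q' hq'
      rw [List.append_cons, List.foldl_append, data_foldl_of_not_write hq']
    rw [e1, e2 _ fun s hs => hq s (List.mem_of_mem_take hs), ← e2 q hq, ← hcode, foldl_code]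

end Rule

/-- The data after the first `m` rules. -/
def applyRules (ρ : ℕ → Rule) (T : ℕ → Block) : ℕ → ℕ → Block
  | 0 => T
  | m + 1 => (ρ m).apply (applyRules ρ T m)

theorem Rule.apply_input {r : Rule} (hr : r.WellFormed) (T : ℕ → Block) (n : ℕ) :
    r.apply T n 0 = T n 0 := by
  rw [Rule.apply]
  split_ifs
  · by_cases h : n = r.block
    · subst h
      funext j
      rw [Function.update_self, Block.set, if_neg (fun h => hr.2.2 h.1.symm)]
    · rw [Function.update_of_ne h]
  · rfl

theorem applyRules_input {ρ : ℕ → Rule} (hρ : ∀ m, (ρ m).WellFormed) (T : ℕ → Block) (m n : ℕ) :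
    applyRules ρ T m n 0 = T n 0 := by
  induction m with
  | zero => rfl
  | succ m ih => rw [applyRules, (ρ m).apply_input (hρ m), ih]

/-- A sequence of rules can be written on the input tape, so that the machine carries them out one
after the other. -/
theorem exists_program {ρ : ℕ → Rule} (hρ : ∀ m, (ρ m).WellFormed) :
    ∃ P : ℕ → Instr, ∀ (T : ℕ → Block) (c : universal.Config), (∀ n, instrAt (T n) = P n) →
      Ready 0 ⟨0, true, T⟩ c → ∀ m₀, ∃ K, (m₀ = 0 → K = 0) ∧ ∀ k, K ≤ k →
        ∃ m, m₀ ≤ m ∧ Shows (applyRules ρ T m) (universal.next^[k] c) := by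
  obtain ⟨P, t, ht0, hts, hP⟩ := exists_concat (fun m => (ρ m).code) fun m => (ρ m).code_ne_nil
  refine ⟨P, fun T c hT hc m₀ => ?_⟩
  let a : ℕ → Memory := fun t => Nat.rec ⟨0, true, T⟩ (fun t a => exec a (P t)) t
  have has : ∀ t, a (t + 1) = exec (a t) (P t) := fun t => rfl
  -- An instruction moves the token by at most one block, so the token never overtakes the
  -- instruction mark and is found by a search to the left.
  have htok : ∀ t, (a t).token ≤ t := by
    intro t
    induction t with
    | zero => exact le_rfl
    | succ t ih =>
      rw [has]
      rcases P t with ⟨_ | _⟩ | _ | _ <;> simp [exec, ITTM.moveHead] <;> omega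
  have hfold : ∀ m, a (t m) = ⟨0, true, applyRules ρ T m⟩ → ∀ j, j ≤ (ρ m).code.length →
      a (t m + j) = ((ρ m).code.take j).foldl exec ⟨0, true, applyRules ρ T m⟩ := by
    intro m hm j
    induction j with
    | zero => intro _; simpa using hm
    | succ j ih =>
      intro hj
      rw [← add_assoc, has, ih (by omega), hP m j (by omega), List.take_add_one,
        List.foldl_append]
      simp [List.getElem?_eq_getElem (show j < (ρ m).code.length by omega)]
  have hrule : ∀ m, a (t m) = ⟨0, true, applyRules ρ T m⟩ := by
    intro m
    induction m with
    | zero => rw [ht0]; rfl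
    | succ m ih =>
      rw [hts, hfold m ih _ le_rfl, List.take_length, Rule.foldl_code, applyRules]
  have hblock : ∀ s m, t m ≤ s → ∃ m', m ≤ m' ∧ (a s).data = applyRules ρ T m' := by
    intro s m hs
    obtain ⟨d, rfl⟩ := Nat.exists_eq_add_of_le hs
    clear hs
    induction d using Nat.strong_induction_on generalizing m with
    | _ d ih =>
      rcases le_or_gt d (ρ m).code.length with h | h
      · rw [hfold m (hrule m) d h]
        rcases (ρ m).data_foldl_take (applyRules ρ T m) d with h' | h'
        · exact ⟨m, le_rfl, h'⟩
        · exact ⟨m + 1, by omega, h'⟩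
      · have hpos := List.length_pos_iff.2 (ρ m).code_ne_nil
        obtain ⟨m', h1, h2⟩ := ih (d - (ρ m).code.length) (by omega) (m + 1)
        refine ⟨m', by omega, ?_⟩
        rw [← h2, hts]
        congr 2
        omega
  -- Well-formed rules do not write on the input tape, so the program is intact whenever an
  -- instruction is fetched.
  have hinstr : ∀ s, instrAt ((a s).data s) = P s := by
    intro s
    obtain ⟨m', -, h⟩ := hblock s 0 (by omega)
    rw [h, instrAt, applyRules_input hρ, ← hT s]
    rfl
  have hvalid : ∀ s, Valid (P s) := by
    have key : ∀ d m, Valid (P (t m + d)) := by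
      intro d
      induction d using Nat.strong_induction_on with
      | _ d ih =>
        intro m
        rcases lt_or_ge d (ρ m).code.length with h | h
        · rw [hP m d h]
          exact Rule.valid_of_mem_code (hρ m) _ (List.getElem_mem h)
        · have hpos := List.length_pos_iff.2 (ρ m).code_ne_nil
          have := ih (d - (ρ m).code.length) (by omega) (m + 1)
          rw [hts] at this
          convert this using 2
          omega
    intro s
    have := key s 0
    rwa [ht0, zero_add] at this
  obtain ⟨K, hK0, hK⟩ := exists_ge_shows (a := a) (c := c) hc (fun s => by rw [hinstr]) htok
    (fun s => by rw [hinstr]; exact hvalid s) (t m₀)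
  refine ⟨K, fun h => hK0 (by rw [h, ht0]), fun k hk => ?_⟩
  obtain ⟨s, hs, hs'⟩ := hK k hk
  obtain ⟨m', h1, h2⟩ := hblock s m₀ hs
  exact ⟨m', h1, h2 ▸ hs'⟩

/-- The rules do not write where they test. -/
def Separated (ρ : ℕ → Rule) : Prop :=
  ∀ m m', ∀ s ∈ (ρ m).tests, ¬ ((ρ m').track = s.2.1 ∧ (ρ m').cell = s.2.2.1)

theorem Rule.apply_of_ne {r : Rule} {T : ℕ → Block} {n : ℕ} {i : Fin 3} {j : Fin 16}
    (h : r.Enabled T → ¬ (r.block = n ∧ r.track = i ∧ r.cell = j)) : r.apply T n i j = T n i j := by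
  rw [Rule.apply]
  split_ifs with he
  · by_cases hn : n = r.block
    · subst hn
      rw [Function.update_self, Block.set, if_neg]
      rintro ⟨rfl, rfl⟩
      exact h he ⟨rfl, rfl, rfl⟩
    · rw [Function.update_of_ne hn]
  · rfl

theorem Rule.apply_of_enabled {r : Rule} {T : ℕ → Block} (h : r.Enabled T) :
    r.apply T r.block r.track r.cell = r.value := by
  rw [Rule.apply, if_pos h, Function.update_self, Block.set, if_pos ⟨rfl, rfl⟩]

/-- No rule writes a bit that some rule tests. Hence the set of enabled rules is fixed by the
initial data, and rules carried out one after the other act as if simultaneously. -/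
theorem enabled_applyRules {ρ : ℕ → Rule} (hρ : Separated ρ) (T : ℕ → Block) (m m' : ℕ) :
    (ρ m').Enabled (applyRules ρ T m) ↔ (ρ m').Enabled T := by
  induction m with
  | zero => rfl
  | succ m ih =>
    rw [← ih, applyRules]
    refine forall₂_congr fun s hs => ?_
    rw [Rule.apply_of_ne]
    rintro - ⟨-, h1, h2⟩
    exact hρ m' m s hs ⟨h1, h2⟩

/-- A bit that no enabled rule writes is unchanged. -/
theorem applyRules_of_not_written {ρ : ℕ → Rule} (hρ : Separated ρ) {T : ℕ → Block} {n : ℕ}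
    {i : Fin 3} {j : Fin 16}
    (h : ∀ m, (ρ m).Enabled T → ¬ ((ρ m).block = n ∧ (ρ m).track = i ∧ (ρ m).cell = j)) (m : ℕ) :
    applyRules ρ T m n i j = T n i j := by
  induction m with
  | zero => rfl
  | succ m ih =>
    rw [applyRules, Rule.apply_of_ne, ih]
    rw [enabled_applyRules hρ]
    exact h m

/-- A bit to which all enabled rules give the same value has its old value or that one. -/
theorem applyRules_eq_or {ρ : ℕ → Rule} (hρ : Separated ρ) {T : ℕ → Block} {n : ℕ}
    {i : Fin 3} {j : Fin 16} {b : Bool}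
    (h : ∀ m, (ρ m).Enabled T → (ρ m).block = n → (ρ m).track = i → (ρ m).cell = j →
      (ρ m).value = b) (m : ℕ) :
    applyRules ρ T m n i j = T n i j ∨ applyRules ρ T m n i j = b := by
  induction m with
  | zero => exact Or.inl rfl
  | succ m ih =>
    by_cases he : (ρ m).Enabled T ∧ (ρ m).block = n ∧ (ρ m).track = i ∧ (ρ m).cell = j
    · right
      obtain ⟨he, rfl, rfl, rfl⟩ := he
      rw [applyRules, Rule.apply_of_enabled ((enabled_applyRules hρ T m m).2 he)]
      exact h m he rfl rfl rfl
    · rw [applyRules, Rule.apply_of_ne]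
      · exact ih
      · intro h1 h2
        exact he ⟨(enabled_applyRules hρ T m m).1 h1, h2⟩

/-- A bit to which all enabled rules give the same value gets this value as soon as one of them is
applied. -/
theorem applyRules_of_written {ρ : ℕ → Rule} (hρ : Separated ρ) {T : ℕ → Block} {n : ℕ}
    {i : Fin 3} {j : Fin 16} {b : Bool}
    (h : ∀ m, (ρ m).Enabled T → (ρ m).block = n → (ρ m).track = i → (ρ m).cell = j →
      (ρ m).value = b) {m₀ : ℕ} (he : (ρ m₀).Enabled T)
    (ht : (ρ m₀).block = n ∧ (ρ m₀).track = i ∧ (ρ m₀).cell = j) {m : ℕ} (hm : m₀ < m) :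
    applyRules ρ T m n i j = b := by
  induction m, hm using Nat.le_induction with
  | base =>
    obtain ⟨rfl, rfl, rfl⟩ := ht
    rw [applyRules, Rule.apply_of_enabled ((enabled_applyRules hρ T m₀ m₀).2 he)]
    exact h m₀ he rfl rfl rfl
  | succ m _ ih =>
    by_cases he : (ρ m).Enabled T ∧ (ρ m).block = n ∧ (ρ m).track = i ∧ (ρ m).cell = j
    · obtain ⟨he, rfl, rfl, rfl⟩ := he
      rw [applyRules, Rule.apply_of_enabled ((enabled_applyRules hρ T m m).2 he)]
      exact h m he rfl rfl rfl
    · rw [applyRules, Rule.apply_of_ne]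
      · exact ih
      · intro h1 h2
        exact he ⟨(enabled_applyRules hρ T m m).1 h1, h2⟩

end universal

/-! ### The two phases of a network step: cleaning and carrying out the rules -/

namespace universal

theorem encode_eq {M : BlockMachine} {z : Real2} {α : Ordinal.{0}} {q : M.State}
    (hs : (M.toITTM.run z α).state = (q, (fun _ _ => false), 0))
    (hh : (M.toITTM.run z α).head = 0) : M.toITTM.run z α =
      M.encode ⟨q, 0, BlockMachine.blocksOf (M.toITTM.run z α).tape⟩ :=
  BlockMachine.ITTM_config_ext hs hh (BlockMachine.flatten_blocksOf _).symm

/-- The phase that begins a network step. -/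
theorem clean_phase {z : Real2} {α : Ordinal.{0}} {q : UState} {T : ℕ → Block}
    (h : universal.toITTM.run z α = universal.encode ⟨q, 0, T⟩) (hq : q ≠ .halt)
    (hT : uTrans q (T 0) = (.clean, cleanBlock (T 0), .right)) :
    universal.toITTM.run z (α + Ordinal.omega0) =
        universal.encode ⟨.limit, 0, fun n => cleanBlock (T n)⟩ ∧
      ∀ (s : ℕ) (n : ℕ) (i : Fin 3) (j : Fin 16),
        BlockMachine.blocksOf (universal.toITTM.run z (α + s)).tape n i j = T n i j ∨
        BlockMachine.blocksOf (universal.toITTM.run z (α + s)).tape n i j =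
          cleanBlock (T n) i j := by
  have hnext : ∀ (q : UState) (n : ℕ) (T' : ℕ → Block),
      uTrans q (T' n) = (.clean, cleanBlock (T' n), .right) →
      universal.next ⟨q, n, T'⟩ = ⟨.clean, n + 1, Function.update T' n (cleanBlock (T' n))⟩ := by
    intro q n T' h'
    simp only [BlockMachine.next, universal, h', ITTM.moveHead]
  have hit : ∀ k, universal.next^[k + 1] ⟨q, 0, T⟩ = ⟨.clean, k + 1,
      fun n => if n < k + 1 then cleanBlock (T n) else T n⟩ := by
    intro k
    induction k with
    | zero =>
      rw [zero_add, Function.iterate_one, hnext q 0 T hT]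
      congr 1
      funext n
      by_cases hn : n = 0
      · subst hn; simp
      · rw [Function.update_of_ne hn, if_neg (by omega)]
    | succ k ih =>
      rw [Function.iterate_succ_apply', ih, hnext _ _ _ rfl]
      congr 1
      funext n
      by_cases hn : n = k + 1
      · subst hn; simp
      · rw [Function.update_of_ne hn]
        exact if_congr (by omega) rfl rfl
  have hne : ∀ m, (universal.next^[m] ⟨q, 0, T⟩).state ≠ universal.halt := by
    intro m
    cases m with
    | zero => exact hq
    | succ m =>
      rw [hit]
      exact fun h => UState.noConfusion h
  obtain ⟨T', hT', hlim⟩ := universal.run_add_omega h hne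
  refine ⟨?_, fun s n i j => ?_⟩
  · rw [hT']
    congr 2
    funext n i j
    refine hlim n i j _ ⟨n + 1, fun m hm => ?_⟩
    obtain ⟨k, rfl⟩ := Nat.exists_eq_add_of_le' (show 1 ≤ m by omega)
    rw [hit]
    simp only
    rw [if_pos (by omega)]
  · obtain ⟨m, -, hm⟩ := universal.run_tape_between h hne s i (16 * n + j)
    have e := congrFun (congrFun (congrFun (BlockMachine.blocksOf_flatten
      (universal.next^[m] ⟨q, 0, T⟩).tape) n) i) j
    rw [BlockMachine.blocksOf] at e ⊢
    rw [hm, e]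
    cases m with
    | zero => exact Or.inl rfl
    | succ m =>
      rw [hit]
      dsimp only
      split_ifs <;> simp

/-- The phase that carries out all rules. -/
theorem run_phase {z : Real2} {α : Ordinal.{0}} {T : ℕ → Block}
    (h : universal.toITTM.run z α = universal.encode ⟨.limit, 0, T⟩) (hF : T 0 1 4 = false)
    (hD : ∀ n, T n 1 2 = false) (hI : ∀ n, T n 1 3 = false) {R : ℕ → ℕ → Block}
    (hR : ∀ c, Ready 0 ⟨0, true, Function.update T 0 ((T 0).set 1 4 true)⟩ c → ∀ m₀, ∃ K,
      (m₀ = 0 → K = 0) ∧ ∀ k, K ≤ k → ∃ m, m₀ ≤ m ∧ Shows (R m) (universal.next^[k] c)) :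
    ∃ T' : ℕ → Block, universal.toITTM.run z (α + Ordinal.omega0) =
        universal.encode ⟨.limit, 0, T'⟩ ∧
      ∀ n i j, ¬ (i = 1 ∧ (j = 2 ∨ j = 3)) →
        (∀ b, (∃ m₀, ∀ m, m₀ ≤ m → R m n i j = b) → T' n i j = b) ∧
        ∀ s : ℕ, BlockMachine.blocksOf (universal.toITTM.run z (α + s)).tape n i j = T n i j ∨
          ∃ m, BlockMachine.blocksOf (universal.toITTM.run z (α + s)).tape n i j = R m n i j := by
  -- For `m₀ = 0` the bound is 0, so every moment of the phase, and not only late ones, shows some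
  -- `R m`.
  have hK : ∀ c, Ready 0 ⟨0, true, Function.update T 0 ((T 0).set 1 4 true)⟩ c → ∀ k,
      ∃ m, Shows (R m) (universal.next^[k] c) := fun c hc k => by
    obtain ⟨K, hK0, hK⟩ := hR c hc 0
    obtain ⟨m, -, hm⟩ := hK k (by rw [hK0 rfl]; omega)
    exact ⟨m, hm⟩
  let c : universal.Config := universal.next ⟨.limit, 0, T⟩
  have hc : Ready 0 ⟨0, true, Function.update T 0 ((T 0).set 1 4 true)⟩ c := by
    refine ⟨0, le_rfl, ?_⟩
    have : uTrans .limit (T 0) =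
        (.seekInstr true, ((((T 0).set 1 4 true).set 1 2 true).set 1 3 true), .left) := by
      simp [uTrans, hF]
    simp only [c, BlockMachine.next, show universal.trans = uTrans from rfl, this, ITTM.moveHead]
    congr 1
    funext n i j
    by_cases hn : n = 0
    · subst hn
      simp only [Function.update_self, Block.set, marks, universal.single, decide_true]
      split_ifs <;> simp_all
    · simp only [Function.update_of_ne hn, marks, universal.single, hn, decide_false]
      split_ifs with h1 h2
      · rw [h1.1, h1.2, hD]
      · rw [h2.1, h2.2, hI]
      · rfl
  have hne : ∀ m, (universal.next^[m] ⟨.limit, 0, T⟩).state ≠ universal.halt := by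
    intro m
    cases m with
    | zero => exact fun h => UState.noConfusion h
    | succ m =>
      rw [Function.iterate_succ_apply]
      exact (hK c hc m).choose_spec.1
  obtain ⟨T', hT', hlim⟩ := universal.run_add_omega h hne
  refine ⟨T', hT', fun n i j hij => ⟨fun b hb => ?_, fun s => ?_⟩⟩
  · obtain ⟨m₀, hm₀⟩ := hb
    obtain ⟨K, -, hK'⟩ := hR c hc m₀
    refine hlim n i j b ⟨K + 1, fun m hm => ?_⟩
    obtain ⟨k, rfl⟩ := Nat.exists_eq_add_of_le' (show 1 ≤ m by omega)
    rw [Function.iterate_succ_apply]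
    obtain ⟨m, h1, h2⟩ := hK' k (by omega)
    rw [h2.2 n i j hij, hm₀ m h1]
  · obtain ⟨m, -, hm⟩ := universal.run_tape_between h hne s i (16 * n + j)
    have e := congrFun (congrFun (congrFun (BlockMachine.blocksOf_flatten
      (universal.next^[m] ⟨.limit, 0, T⟩).tape) n) i) j
    rw [BlockMachine.blocksOf] at e ⊢
    rw [hm, e]
    cases m with
    | zero => exact Or.inl rfl
    | succ m =>
      right
      obtain ⟨m', h'⟩ := hK c hc m
      exact ⟨m', h'.2 n i j hij⟩

end universal

/-! ### One step of an open network on the universal machine -/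

/-- A network whose cells are numbered, with an open update rule, output cells, and a cell that
signals the end of the computation. -/
structure OpenNetwork where
  step : Real2 → Real2 → Real2
  isOpen_step : ∀ k, IsOpen {p : Real2 × Real2 | step p.1 p.2 k = true}
  out : ℕ → ℕ
  flag : ℕ

namespace OpenNetwork

open universal

variable (N : OpenNetwork)

/-- The test whether an input bit has a given value. -/
def inputTest (s : ℕ × Bool) : ℕ × Fin 3 × Fin 16 × Bool :=
  (s.1 / 8, 0, Fin.ofNat 16 (2 * (s.1 % 8)), s.2)

/-- The test whether a cell has a given value. -/
def cellTest (s : ℕ × Bool) : ℕ × Fin 3 × Fin 16 × Bool := (s.1, 1, 0, s.2)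

/-- The rules by which the universal machine carries out a step of the network. -/
inductive IsRule : Rule → Prop
  | update (k : ℕ) (A B : List (ℕ × Bool))
      (h : ∀ x u : Real2, (∀ s ∈ A, x s.1 = s.2) → (∀ s ∈ B, u s.1 = s.2) → N.step x u k = true) :
      IsRule ⟨A.map inputTest ++ B.map cellTest, k, 1, 1, true⟩
  | output (p : ℕ) (b : Bool) : IsRule ⟨[cellTest (N.out p, b)], p / 16, 2, Fin.ofNat 16 p, b⟩
  | flag : IsRule ⟨[cellTest (N.flag, true)], 0, 1, 5, true⟩

variable {N}

theorem IsRule.wellFormed {r : Rule} (hr : N.IsRule r) : r.WellFormed := by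
  cases hr with
  | update k A B h =>
    refine ⟨fun s hs => ?_, by simp, by simp⟩
    simp only [List.mem_append, List.mem_map] at hs
    rcases hs with ⟨a, _, rfl⟩ | ⟨a, _, rfl⟩
    · simp [inputTest]
    · simp [cellTest]
  | output p b => exact ⟨by simp [cellTest], by simp, by simp⟩
  | flag => exact ⟨by simp [cellTest], by simp, by simp⟩

theorem IsRule.separated {r r' : Rule} (hr : N.IsRule r) (hr' : N.IsRule r') :
    ∀ s ∈ r.tests, ¬ (r'.track = s.2.1 ∧ r'.cell = s.2.2.1) := by
  have h1 : ∀ s ∈ r.tests, s.2.1 = 0 ∨ (s.2.1 = 1 ∧ s.2.2.1 = 0) := by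
    intro s hs
    cases hr with
    | update k A B h =>
      simp only [List.mem_append, List.mem_map] at hs
      rcases hs with ⟨a, _, rfl⟩ | ⟨a, _, rfl⟩
      · simp [inputTest]
      · simp [cellTest]
    | output p b => simp only [List.mem_singleton] at hs; subst hs; simp [cellTest]
    | flag => simp only [List.mem_singleton] at hs; subst hs; simp [cellTest]
  intro s hs
  rcases h1 s hs with h | ⟨h, h'⟩
  · rw [h]; cases hr' <;> simp
  · rw [h, h']; cases hr' <;> simp

/-- The bits of the tapes show the input `x` and the cells `w`. -/
def Fits (x w : Real2) (T : ℕ → Block) : Prop :=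
  (∀ p, T (p / 8) 0 (Fin.ofNat 16 (2 * (p % 8))) = x p) ∧ ∀ k, T k 1 0 = w k

theorem enabled_update_iff {x w : Real2} {T : ℕ → Block} (hT : Fits x w T)
    {A B : List (ℕ × Bool)} {k : ℕ} {i : Fin 3} {j : Fin 16} {b : Bool} :
    Rule.Enabled ⟨A.map inputTest ++ B.map cellTest, k, i, j, b⟩ T ↔
      (∀ s ∈ A, x s.1 = s.2) ∧ ∀ s ∈ B, w s.1 = s.2 := by
  simp only [Rule.Enabled, List.mem_append, List.mem_map, or_imp, forall_and,
    forall_exists_index, and_imp, forall_apply_eq_imp_iff₂]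
  simp only [inputTest, cellTest, hT.1, hT.2]

theorem enabled_cellTest_iff {x w : Real2} {T : ℕ → Block} (hT : Fits x w T) {m : ℕ}
    {k : ℕ} {i : Fin 3} {j : Fin 16} {b b' : Bool} :
    Rule.Enabled ⟨[cellTest (m, b')], k, i, j, b⟩ T ↔ w m = b' := by
  simp [Rule.Enabled, cellTest, hT.2]

/-- By openness finitely many bits of x and w secure the value, and the corresponding tests make up
a rule that is enabled. -/
theorem exists_update_rule {x w : Real2} {k : ℕ} (h : N.step x w k = true) {T : ℕ → Block}
    (hT : Fits x w T) : ∃ r, N.IsRule r ∧ r.Enabled T ∧ r.block = k ∧ r.track = 1 ∧ r.cell = 1 ∧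
      r.value = true := by
  obtain ⟨A, B, hAB⟩ := isOpen_iff_finite_support.1 (N.isOpen_step k) (x, w) h
  refine ⟨_, .update k (A.toList.map fun n => (n, x n)) (B.toList.map fun n => (n, w n)) ?_,
    (enabled_update_iff hT).2 ⟨by simp, by simp⟩, rfl, rfl, rfl, rfl⟩
  intro x' u' h1 h2
  exact hAB (x', u') (fun n hn => h1 (n, x n) (by simpa using hn))
    (fun n hn => h2 (n, w n) (by simpa using hn))

end OpenNetwork

namespace OpenNetwork

open universal

variable (N : OpenNetwork)

/-- At stage `α` of the computation on input `z` the universal machine is about to carry out a step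
of the network, whose cells show `w`. -/
structure Entry (z : Real2) (α : Ordinal.{0}) (w : Real2) : Prop where
  state : ∃ q : UState, (universal.toITTM.run z α).state = (q, (fun _ _ => false), 0) ∧
    (q = .start ∨ q = .limit ∧ (universal.toITTM.run z α).tape 1 4 = true)
  head : (universal.toITTM.run z α).head = 0
  input : (universal.toITTM.run z α).tape 0 = z
  cells : ∀ n, (universal.toITTM.run z α).tape 1 (16 * n + 1) = w n
  flag : (universal.toITTM.run z α).tape 1 5 = false

/-- At stage `α` of the computation on input `z` the universal machine has just carried out a step
of the network, which led from `w` to `w'`. -/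
structure Exit (z : Real2) (α : Ordinal.{0}) (w w' : Real2) : Prop where
  state : (universal.toITTM.run z α).state = (UState.limit, (fun _ _ => false), 0)
  phase : (universal.toITTM.run z α).tape 1 4 = true
  head : (universal.toITTM.run z α).head = 0
  input : (universal.toITTM.run z α).tape 0 = z
  cells : ∀ n, (universal.toITTM.run z α).tape 1 (16 * n + 1) = w' n
  flag : (universal.toITTM.run z α).tape 1 5 = w N.flag
  output : ∀ p, (universal.toITTM.run z α).tape 2 p = w (N.out p)

/-- What the tapes show at stage `τ`, during a step of the network begun at stage `α`. -/
structure During (z : Real2) (α τ : Ordinal.{0}) (w w' : Real2) : Prop where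
  input : (universal.toITTM.run z τ).tape 0 = z
  -- One direction suffices: at a limit of network steps, a bit that is on cofinally on the tape
  -- must come from network values that are on cofinally.
  cells : ∀ n, (universal.toITTM.run z τ).tape 1 (16 * n + 1) = true → w n = true ∨ w' n = true
  flag : (universal.toITTM.run z τ).tape 1 5 = true → w N.flag = true
  output : ∀ p, (universal.toITTM.run z τ).tape 2 p = (universal.toITTM.run z α).tape 2 p ∨
    (universal.toITTM.run z τ).tape 2 p = w (N.out p)

/-- The parameter lists all countably many rules of the network, in an arbitrary order and with no
effectivity required. Cleaning turns `w` into the present values and switches the next values off.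
Among ω stages of rules, a next value comes on exactly if some enabled rule sets it, which by
openness means that the update rule holds. -/
theorem exists_parameter : ∃ c : Real2, ∀ (x w : Real2) (α : Ordinal.{0}),
    Entry (joinReal x c) α w →
      N.Exit (joinReal x c) (α + Ordinal.omega0 + Ordinal.omega0) w (N.step x w) ∧
      ∀ τ, α ≤ τ → τ < α + Ordinal.omega0 + Ordinal.omega0 →
        N.During (joinReal x c) α τ w (N.step x w) := by
  classical
  have : Nonempty {r // N.IsRule r} := ⟨_, .flag⟩
  obtain ⟨e, he⟩ := exists_surjective_nat {r // N.IsRule r}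
  let ρ : ℕ → Rule := fun m => (e m).1
  have hρ : ∀ m, N.IsRule (ρ m) := fun m => (e m).2
  have hρs : ∀ r, N.IsRule r → ∃ m, ρ m = r := fun r hr => by
    obtain ⟨m, hm⟩ := he ⟨r, hr⟩
    exact ⟨m, congrArg Subtype.val hm⟩
  have hsep : Separated ρ := fun m m' => (hρ m).separated (hρ m')
  obtain ⟨P, hP⟩ := exists_program fun m => (hρ m).wellFormed
  -- The sixteen input cells of a block hold eight bits of x and eight of the parameter, which is
  -- room for one instruction code.
  refine ⟨fun m => (P (m / 8)).code (Fin.ofNat 8 m), fun x w α h => ?_⟩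
  set c : Real2 := fun m => (P (m / 8)).code (Fin.ofNat 8 m) with hc
  set z := joinReal x c with hz
  obtain ⟨q, hq, hq'⟩ := h.state
  set T := BlockMachine.blocksOf (universal.toITTM.run z α).tape with hT
  have hT0 : ∀ n j, T n 0 j = z (16 * n + j) := fun n j => by
    rw [hT, BlockMachine.blocksOf, h.input]
  have hT1 : ∀ n, T n 1 1 = w n := fun n => h.cells n
  have hT5 : T 0 1 5 = false := h.flag
  have hclean := clean_phase (z := z) (α := α) (q := q) (T := T)
    (encode_eq (M := universal) hq h.head) (by rcases hq' with rfl | ⟨rfl, -⟩ <;> simp) (by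
      rcases hq' with rfl | ⟨rfl, hF⟩
      · rfl
      · have hF' : T 0 1 4 = true := hF
        simp [uTrans, hF', hT5])
  set T₁ : ℕ → Block := fun n => cleanBlock (T n) with hT₁
  -- The phase bit is switched on when the machine leaves the limit state, so the rules start from
  -- `T₂`.
  set T₂ := Function.update T₁ 0 ((T₁ 0).set 1 4 true) with hT₂
  have hT₂' : ∀ n i j, ¬ (i = 1 ∧ j = 4) → T₂ n i j = T₁ n i j := by
    intro n i j hij
    by_cases hn : n = 0
    · subst hn
      rw [hT₂, Function.update_self, Block.set, if_neg hij]
    · rw [hT₂, Function.update_of_ne hn]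
  have hkeep : ∀ n i j, i ≠ 1 ∨ j = 5 → T₂ n i j = T n i j := by
    intro n i j hij
    rw [hT₂' n i j (by rintro ⟨rfl, rfl⟩; simp at hij)]
    simp only [hT₁, cleanBlock]
    rw [if_neg, if_neg]
    · rintro ⟨rfl, h⟩
      rcases hij with h' | rfl
      · exact h' rfl
      · simp at h
    · rintro ⟨rfl, rfl⟩
      simp at hij
  have hinstr : ∀ n, instrAt (T₂ n) = P n := by
    intro n
    rw [instrAt]
    have : (fun l : Fin 8 => T₂ n 0 (Fin.ofNat 16 (2 * l + 1))) = (P n).code := by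
      funext l
      have hl : (Fin.ofNat 16 (2 * l.1 + 1)).1 = 2 * l.1 + 1 := by
        simp [Fin.ofNat]; omega
      rw [hkeep _ _ _ (Or.inl (by simp)), hT0, hl, hz, joinReal, if_neg (by omega), hc]
      have h1 : (16 * n + (2 * l.1 + 1)) / 2 = 8 * n + l.1 := by omega
      have h2 : (8 * n + l.1) / 8 = n := by omega
      have h3 : Fin.ofNat 8 (8 * n + l.1) = l := by ext; simp [Fin.ofNat]
      simp only [h1, h2, h3]
    rw [this]
    exact Function.leftInverse_invFun Instr.code_injective (P n)
  have hfits : Fits x w T₂ := by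
    constructor
    · intro p
      have hl : (Fin.ofNat 16 (2 * (p % 8))).1 = 2 * (p % 8) := by
        simp [Fin.ofNat]; omega
      rw [hkeep _ _ _ (Or.inl (by simp)), hT0, hl, hz, joinReal, if_pos (by omega)]
      congr 1
      omega
    · intro k
      rw [hT₂' k 1 0 (by simp), ← hT1]
      simp [hT₁, cleanBlock]
  obtain ⟨T₃, hT₃, hrun⟩ := run_phase (z := z) (α := α + Ordinal.omega0) (T := T₁) hclean.1
    (by simp [hT₁, cleanBlock]) (by simp [hT₁, cleanBlock]) (by simp [hT₁, cleanBlock])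
    (R := applyRules ρ T₂) fun c hc => hP T₂ c hinstr hc
  have hcells : ∀ n m, applyRules ρ T₂ m n 1 1 = true → N.step x w n = true := by
    intro n m hm
    by_contra hne
    rw [applyRules_of_not_written hsep, hT₂' _ _ _ (by simp)] at hm
    · simp [hT₁, cleanBlock] at hm
    · intro m' hen hloc
      have := hρ m'
      generalize ρ m' = r at *
      cases this with
      | update k A B hk =>
        obtain ⟨rfl, -⟩ := hloc
        obtain ⟨h1, h2⟩ := (enabled_update_iff hfits).1 hen
        exact hne (hk x w h1 h2)
      | output p b => simp at hloc
      | flag => simp at hloc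
  have hcells' : ∀ n, N.step x w n = true → ∃ m₀, ∀ m, m₀ ≤ m → applyRules ρ T₂ m n 1 1 = true := by
    intro n hn
    obtain ⟨r, hr, h1, h2, h3, h4, h5⟩ := exists_update_rule hn hfits
    obtain ⟨m₀, rfl⟩ := hρs r hr
    refine ⟨m₀ + 1, fun m hm => applyRules_of_written hsep ?_ h1 ⟨h2, h3, h4⟩ hm⟩
    intro m' _ _ ht hc
    have := hρ m'
    generalize ρ m' = r at *
    cases this with
    | update k A B hk => rfl
    | output p b => simp at ht
    | flag => simp at hc
  have hflag : ∀ m, applyRules ρ T₂ m 0 1 5 = true → w N.flag = true := by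
    intro m hm
    by_contra hne
    rw [applyRules_of_not_written hsep, hkeep _ _ _ (Or.inr rfl), hT5] at hm
    · exact absurd hm (by simp)
    · intro m' hen hloc
      have := hρ m'
      generalize ρ m' = r at *
      cases this with
      | update k A B hk => simp at hloc
      | output p b => simp at hloc
      | flag => exact hne ((enabled_cellTest_iff hfits).1 hen)
  have hflag' : w N.flag = true → ∃ m₀, ∀ m, m₀ ≤ m → applyRules ρ T₂ m 0 1 5 = true := by
    intro hw
    obtain ⟨m₀, hm₀⟩ := hρs _ (IsRule.flag (N := N))
    refine ⟨m₀ + 1, fun m hm => applyRules_of_written hsep ?_ (m₀ := m₀) ?_ ?_ hm⟩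
    · intro m' _ _ ht hc
      have := hρ m'
      generalize ρ m' = r at *
      cases this with
      | update k A B hk => rfl
      | output p b => simp at ht
      | flag => rfl
    · rw [hm₀, enabled_cellTest_iff hfits]; exact hw
    · rw [hm₀]; exact ⟨rfl, rfl, rfl⟩
  have hout : ∀ p m, (ρ m).Enabled T₂ → (ρ m).block = p / 16 → (ρ m).track = 2 →
      (ρ m).cell = Fin.ofNat 16 p → (ρ m).value = w (N.out p) := by
    intro p m hen hb ht hc
    have := hρ m
    generalize ρ m = r at *
    cases this with
    | update k A B hk => simp at ht
    | output p' b =>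
      have hp : p' = p := by
        have := congrArg Fin.val hc
        simp only [Fin.ofNat] at this hb
        omega
      subst hp
      exact ((enabled_cellTest_iff hfits).1 hen).symm
    | flag => simp at ht
  have hout' : ∀ p, ∃ m₀, ∀ m, m₀ ≤ m →
      applyRules ρ T₂ m (p / 16) 2 (Fin.ofNat 16 p) = w (N.out p) := by
    intro p
    obtain ⟨m₀, hm₀⟩ := hρs _ (IsRule.output (N := N) p (w (N.out p)))
    refine ⟨m₀ + 1, fun m hm => applyRules_of_written hsep (hout p) (m₀ := m₀) ?_ ?_ hm⟩
    · rw [hm₀, enabled_cellTest_iff hfits]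
    · rw [hm₀]; exact ⟨rfl, rfl, rfl⟩
  have hphase : ∀ m, applyRules ρ T₂ m 0 1 4 = true := by
    intro m
    rw [applyRules_of_not_written hsep]
    · rw [hT₂, Function.update_self]; simp [Block.set]
    · intro m' _ hloc
      have := hρ m'
      generalize ρ m' = r at *
      cases this <;> simp at hloc
  have hin : ∀ m n j, applyRules ρ T₂ m n 0 j = T n 0 j := by
    intro m n j
    rw [applyRules_input fun m => (hρ m).wellFormed, hkeep _ _ _ (Or.inl (by simp))]
  have hraw : ∀ τ i p, (universal.toITTM.run z τ).tape i p =
      BlockMachine.blocksOf (universal.toITTM.run z τ).tape (p / 16) i (Fin.ofNat 16 p) := by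
    intro τ i p
    exact (congrFun (congrFun (BlockMachine.flatten_blocksOf _) i) p).symm
  have hinput : ∀ τ, (∀ n j, BlockMachine.blocksOf (universal.toITTM.run z τ).tape n 0 j = T n 0 j) →
      (universal.toITTM.run z τ).tape 0 = z := by
    intro τ hτ
    refine Eq.trans ?_ h.input
    funext p
    rw [hraw τ, hτ, hraw α]
  constructor
  · have hb : ∀ n i j, (universal.toITTM.run z (α + Ordinal.omega0 + Ordinal.omega0)).tape i
        (16 * n + (j : Fin 16).1) = T₃ n i j := by
      intro n i j
      rw [hT₃]
      exact congrFun (congrFun (congrFun (BlockMachine.blocksOf_flatten T₃) n) i) j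
    refine ⟨by rw [hT₃]; rfl, ?_, by rw [hT₃]; rfl, ?_, fun n => ?_, ?_, fun p => ?_⟩
    · rw [← (hrun 0 1 4 (by simp)).1 true ⟨0, fun m _ => hphase m⟩]
      exact hb 0 1 4
    · refine hinput _ fun n j => ?_
      rw [BlockMachine.blocksOf, hb]
      exact (hrun n 0 j (by simp)).1 _ ⟨0, fun m _ => hin m n j⟩
    · refine (hb n 1 1).trans ((hrun n 1 1 (by simp)).1 _ ?_)
      cases hn : N.step x w n with
      | true => exact hcells' n hn
      | false =>
        refine ⟨0, fun m _ => ?_⟩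
        rw [Bool.eq_false_iff]
        intro hm
        rw [hcells n m hm] at hn
        exact absurd hn (by simp)
    · refine (hb 0 1 5).trans ((hrun 0 1 5 (by simp)).1 _ ?_)
      cases hn : w N.flag with
      | true => exact hflag' hn
      | false =>
        refine ⟨0, fun m _ => ?_⟩
        rw [Bool.eq_false_iff]
        intro hm
        rw [hflag m hm] at hn
        exact absurd hn (by simp)
    · rw [hraw, BlockMachine.blocksOf, hb]
      exact (hrun _ _ _ (by simp)).1 _ (hout' p)
  · intro τ h1 h2
    rcases lt_or_ge τ (α + Ordinal.omega0) with h3 | h3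
    · obtain ⟨s, hs⟩ := Ordinal.lt_omega0.1 (show τ - α < Ordinal.omega0 by
        rwa [Ordinal.sub_lt_of_le h1])
      have hτ : τ = α + (s : ℕ) := by rw [← hs, Ordinal.add_sub_cancel_of_le h1]
      have hb := hclean.2 s
      rw [← hτ] at hb
      refine ⟨hinput τ fun n j => ?_, fun n hn => ?_, fun hn => ?_, fun p => ?_⟩
      · rcases hb n 0 j with h | h <;> rw [h]
        simp [cleanBlock]
      · rcases hb n 1 1 with h | h
        · left
          rw [← hT1, ← h]; exact hn
        · have := h.symm.trans hn
          simp [cleanBlock] at this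
      · rcases hb 0 1 5 with h | h
        · have := h.symm.trans hn
          rw [hT5] at this
          exact absurd this (by simp)
        · have := h.symm.trans hn
          simp [cleanBlock, hT5] at this
      · left
        rw [hraw τ, hraw α]
        rcases hb (p / 16) 2 (Fin.ofNat 16 p) with h | h <;> rw [h]
        simp [cleanBlock, hT]
    · obtain ⟨s, hs⟩ := Ordinal.lt_omega0.1 (show τ - (α + Ordinal.omega0) < Ordinal.omega0 by
        rwa [Ordinal.sub_lt_of_le h3])
      have hτ : τ = α + Ordinal.omega0 + (s : ℕ) := by rw [← hs, Ordinal.add_sub_cancel_of_le h3]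
      have hb := fun n i j hij => (hrun n i j hij).2 s
      rw [← hτ] at hb
      refine ⟨hinput τ fun n j => ?_, fun n hn => ?_, fun hn => ?_, fun p => ?_⟩
      · rcases hb n 0 j (by simp) with h | ⟨m, h⟩ <;> rw [h]
        · simp [hT₁, cleanBlock]
        · exact hin m n j
      · rcases hb n 1 1 (by simp) with h | ⟨m, h⟩
        · have := h.symm.trans hn
          simp [hT₁, cleanBlock] at this
        · exact Or.inr (hcells n m (h.symm.trans hn))
      · rcases hb 0 1 5 (by simp) with h | ⟨m, h⟩
        · have := h.symm.trans hn
          simp [hT₁, cleanBlock, hT5] at this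
        · exact hflag m (h.symm.trans hn)
      · rw [hraw τ, hraw α]
        rcases hb (p / 16) 2 (Fin.ofNat 16 p) (by simp) with h | ⟨m, h⟩ <;> rw [h]
        · left
          simp [hT₁, cleanBlock, hT]
        · have := applyRules_eq_or hsep (hout p) m
          rwa [hkeep _ _ _ (Or.inl (by simp))] at this

end OpenNetwork

/-! ### Transfinitely many network steps on the universal machine -/

/-- A network under a given input signal has an evolution. -/
theorem exists_drives {κ : Type} (step : Real2 → (κ → Bool) → κ → Bool)
    (v : Ordinal.{0} → Real2) : ∃ u, Drives step v u := by
  classical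
  let L : ∀ l : Ordinal.{0}, Order.IsSuccLimit l → (∀ β < l, κ → Bool) → κ → Bool :=
    fun l _ h k => decide (∀ β < l, ∃ γ, ∃ hγ : γ < l, β ≤ γ ∧ h γ hγ k = true)
  let u : Ordinal.{0} → κ → Bool := fun α =>
    Ordinal.limitRecOn α (fun _ => false) (fun β c => step (v β) c) L
  have hlim : ∀ l, (hl : Order.IsSuccLimit l) → u l = L l hl fun β _ => u β := fun l hl =>
    Ordinal.limitRecOn_limit _ _ _ _ hl
  refine ⟨u, Ordinal.limitRecOn_zero _ _ _, fun β => Ordinal.limitRecOn_add_one _ _ _ _, ?_⟩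
  intro l hl k
  rw [hlim l hl]
  simp only [L, decide_eq_true_eq, exists_prop]

namespace OpenNetwork

open universal

variable {N : OpenNetwork}

/-- The stage of the universal machine at which it begins the given step of the network. -/
def stage (β : Ordinal.{0}) : Ordinal.{0} := (Ordinal.omega0 + Ordinal.omega0) * β

theorem stage_add_one (β : Ordinal.{0}) :
    stage (β + 1) = stage β + Ordinal.omega0 + Ordinal.omega0 := by
  rw [stage, ← Order.succ_eq_add_one, Ordinal.mul_succ, add_assoc, stage]

theorem omega0_add_omega0_pos : 0 < Ordinal.omega0.{0} + Ordinal.omega0 :=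
  Ordinal.omega0_pos.trans_le le_self_add

theorem stage_le_stage {β γ : Ordinal.{0}} : stage β ≤ stage γ ↔ β ≤ γ :=
  mul_le_mul_iff_right₀ omega0_add_omega0_pos

theorem stage_lt_stage {β γ : Ordinal.{0}} : stage β < stage γ ↔ β < γ :=
  mul_lt_mul_iff_right₀ omega0_add_omega0_pos

theorem isSuccLimit_stage {l : Ordinal.{0}} (hl : Order.IsSuccLimit l) :
    Order.IsSuccLimit (stage l) :=
  Ordinal.isSuccLimit_mul_right omega0_add_omega0_pos hl

theorem exists_stage (τ : Ordinal.{0}) : ∃ β, stage β ≤ τ ∧ τ < stage (β + 1) :=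
  ⟨_, Ordinal.mul_div_le τ _, by
    rw [← Order.succ_eq_add_one]
    exact Ordinal.lt_mul_succ_div τ omega0_add_omega0_pos.ne'⟩

theorem Entry.of_exit {z : Real2} {α : Ordinal.{0}} {w w' : Real2} (h : N.Exit z α w w')
    (hw : w N.flag = false) : Entry z α w' :=
  ⟨⟨.limit, h.state, Or.inr ⟨rfl, h.phase⟩⟩, h.head, h.input, h.cells, h.flag.trans hw⟩

theorem Entry.state_ne_halt {z : Real2} {α : Ordinal.{0}} {w : Real2} (h : Entry z α w) :
    (universal.toITTM.run z α).state ≠ universal.toITTM.halt := by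
  obtain ⟨q, hq, hq'⟩ := h.state
  rw [hq]
  intro h
  have h : q = UState.halt := congrArg Prod.fst h
  subst h
  simp at hq'

section run

variable {z x : Real2} {u : Ordinal.{0} → Real2}
  (hz : ∀ (w : Real2) (α : Ordinal.{0}), Entry z α w →
      N.Exit z (α + Ordinal.omega0 + Ordinal.omega0) w (N.step x w) ∧
      ∀ τ, α ≤ τ → τ < α + Ordinal.omega0 + Ordinal.omega0 → N.During z α τ w (N.step x w))
  (hu : Drives N.step (fun _ => x) u)

include hz hu

theorem Entry.exit {β : Ordinal.{0}} (h : Entry z (stage β) (u β)) :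
    N.Exit z (stage (β + 1)) (u β) (u (β + 1)) := by
  rw [stage_add_one, hu.succ]
  exact (hz _ _ h).1

theorem Entry.during {β τ : Ordinal.{0}} (h : Entry z (stage β) (u β)) (h1 : stage β ≤ τ)
    (h2 : τ < stage (β + 1)) : N.During z (stage β) τ (u β) (u (β + 1)) := by
  rw [stage_add_one] at h2
  rw [hu.succ]
  exact (hz _ _ h).2 τ h1 h2

/-- The universal machine carries out the steps of the network as long as its flag is off. -/
theorem entry_stage (β : Ordinal.{0}) (hβ : ∀ γ < β, u γ N.flag = false) :
    Entry z (stage β) (u β) := by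
  induction β using Ordinal.limitRecOn with
  | zero =>
    rw [stage, mul_zero, hu.zero]
    have h0 := universal.toITTM.run_zero z
    constructor
    · rw [h0]; exact ⟨.start, rfl, Or.inl rfl⟩
    · rw [h0]; rfl
    · rw [h0]; rfl
    · rw [h0]; intro n; rfl
    · rw [h0]; rfl
  | add_one β ih =>
    have h := ih fun γ hγ => hβ γ (hγ.trans (lt_add_one β))
    exact Entry.of_exit (h.exit hz hu) (hβ β (lt_add_one β))
  | limit l hl ih =>
    replace ih : ∀ β < l, Entry z (stage β) (u β) := fun β h =>
      ih β h fun γ hγ => hβ γ (hγ.trans h)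
    have hfind : ∀ τ < stage l, ∃ β < l, stage β ≤ τ ∧ τ < stage (β + 1) ∧
        N.During z (stage β) τ (u β) (u (β + 1)) := by
      intro τ hτ
      obtain ⟨β, h1, h2⟩ := exists_stage τ
      have h3 := stage_lt_stage.1 (h1.trans_lt hτ)
      exact ⟨β, h3, h1, h2, (ih β h3).during hz hu h1 h2⟩
    have hstate : ∀ τ < stage l, (universal.toITTM.run z τ).state ≠ universal.toITTM.halt := by
      intro τ hτ h
      obtain ⟨β, h1, -, h2, -⟩ := hfind τ hτ
      exact (ih _ (hl.add_one_lt h1)).state_ne_halt (universal.toITTM.run_of_halt h _ h2.le).1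
    have hst := universal.toITTM.run_limit_state_of_not_halt z (isSuccLimit_stage hl) hstate
    have hlim := universal.toITTM.isLimsupSignal_tape z _ (isSuccLimit_stage hl)
    have hpos : 0 < stage l := (isSuccLimit_stage hl).bot_lt
    refine ⟨⟨.limit, hst.1, Or.inr ⟨rfl, ?_⟩⟩, hst.2, ?_, fun n => ?_, ?_⟩
    -- Every completed network step ends with the phase on, and such ends are cofinal.
    · refine (hlim (1, 4)).2 fun τ hτ => ?_
      obtain ⟨β, h1, -, h2, -⟩ := hfind τ hτ
      exact ⟨_, stage_lt_stage.2 (hl.add_one_lt h1), h2.le, ((ih β h1).exit hz hu).phase⟩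
    · funext n
      refine hlim.eq_of_eventually (k := (0, n)) hpos fun τ _ hτ => ?_
      obtain ⟨β, -, -, -, h⟩ := hfind τ hτ
      exact congrFun h.input n
    -- The limsup over machine stages agrees with the limsup over network steps: a bit seen on
    -- within step `β'` is on in the network at `β'` or `β' + 1`, and conversely each network value
    -- is on the tape at the start of its step.
    · rw [Bool.eq_iff_iff]
      refine (hlim (1, 16 * n + 1)).trans (Iff.trans ?_ (hu.limit l hl n).symm)
      constructor
      · intro h β hβl
        obtain ⟨τ, h1, h2, h3⟩ := h _ (stage_lt_stage.2 hβl)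
        obtain ⟨β', h4, h5, h6, h7⟩ := hfind τ h1
        have h8 : β ≤ β' := Order.lt_succ_iff.1 (by
          rw [Order.succ_eq_add_one]
          exact stage_lt_stage.1 (h2.trans_lt h6))
        rcases h7.cells n h3 with h | h
        · exact ⟨β', h4, h8, h⟩
        · exact ⟨β' + 1, hl.add_one_lt h4, h8.trans (lt_add_one β').le, h⟩
      · intro h τ hτ
        obtain ⟨β, h1, -, h2, -⟩ := hfind τ hτ
        obtain ⟨γ, h3, h4, h5⟩ := h _ (hl.add_one_lt h1)
        exact ⟨stage γ, stage_lt_stage.2 h3, h2.le.trans (stage_le_stage.2 h4),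
          ((ih γ h3).cells n).trans h5⟩
    · refine hlim.eq_of_eventually (k := (1, 5)) hpos fun τ _ hτ => ?_
      obtain ⟨β, h1, -, -, h⟩ := hfind τ hτ
      rw [Bool.eq_false_iff]
      intro h'
      have := h.flag h'
      rw [hβ β h1] at this
      exact absurd this (by simp)

/-- While the flag is off, the output tape shows the eventual values of the output cells. -/
theorem output_eventually (hf : ∀ β, u β N.flag = false) {γ : Ordinal.{0}} {p : ℕ} {b : Bool}
    (hγ : ∀ β, γ ≤ β → u β (N.out p) = b) :
    ∀ τ, stage (γ + 1) ≤ τ → (universal.toITTM.run z τ).tape 2 p = b := by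
  have hE := fun β => entry_stage hz hu β fun γ _ => hf γ
  have hle : ∀ {β τ}, stage (γ + 1) ≤ τ → τ < stage (β + 1) → γ + 1 ≤ β := fun h1 h2 =>
    Order.lt_succ_iff.1 (by
      rw [Order.succ_eq_add_one]
      exact stage_lt_stage.1 (h1.trans_lt h2))
  have key : ∀ β, γ + 1 ≤ β → (universal.toITTM.run z (stage β)).tape 2 p = b →
      ∀ τ, stage β ≤ τ → τ < stage (β + 1) → (universal.toITTM.run z τ).tape 2 p = b := by
    intro β hβ h τ h1 h2
    rcases ((hE β).during hz hu h1 h2).output p with h3 | h3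
    · rw [h3, h]
    · rw [h3, hγ β (le_self_add.trans hβ)]
  have hst : ∀ β, γ + 1 ≤ β → (universal.toITTM.run z (stage β)).tape 2 p = b := by
    apply Ordinal.induction_ge
    · rw [((hE γ).exit hz hu).output, hγ γ le_rfl]
    · intro β hβ _
      rw [((hE β).exit hz hu).output, hγ β (le_self_add.trans hβ)]
    · intro l hl hlt ih
      refine (universal.toITTM.isLimsupSignal_tape z _ (isSuccLimit_stage hl)).eq_of_eventually
        (k := (2, p)) (stage_lt_stage.2 hlt) fun τ h1 h2 => ?_
      obtain ⟨β, h3, h4⟩ := exists_stage τ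
      exact key β (hle h1 h4) (ih β (hle h1 h4) (stage_lt_stage.1 (h3.trans_lt h2))) τ h3 h4
  intro τ hτ
  obtain ⟨β, h3, h4⟩ := exists_stage τ
  exact key β (hle hτ h4) (hst β (hle hτ h4)) τ h3 h4

/-- When the flag comes on, the machine halts, the output tape showing the output cells. -/
theorem computes_of_flag {β : Ordinal.{0}} (hβ : ∀ γ < β, u γ N.flag = false)
    (hf : u β N.flag = true) : universal.toITTM.Computes z fun p => u β (N.out p) := by
  have h := (entry_stage hz hu β hβ).exit hz hu
  obtain ⟨T, hT⟩ : ∃ T, T = BlockMachine.blocksOf (universal.toITTM.run z (stage (β + 1))).tape :=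
    ⟨_, rfl⟩
  have hrun := universal.encode_eq (M := universal) h.state h.head
  rw [← hT] at hrun
  have h4 : T 0 1 4 = true := by rw [hT]; exact h.phase
  have h5 : T 0 1 5 = true := by rw [hT]; exact h.flag.trans hf
  -- The flag is noticed at the limit that ends the step; one more block step leads to the halt
  -- state without changing the tape.
  have hnext := (universal.run_micro (fun h => UState.noConfusion h) hrun).2
  have hu' : universal.next ⟨UState.limit, 0, T⟩ = ⟨UState.halt, 1, T⟩ := by
    have : universal.trans UState.limit (T 0) = (.halt, T 0, .right) := by
      show uTrans .limit (T 0) = (UState.halt, T 0, Turing.Dir.right)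
      simp [uTrans, h4, h5]
    simp only [BlockMachine.next, this, ITTM.moveHead, Function.update_eq_self]
  rw [hu'] at hnext
  refine ⟨_, by rw [hnext]; rfl, ?_⟩
  rw [hnext]
  funext p
  refine Eq.trans ?_ (h.output p)
  show BlockMachine.flatten T 2 p = _
  rw [hT, BlockMachine.flatten_blocksOf]

end run

theorem eventuallyComputable {f : Real2 → Real2}
    (h : ∀ x u, Drives N.step (fun _ => x) u → (∀ β, u β N.flag = false) ∧
      ∃ γ, ∀ β, γ ≤ β → ∀ p, u β (N.out p) = f x p) : EventuallyComputable f := by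
  obtain ⟨c, hc⟩ := N.exists_parameter
  refine ⟨universal.toITTM, c, fun x => ?_⟩
  obtain ⟨u, hu⟩ := exists_drives N.step fun _ => x
  obtain ⟨h1, γ, h2⟩ := h x u hu
  exact ⟨stage (γ + 1), fun τ hτ => funext fun p =>
    output_eventually (hc x) hu h1 (fun β hβ => h2 β hβ p) τ hτ⟩

theorem infTimeComputable {f : Real2 → Real2}
    (h : ∀ x u, Drives N.step (fun _ => x) u → (∃ β, u β N.flag = true) ∧
      ∀ β, u β N.flag = true → ∀ p, u β (N.out p) = f x p) : InfTimeComputable f := by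
  obtain ⟨c, hc⟩ := N.exists_parameter
  refine ⟨universal.toITTM, c, fun x => ?_⟩
  obtain ⟨u, hu⟩ := exists_drives N.step fun _ => x
  obtain ⟨h1, h2⟩ := h x u hu
  obtain ⟨β, hβ, hmin⟩ := WellFounded.has_min (wellFounded_lt (α := Ordinal.{0}))
    {β | u β N.flag = true} h1
  rw [← funext (h2 β hβ)]
  exact computes_of_flag (hc x) hu
    (fun γ hγ => Bool.eq_false_iff.2 fun h => hmin γ h hγ) hβ

end OpenNetwork

/-! ### From realizability back to machines, and the detection of rest -/

namespace OpenNetwork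

variable {κ : Type} {step : Real2 → (κ → Bool) → κ → Bool}

/-- A network with countably many cells, the cells being numbered, together with countably many
cells that stay off. -/
def ofCells (ho : ∀ k, IsOpen {p : Real2 × (κ → Bool) | step p.1 p.2 k = true}) (out : ℕ → κ)
    (e : κ ⊕ ℕ ≃ ℕ) (flag : κ ⊕ ℕ) : OpenNetwork where
  step x w k := Sum.elim (step x fun j => w (e (Sum.inl j))) (fun _ => false) (e.symm k)
  isOpen_step k := by
    rcases e.symm k with k | k
    · exact (ho k).preimage (f := fun p : Real2 × Real2 =>
        (p.1, fun j : κ => p.2 (e (Sum.inl j)))) (by fun_prop)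
    · simp
  out n := e (Sum.inl (out n))
  flag := e flag

variable {ho : ∀ k, IsOpen {p : Real2 × (κ → Bool) | step p.1 p.2 k = true}} {out : ℕ → κ}
  {e : κ ⊕ ℕ ≃ ℕ} {flag : κ ⊕ ℕ} {v : Ordinal.{0} → Real2} {u : Ordinal.{0} → Real2}

theorem drives_of_ofCells (hu : Drives (ofCells ho out e flag).step v u) :
    Drives step v fun β j => u β (e (Sum.inl j)) :=
  ⟨by rw [hu.zero], fun β => by rw [hu.succ]; funext j; simp [ofCells], hu.limit.comp _⟩

theorem ofCells_dummy (hu : Drives (ofCells ho out e flag).step v u) (n : ℕ) (β : Ordinal.{0}) :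
    u β (e (Sum.inr n)) = false := by
  refine Ordinal.induction_ge (P := fun β => u β (e (Sum.inr n)) = false) (γ := 0) ?_ ?_ ?_ β zero_le
  · rw [hu.zero]
  · intro β _ _
    rw [hu.succ]
    simp [ofCells]
  · intro l hl hlt ih
    exact (hu.limit l hl).eq_of_eventually hlt fun γ h1 h2 => ih γ h1 h2

end OpenNetwork

theorem Realizable.eventuallyComputable {f : Real2 → Real2} (hf : Realizable False f) :
    EventuallyComputable f := by
  obtain ⟨κ, hκ, step, out, ho, hf⟩ := hf
  -- The additional cells make the index set infinite; one of them, always off, serves as the flag.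
  obtain ⟨e⟩ := nonempty_equiv_of_countable (α := κ ⊕ ℕ) (β := ℕ)
  refine OpenNetwork.eventuallyComputable (N := .ofCells ho out e (Sum.inr 0)) fun x u hu => ?_
  obtain ⟨γ, hγ, -⟩ := hf _ _ (isLimsupSignal_const x) (OpenNetwork.drives_of_ofCells hu) x 0
    fun _ _ => rfl
  exact ⟨OpenNetwork.ofCells_dummy hu 0, γ, hγ⟩

/-- The network `step`, supplemented by cells that detect whether it has come to rest: a delayed copy
of all cells, a cell that shows whether the two copies differ, a delayed copy of this cell, two
cells that come on at the beginning, and a cell that signals rest. -/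
def restStep {κ : Type} (step : Real2 → (κ → Bool) → κ → Bool) (x : Real2)
    (u : κ ⊕ κ ⊕ Fin 5 → Bool) : κ ⊕ κ ⊕ Fin 5 → Bool :=
  open Classical in
  Sum.elim (step x (u ∘ Sum.inl)) (Sum.elim (u ∘ Sum.inl) ![
    decide (∃ k, u (.inl k) ≠ u (.inr (.inl k))),
    u (.inr (.inr 0)),
    true,
    u (.inr (.inr 2)),
    !u (.inr (.inr 0)) && !u (.inr (.inr 1)) && u (.inr (.inr 3))])

theorem isOpen_restStep {κ : Type} {step : Real2 → (κ → Bool) → κ → Bool}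
    (ho : ∀ k, IsOpen {p : Real2 × (κ → Bool) | step p.1 p.2 k = true}) (k : κ ⊕ κ ⊕ Fin 5) :
    IsOpen {p : Real2 × (κ ⊕ κ ⊕ Fin 5 → Bool) | restStep step p.1 p.2 k = true} := by
  rcases k with k | k | i
  · exact (ho k).preimage (f := fun p : Real2 × (κ ⊕ κ ⊕ Fin 5 → Bool) =>
      (p.1, p.2 ∘ Sum.inl)) (by fun_prop)
  · exact Continuous.isOpen_eq_const (f := fun p : Real2 × (κ ⊕ κ ⊕ Fin 5 → Bool) =>
      p.2 (.inl k)) (by fun_prop) true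
  · fin_cases i
    · have : {p : Real2 × (κ ⊕ κ ⊕ Fin 5 → Bool) | restStep step p.1 p.2 (.inr (.inr 0)) = true} =
          ⋃ k, {p | (fun b : Bool × Bool => decide (b.1 ≠ b.2))
            (p.2 (.inl k), p.2 (.inr (.inl k))) = true} := by
        ext p
        simp [restStep]
      exact this ▸ isOpen_iUnion fun k => Continuous.isOpen_eq_const
        (f := fun p : Real2 × (κ ⊕ κ ⊕ Fin 5 → Bool) => (fun b : Bool × Bool => decide (b.1 ≠ b.2))
          (p.2 (.inl k), p.2 (.inr (.inl k))))
        ((continuous_of_discreteTopology (f := fun b : Bool × Bool => decide (b.1 ≠ b.2))).comp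
          (g := fun b : Bool × Bool => decide (b.1 ≠ b.2)) (by fun_prop)) true
    · exact Continuous.isOpen_eq_const (f := fun p : Real2 × (κ ⊕ κ ⊕ Fin 5 → Bool) =>
        p.2 (.inr (.inr 0))) (by fun_prop) true
    · simp [restStep]
    · exact Continuous.isOpen_eq_const (f := fun p : Real2 × (κ ⊕ κ ⊕ Fin 5 → Bool) =>
        p.2 (.inr (.inr 2))) (by fun_prop) true
    · exact Continuous.isOpen_eq_const (f := fun p : Real2 × (κ ⊕ κ ⊕ Fin 5 → Bool) =>
        (fun b : Bool × Bool × Bool => !b.1 && !b.2.1 && b.2.2)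
          (p.2 (.inr (.inr 0)), p.2 (.inr (.inr 1)), p.2 (.inr (.inr 3))))
        ((continuous_of_discreteTopology
          (f := fun b : Bool × Bool × Bool => !b.1 && !b.2.1 && b.2.2)).comp
          (g := fun b : Bool × Bool × Bool => !b.1 && !b.2.1 && b.2.2) (by fun_prop)) true

section rest

variable {κ : Type} {step : Real2 → (κ → Bool) → κ → Bool} {x : Real2}
  {u : Ordinal.{0} → κ ⊕ κ ⊕ Fin 5 → Bool}

theorem Drives.constant {s : Ordinal.{0} → κ → Bool} (hs : Drives step (fun _ => x) s)
    {β : Ordinal.{0}} (h : s (β + 1) = s β) : ∀ γ, β ≤ γ → s γ = s β := by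
  apply Ordinal.induction_ge (P := fun γ => s γ = s β) rfl
  · intro γ _ ih
    rw [hs.succ, ih, ← hs.succ, h]
  · intro l hl hlt ih
    funext k
    exact (hs.limit l hl).eq_of_eventually hlt fun γ h1 h2 => by rw [ih γ h1 h2]

theorem Drives.of_restStep (hu : Drives (restStep step) (fun _ => x) u) :
    Drives step (fun _ => x) fun β => u β ∘ Sum.inl :=
  ⟨by rw [hu.zero]; rfl, fun β => by rw [hu.succ]; rfl, hu.limit.comp _⟩

/-- The copy lags behind by one stage. The comparison is meaningful only two stages after `β`: right
after a limit it is blind, since cells and copies have the same limsup there. -/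
theorem Drives.restStep_change_iff (hu : Drives (restStep step) (fun _ => x) u) (β : Ordinal.{0}) :
    u (β + 1 + 1) (.inr (.inr 0)) = false ↔ u (β + 1) ∘ Sum.inl = u β ∘ Sum.inl := by
  have h : u (β + 1) ∘ (Sum.inr ∘ Sum.inl) = u β ∘ Sum.inl := by rw [hu.succ]; rfl
  rw [← h, hu.succ (β + 1)]
  simp [restStep, funext_iff]

/-- When the last cell is on the network is at rest. -/
theorem Drives.rest_of_flag (hu : Drives (restStep step) (fun _ => x) u) (β : Ordinal.{0})
    (hβ : u β (.inr (.inr 4)) = true) : ∀ γ, β ≤ γ → u γ ∘ Sum.inl = u β ∘ Sum.inl := by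
  suffices ∃ δ ≤ β, ∀ γ, δ ≤ γ → u γ ∘ Sum.inl = u δ ∘ Sum.inl by
    obtain ⟨δ, h1, h2⟩ := this
    intro γ hγ
    rw [h2 γ (h1.trans hγ), h2 β h1]
  have hfix : ∀ δ, u (δ + 1 + 1) (.inr (.inr 0)) = false →
      ∀ γ, δ ≤ γ → u γ ∘ Sum.inl = u δ ∘ Sum.inl := fun δ h =>
    hu.of_restStep.constant ((hu.restStep_change_iff δ).1 h)
  -- If the change cell is off at a limit, it was off on a final segment below, which contains a
  -- meaningful comparison.
  have hlim : ∀ l, Order.IsSuccLimit l → u l (.inr (.inr 0)) = false →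
      ∃ δ ≤ l, ∀ γ, δ ≤ γ → u γ ∘ Sum.inl = u δ ∘ Sum.inl := by
    intro l hl h
    have := mt (hu.limit l hl (.inr (.inr 0))).2 (by simp [h])
    push Not at this
    obtain ⟨δ, hδ, h'⟩ := this
    have hle : δ ≤ δ + 1 + 1 := le_self_add.trans le_self_add
    exact ⟨δ, hδ.le, hfix δ (Bool.eq_false_iff.2
      (h' _ (hl.add_one_lt (hl.add_one_lt hδ)) hle))⟩
  induction β using Ordinal.limitRecOn with
  | zero => rw [hu.zero] at hβ; exact absurd hβ (by simp)
  -- The flag is on at a limit only if it was on before.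
  | limit l hl ih =>
    obtain ⟨γ, h1, -, h2⟩ := (hu.limit l hl _).1 hβ 0 hl.bot_lt
    obtain ⟨δ, h3, h4⟩ := ih γ h1 h2
    exact ⟨δ, h3.trans h1.le, h4⟩
  | add_one β _ =>
    rw [hu.succ] at hβ
    have hβ : ((!u β (.inr (.inr 0)) && !u β (.inr (.inr 1))) && u β (.inr (.inr 3))) = true := hβ
    simp only [Bool.and_eq_true, Bool.not_eq_true'] at hβ
    obtain ⟨⟨h0, h1⟩, h3⟩ := hβ
    suffices ∃ δ ≤ β, ∀ γ, δ ≤ γ → u γ ∘ Sum.inl = u δ ∘ Sum.inl by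
      obtain ⟨δ, h1, h2⟩ := this
      exact ⟨δ, h1.trans le_self_add, h2⟩
    -- The comparison cell may be off for no reason at the very beginning, which the starting cells
    -- exclude, and right after a limit. In the latter case its delayed copy shows the comparison
    -- cell at the limit itself, which is reliable.
    rcases Ordinal.zero_or_succ_or_isSuccLimit β with rfl | ⟨β, rfl⟩ | hl
    · rw [hu.zero] at h3; exact absurd h3 (by simp)
    · rw [Order.succ_eq_add_one] at *
      rw [hu.succ] at h1 h3
      have h1 : u β (.inr (.inr 0)) = false := h1
      have h3 : u β (.inr (.inr 2)) = true := h3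
      rcases Ordinal.zero_or_succ_or_isSuccLimit β with rfl | ⟨β, rfl⟩ | hl
      · rw [hu.zero] at h3; exact absurd h3 (by simp)
      · rw [Order.succ_eq_add_one] at *
        exact ⟨β, le_self_add.trans le_self_add, hfix β h0⟩
      · obtain ⟨δ, h4, h5⟩ := hlim β hl h1
        exact ⟨δ, h4.trans le_self_add, h5⟩
    · exact hlim β hl h0

/-- A network that comes to rest is found to be at rest. -/
theorem Drives.flag_of_rest (hu : Drives (restStep step) (fun _ => x) u) {γ : Ordinal.{0}}
    (hγ : ∀ β, γ ≤ β → u β ∘ Sum.inl = u γ ∘ Sum.inl) :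
    u (γ + 1 + 1 + 1 + 1) (.inr (.inr 4)) = true := by
  have h1 : γ ≤ γ + 1 := le_self_add
  have h2 : γ ≤ γ + 1 + 1 := h1.trans le_self_add
  have h3 : u (γ + 1 + 1) (.inr (.inr 0)) = false :=
    (hu.restStep_change_iff γ).2 (hγ _ h1)
  have h4 : u (γ + 1 + 1 + 1) (.inr (.inr 0)) = false :=
    (hu.restStep_change_iff (γ + 1)).2 ((hγ _ h2).trans (hγ _ h1).symm)
  have h5 : u (γ + 1 + 1 + 1) (.inr (.inr 1)) = false := by rw [hu.succ]; exact h3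
  have h6 : u (γ + 1 + 1 + 1) (.inr (.inr 3)) = true := by rw [hu.succ, hu.succ]; rfl
  rw [hu.succ]
  show ((!u (γ + 1 + 1 + 1) (.inr (.inr 0)) && !u (γ + 1 + 1 + 1) (.inr (.inr 1))) &&
    u (γ + 1 + 1 + 1) (.inr (.inr 3))) = true
  rw [h4, h5, h6]
  rfl

end rest

theorem Realizable.infTimeComputable {f : Real2 → Real2} (hf : Realizable True f) :
    InfTimeComputable f := by
  obtain ⟨κ, hκ, step, out, ho, hf⟩ := hf
  obtain ⟨e⟩ := nonempty_equiv_of_countable (α := (κ ⊕ κ ⊕ Fin 5) ⊕ ℕ) (β := ℕ)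
  refine OpenNetwork.infTimeComputable (N := .ofCells (isOpen_restStep ho)
    (fun n => .inl (out n)) e (.inl (.inr (.inr 4)))) fun x u hu => ?_
  have hu' := OpenNetwork.drives_of_ofCells hu
  obtain ⟨γ, h1, h2⟩ := hf _ _ (isLimsupSignal_const x) hu'.of_restStep x 0 fun _ _ => rfl
  refine ⟨⟨_, hu'.flag_of_rest (h2 trivial)⟩, fun β hβ p => ?_⟩
  -- The flag may come on before the stage `γ`; since the network is at rest from then on, its
  -- output equals the one at the later of the two stages.
  have h3 := congrFun (hu'.rest_of_flag β hβ (max β γ) (le_max_left _ _)) (out p)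
  exact h3.symm.trans (h1 _ (le_max_right _ _) p)

/-! ### Proof of the theorem -/

theorem exists_measurable_enumerator {E : Setoid Real2} (hE : IsCountableBorel E) :
    ∃ f : Real2 → Real2, Measurable f ∧ IsEnumerator E f := by
  obtain ⟨g, hg, hr⟩ := hE.exists_enumeration
  refine ⟨fun x k => g k.unpair.1 x k.unpair.2, measurable_pi_iff.2 fun k =>
    (measurable_pi_apply _).comp (hg _), fun x => ?_⟩
  rw [← hr x]
  congr 1
  funext n m
  simp [decodeSeq]

theorem realizable_iterateTable {S : Prop} {f : Real2 → Real2} (hf : Realizable S f) :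
    Realizable S (iterateTable fun n x => decodeSeq (f x) n) := by
  have hg : ∀ n, Realizable S fun x => decodeSeq (f x) n := fun n =>
    Realizable.comp (g := fun y => decodeSeq y n)
      (measurable_pi_iff.2 fun m => measurable_pi_apply _).realizable hf
  have hfold : ∀ w : List ℕ, Realizable S fun x =>
      w.foldl (fun y n => decodeSeq (f y) n) x := by
    intro w
    induction w with
    | nil => exact measurable_id.realizable
    | cons n w ih => exact ih.comp (hg n)
  exact Realizable.pack hfold wordIndex.symm

/-- A relation with a realizable enumerator has a realizable reduction to every countable Borel
equivalence relation that is greatest with respect to Borel reductions. -/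
theorem exists_realizable_reduction {S : Prop} {E Einf : Setoid Real2} (hEinf : IsEInfty Einf)
    {f : Real2 → Real2} (hf : Realizable S f) (hE : IsEnumerator E f) :
    ∃ r : Real2 → Real2, Realizable S r ∧ IsReduction E Einf r := by
  obtain ⟨b, hb, hred⟩ := hEinf.2 _ isCountableBorel_shiftSetoid
  exact ⟨_, hb.realizable.comp (realizable_iterateTable hf),
    hred.comp (isReduction_iterateTable hE)⟩

theorem mainTheorem1 :
    (∃ Einf : Setoid Real2, IsEInfty Einf) ∧
    ∀ Einf : Setoid Real2, IsEInfty Einf →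
      (Enumerable Einf ∧ ∀ E : Setoid Real2, Enumerable E → CompReducible E Einf) ∧
      (EventuallyEnumerable Einf ∧
        ∀ E : Setoid Real2, EventuallyEnumerable E → EvtReducible E Einf) := by
  refine ⟨⟨_, isEInfty_shiftSetoid⟩, fun Einf hEinf => ?_⟩
  obtain ⟨e, he, hEe⟩ := exists_measurable_enumerator hEinf.1
  refine ⟨⟨⟨e, he.realizable.infTimeComputable, hEe⟩, ?_⟩,
    ⟨e, he.realizable.eventuallyComputable, hEe⟩, ?_⟩
  · rintro E ⟨f, hf, hE⟩
    obtain ⟨r, hr, hred⟩ := exists_realizable_reduction hEinf hf.realizable hE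
    exact ⟨r, hr.infTimeComputable, hred⟩
  · rintro E ⟨f, hf, hE⟩
    obtain ⟨r, hr, hred⟩ := exists_realizable_reduction hEinf hf.realizable hE
    exact ⟨r, hr.eventuallyComputable, hred⟩

end
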